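/- Let $K$ be a number field and let $d > 1$ and $n \ge 0$ be integers. Write $f^n$ for the $n$-th iterate of a polynomial $f$ under composition ($f^0(x)=x$), and $[S_d]^n$ for the $n$-th iterated wreath product of the symmetric group $S_d$ acting on $d$ letters: $[S_d]^0$ is trivial, and $[S_d]^{n+1} = S_d[[S_d]^n] = ([S_d]^n)^d \rtimes S_d$, where $S_d$ permutes the $d$ factors. There is a Zariski dense subset $\mathcal{H}$ of $K^d$ such that, for every monic polynomial $f(x)\in K[x]$ of degree $d$ with critical points $b_1,\dots,b_{d-1}\in K$ (listed with multiplicity, i.e. $f'(x)=d\prod_{i=1}^{d-1}(x-b_i)$) and constant term $c_0$ such that $(b_1,\dots,b_{d-1},c_0)\in\mathcal{H}$, \[ \operatorname{Gal}\bigl(K\bigl((f'\circ f^n)^{-1}(0)\bigr)/K\bigr)\;\cong\;\prod_{i=1}^{d-1}[S_d]^n , \] where $K((f'\circ f^n)^{-1}(0))$ is the field generated over $K$ by all roots of $f'\circ f^n$ in an algebraic closure of $K$. -/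

import Mathlib

/-- The permutational wreath product `S_d[G]`: the semidirect product of `G ^ d` by the symmetric
group `S_d`, which permutes the `d` factors. -/
abbrev SymWreath (d : ℕ) (G : Type) [Group G] : Type :=
  (Fin d → G) ⋊[mulAutArrow] Equiv.Perm (Fin d)

/-- The `n`-th iterated wreath product `[S_d]^n` of the symmetric group `S_d` in its natural action
on `d` letters (the automorphism group of the complete rooted `d`-ary tree of height `n`):
`[S_d]^0` is trivial and `[S_d]^(n+1) = S_d[[S_d]^n]`. -/
def iteratedSymWreath (d : ℕ) : ℕ → GrpCat.{0}
  | 0 => GrpCat.of Unit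
  | n + 1 => GrpCat.of (SymWreath d (iteratedSymWreath d n))

/-- A subset of affine space is Zariski dense if its Zariski closure, the common zero locus of all
polynomials vanishing on it, is the whole space. -/
def IsZariskiDense {K : Type*} [Field K] {σ : Type*} (S : Set (σ → K)) : Prop :=
  MvPolynomial.zeroLocus K (MvPolynomial.vanishingIdeal K S) = Set.univ

/-- The point `(b_1, …, b_{d-1}, c)` of `K ^ d`. -/
def paramPoint {K : Type*} {d : ℕ} (b : Fin (d - 1) → K) (c : K) : Fin d → K :=
  fun i => if h : (i : ℕ) < d - 1 then b ⟨i, h⟩ else c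

/-- The `n`-th iterate `f^n` of a polynomial under composition, with `f^0 = X`. -/
noncomputable def polyIterate {K : Type*} [Field K] (f : Polynomial K) (n : ℕ) : Polynomial K :=
  f.comp^[n] Polynomial.X

/-! ### Inertia groups at primes unramified in the base field -/

section

open scoped NumberField Pointwise

/-! Take for the dense set the integer points with distinct coordinates in one residue class modulo
`M`, where `M` is `d!` times the squares of finitely many primes. Divisibility of the critical
points by `d!` makes `f` integral. Each prime `p` is larger than `d` and `|disc K|`, so it is
unramified in `K`, and it carries one congruence condition modulo `p ^ 2`; these are combined by the
Chinese remainder theorem.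

As `f' = d ∏ (x - b_i)`, the roots of `f' ∘ f^n` are the points of level `n` in a forest of backward
orbits rooted at the fixed points `b_i`. Once all fibres have `d` elements, the Galois group embeds
in the product of the automorphism groups of the trees. It is everything as soon as, on each level
`k ≤ n`, any two points with the same image under `f` are exchanged by an element fixing all other
points of that level, over all roots at once (`exists_smul_eq_of_swaps`). Such swaps are conjugate
to a single one, given transitivity on each level over `b_j` and one point whose stabilizer is
transitive on its siblings (`exists_actsAsSwap`).

Inertia groups supply these ingredients, at three kinds of primes. (1) If `f ≡ x ^ d + p` and all
`b_j ≡ 0` modulo `p ^ 2`, each equation `f^k = b_j` is totally ramified: it has `d ^ k` distinct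
roots, permuted transitively. (2) If `d ≥ 3`, `f ≡ x ^ (d - 1) (x - d) + p` and `b_j ≡ 0` modulo `p
^ 2`, inertia fixes the one point of a fibre that reduces to `d` and permutes the other `d - 1`
transitively. (3) If `f^{m+1}(b_j) - b_j` is divisible by `p` exactly once, and no other relation of
length at most `m + 1` holds modulo `p` between critical points, exactly two roots of level `m + 1`
collide, and inertia swaps them.

Primes of the third kind come from `x ^ d - dBx ^ (d - 1) + c`, with critical points `(d - 1)B` and
`0`. For some algebraic integer `c` the former has exact period `m + 1`, as a simple root in the
parameter, while the latter escapes to infinity; this is then reduced modulo a suitable large prime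
with residue field of `p` elements (`exists_prime_bicritical`). -/

theorem mem_pow_card_inertia_of_fixed {K L : Type*} [Field K] [Field L] [NumberField K]
    [NumberField L] [Algebra K L] [IsGalois K L] (Q : Ideal (𝓞 L)) [Q.IsMaximal] (hQ : Q ≠ ⊥)
    (x : 𝓞 L) (hx : ∀ σ ∈ Q.inertia Gal(L/K), σ • x = x) (hxQ : x ∈ Q) :
    x ∈ Q ^ Nat.card (Q.inertia Gal(L/K)) := by
  set I := Q.inertia Gal(L/K) with hI
  -- Over the fixed field `E` of the inertia group, `Q` has ramification index `|I|`. The invariant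
  -- `x` descends to the prime `q` of `E` below `Q`, and `q` extends into `Q ^ |I|`.
  let E : IntermediateField K L := FixedPoints.intermediateField I
  have : IsGaloisGroup I E L := IsGaloisGroup.subgroup Gal(L/K) K L I
  have : IsGaloisGroup I (𝓞 E) (𝓞 L) := .of_isFractionRing _ _ _ E L
  let q : Ideal (𝓞 E) := Q.under (𝓞 E)
  have hq : q ≠ ⊥ := by
    intro h
    exact hQ (Ideal.eq_bot_of_comap_eq_bot (R := 𝓞 E) h)
  have : q.IsMaximal := Ideal.IsMaximal.under (𝓞 E) Q
  have : Finite (𝓞 E ⧸ q) := Ring.HasFiniteQuotients.finiteQuotient hq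
  have h1 := Ideal.card_inertia_eq_ramificationIdxIn (G := I) q Q
  have h2 : Nat.card (Q.inertia I) = Nat.card I := by
    have : Q.inertia I = ⊤ := by
      rw [eq_top_iff]
      intro σ _ y
      exact σ.2 y
    rw [this, Subgroup.card_top]
  rw [Ideal.ramificationIdxIn_eq_ramificationIdx q Q I, h2] at h1
  rw [h1]
  obtain ⟨z, rfl⟩ := Algebra.IsInvariant.isInvariant (A := 𝓞 E) (G := I) x (fun σ => hx σ.1 σ.2)
  have hz : z ∈ q := hxQ
  have hinj : Function.Injective (algebraMap (𝓞 E) (𝓞 L)) := FaithfulSMul.algebraMap_injective _ _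
  rw [Ideal.IsDedekindDomain.ramificationIdx_eq_multiplicity q Q
    (by rwa [Ne, Ideal.map_eq_bot_iff_of_injective hinj])]
  refine (Ideal.dvd_iff_le.mp (pow_multiplicity_dvd Q (q.map (algebraMap (𝓞 E) (𝓞 L))))) ?_
  exact Ideal.mem_map_of_mem _ hz

/-- Since `p` is unramified in `K`, its ramification index at `Q` is already that of `L/K`, the
order of the inertia group. Together with the previous lemma, inertia-invariant elements of `Q` have
at least the order of `p`. -/
theorem natCast_notMem_pow_card_inertia_succ {K L : Type*} [Field K] [Field L] [NumberField K]
    [NumberField L] [Algebra K L] [IsGalois K L] (Q : Ideal (𝓞 L)) [Q.IsMaximal] {p : ℕ}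
    (hp : p.Prime) (hpK : ¬ (p : ℤ) ∣ NumberField.discr K) (hpQ : (p : 𝓞 L) ∈ Q) :
    (p : 𝓞 L) ∉ Q ^ (Nat.card (Q.inertia Gal(L/K)) + 1) := by
  have hpZ : Prime (p : ℤ) := Nat.prime_iff_prime_int.mp hp
  let P : Ideal (𝓞 K) := Q.under (𝓞 K)
  have : IsGaloisGroup Gal(L/K) (𝓞 K) (𝓞 L) := .of_isFractionRing _ _ _ K L
  have hp0 : (p : 𝓞 K) ≠ 0 := by exact_mod_cast hp.ne_zero
  have hpL : (p : 𝓞 L) ≠ 0 := by exact_mod_cast hp.ne_zero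
  have hpP : (p : 𝓞 K) ∈ P := by
    change algebraMap _ _ (p : 𝓞 K) ∈ Q
    simpa using hpQ
  have hP : P ≠ ⊥ := fun h => hp0 (by simpa [h] using hpP)
  have : P.IsMaximal := Ideal.IsMaximal.under (𝓞 K) Q
  have : Finite (𝓞 K ⧸ P) := Ring.HasFiniteQuotients.finiteQuotient hP
  have h1 := Ideal.card_inertia_eq_ramificationIdxIn (G := Gal(L/K)) P Q
  rw [Ideal.ramificationIdxIn_eq_ramificationIdx P Q Gal(L/K)] at h1
  have h2 := Ideal.ramificationIdx_tower (R := ℤ) P Q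
  have : Algebra.IsUnramifiedAt ℤ P :=
    (NumberField.not_dvd_discr_iff_forall_mem K (𝓞 K) hpZ).mp hpK P inferInstance
      (by simpa using hpP)
  rw [Ideal.ramificationIdx_eq_one P ℤ, one_mul, ← h1] at h2
  have hover : Q.LiesOver (Ideal.span {(p : ℤ)}) := by
    rw [Ideal.liesOver_span_iff (Ideal.IsPrime.ne_top inferInstance) hpZ]
    simpa using hpQ
  have hmap : (Ideal.span {(p : ℤ)}).map (algebraMap ℤ (𝓞 L)) = Ideal.span {(p : 𝓞 L)} := by
    simp [Ideal.map_span]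
  have hne : (Ideal.span {(p : ℤ)}).map (algebraMap ℤ (𝓞 L)) ≠ ⊥ := by
    rw [hmap]; simpa using hp.ne_zero
  rw [Ideal.IsDedekindDomain.ramificationIdx_eq_multiplicity (Ideal.span {(p : ℤ)}) Q hne,
    hmap] at h2
  intro hmem
  rw [← h2] at hmem
  have hfin : FiniteMultiplicity Q (Ideal.span {(p : 𝓞 L)}) := by
    refine FiniteMultiplicity.of_prime_left (Ideal.prime_of_isPrime ?_ inferInstance) ?_
    · rintro rfl; exact hpL (by simpa using hpQ)
    · rw [← hmap]; exact hne
  refine hfin.not_pow_dvd_of_multiplicity_lt (Nat.lt_succ_self _) ?_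
  rw [Ideal.dvd_iff_le, Ideal.span_singleton_le_iff_mem]
  exact hmem

end

/-! ### Iterated wreath products as tree automorphisms -/

section

/-- The leaves of the complete rooted `d`-ary tree of height `n`. -/
def TreePath (d : ℕ) : ℕ → Type
  | 0 => Unit
  | n + 1 => Fin d × TreePath d n

namespace TreePath

/-- Two leaves agree up to their last `k` edges. -/
def Agree {d : ℕ} : (n k : ℕ) → TreePath d n → TreePath d n → Prop
  | 0, _, _, _ => True
  | n + 1, k, u, v => n + 1 ≤ k ∨ (u.1 = v.1 ∧ Agree n k u.2 v.2)

theorem agree_of_le {d : ℕ} : ∀ {n k : ℕ} (_ : n ≤ k) (u v : TreePath d n), Agree n k u v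
  | 0, _, _, _, _ => trivial
  | _ + 1, _, h, _, _ => Or.inl h

instance finite (d : ℕ) : ∀ n, Finite (TreePath d n)
  | 0 => inferInstanceAs (Finite Unit)
  | n + 1 => by
    have := finite d n
    exact inferInstanceAs (Finite (Fin d × TreePath d n))

instance nonempty (d : ℕ) [NeZero d] : ∀ n, Nonempty (TreePath d n)
  | 0 => inferInstanceAs (Nonempty Unit)
  | n + 1 => by
    have := nonempty d n
    exact inferInstanceAs (Nonempty (Fin d × TreePath d n))

end TreePath

namespace SymWreath

/-- The permutation of `Fin d × P` given by an element of the wreath product `S_d[G]`, where `G`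
acts on `P`. -/
def permOf {d : ℕ} {G : Type} [Group G] {P : Type} (φ : G →* Equiv.Perm P) (w : SymWreath d G) :
    Equiv.Perm (Fin d × P) where
  toFun u := (w.right u.1, φ (w.left (w.right u.1)) u.2)
  invFun u := (w.right⁻¹ u.1, (φ (w.left u.1))⁻¹ u.2)
  left_inv u := by simp
  right_inv u := by simp

/-- The imprimitive action of the wreath product `S_d[G]` on `Fin d × P`, where `G` acts on `P`. -/
def toPermHom {d : ℕ} {G : Type} [Group G] {P : Type} (φ : G →* Equiv.Perm P) :
    SymWreath d G →* Equiv.Perm (Fin d × P) :=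
  MonoidHom.mk' (permOf φ) fun w w' => by
    have hs : ∀ i, mulAutArrow w.right w'.left (w.right i) = w'.left i := fun i => by
      change w'.left (w.right⁻¹ • w.right i) = _
      simp
    ext u <;> simp [permOf, hs]

theorem toPermHom_apply {d : ℕ} {G : Type} [Group G] {P : Type} (φ : G →* Equiv.Perm P)
    (w : SymWreath d G) (i : Fin d) (u : P) :
    toPermHom φ w (i, u) = (w.right i, φ (w.left (w.right i)) u) := rfl

theorem toPermHom_injective {d : ℕ} {G : Type} [Group G] {P : Type} [Nonempty P]
    {φ : G →* Equiv.Perm P} (hφ : Function.Injective φ) :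
    Function.Injective (toPermHom (d := d) φ) := by
  intro w w' h
  have hr : w.right = w'.right := by
    ext i
    obtain ⟨u⟩ := ‹Nonempty P›
    have := congrArg (fun π => (π (i, u)).1) h
    simpa [toPermHom_apply] using congrArg Fin.val this
  refine SemidirectProduct.ext ?_ hr
  funext i
  apply hφ
  ext u
  have := congrArg (fun π => (π (w.right⁻¹ i, u)).2) h
  simpa [toPermHom_apply, ← hr] using this

end SymWreath

/-- The action of the iterated wreath product on the leaves of the tree. -/
def iteratedSymWreathPerm (d : ℕ) : (n : ℕ) →
    (iteratedSymWreath d n →* Equiv.Perm (TreePath d n))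
  | 0 => 1
  | n + 1 => SymWreath.toPermHom (iteratedSymWreathPerm d n)

theorem iteratedSymWreathPerm_injective (d : ℕ) [NeZero d] :
    ∀ n, Function.Injective (iteratedSymWreathPerm d n)
  | 0 => fun _ _ _ => (rfl : (() : Unit) = ())
  | n + 1 => SymWreath.toPermHom_injective (iteratedSymWreathPerm_injective d n)

theorem iteratedSymWreathPerm_agree (d : ℕ) : ∀ (n k : ℕ) (w : iteratedSymWreath d n)
    (u v : TreePath d n), TreePath.Agree n k u v →
      TreePath.Agree n k (iteratedSymWreathPerm d n w u) (iteratedSymWreathPerm d n w v)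
  | 0, _, _, _, _, _ => trivial
  | n + 1, k, w, u, v, h => by
    rcases h with h | ⟨h1, h2⟩
    · exact Or.inl h
    · obtain ⟨i, u⟩ := u
      obtain ⟨j, v⟩ := v
      obtain rfl : i = j := h1
      exact Or.inr ⟨rfl, iteratedSymWreathPerm_agree d n k _ u v h2⟩

/-- A permutation preserving agreement at every depth permutes the `d` subtrees below the root and
induces on each a permutation of the same kind, so recursion applies. Hence the wreath product is
the full automorphism group of the tree. -/
theorem mem_range_iteratedSymWreathPerm (d : ℕ) [NeZero d] : ∀ (n : ℕ)
    (π : Equiv.Perm (TreePath d n)),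
    (∀ k u v, TreePath.Agree n k u v → TreePath.Agree n k (π u) (π v)) →
      π ∈ (iteratedSymWreathPerm d n).range
  | 0, π, _ => ⟨1, Equiv.ext fun _ => (rfl : (() : Unit) = ())⟩
  | n + 1, π, hπ => by
    obtain ⟨u₀⟩ : Nonempty (TreePath d n) := inferInstance
    let g : Fin d → TreePath d n → Fin d × TreePath d n := fun i u => π (i, u)
    -- In height `n + 1`, agreement up to the last `n` edges is equality of the first edge.
    have hfst : ∀ i u v, (g i u).1 = (g i v).1 := fun i u v => by
      rcases hπ n (i, u) (i, v) (Or.inr ⟨rfl, TreePath.agree_of_le le_rfl _ _⟩) with h | h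
      · omega
      · exact h.1
    have hinj : ∀ i, Function.Injective fun u => (g i u).2 := fun i u v h => by
      have : g i u = g i v := Prod.ext (hfst i u v) h
      exact congrArg Prod.snd (π.injective this)
    have hτ : Function.Surjective fun i => (g i u₀).1 := fun i => by
      obtain ⟨⟨j, v⟩, hj⟩ := π.surjective (i, u₀)
      exact ⟨j, (hfst j u₀ v).trans (congrArg Prod.fst hj)⟩
    let τ : Equiv.Perm (Fin d) := Equiv.ofBijective _ (Finite.surjective_iff_bijective.mp hτ)
    let α : Fin d → Equiv.Perm (TreePath d n) := fun i =>
      Equiv.ofBijective _ (Finite.injective_iff_bijective.mp (hinj i))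
    have hα : ∀ i, α i ∈ (iteratedSymWreathPerm d n).range := fun i => by
      refine mem_range_iteratedSymWreathPerm d n _ fun k u v h => ?_
      rcases hπ k (i, u) (i, v) (Or.inr ⟨rfl, h⟩) with h | h
      · exact TreePath.agree_of_le (by omega) _ _
      · exact h.2
    choose a ha using hα
    -- The base component is indexed by the target subtree in `permOf`, whence the shift by `τ⁻¹`.
    refine ⟨(⟨fun i => a (τ⁻¹ i), τ⟩ : SymWreath d (iteratedSymWreath d n)), Equiv.ext ?_⟩
    rintro ⟨i, u⟩
    refine (SymWreath.toPermHom_apply _ _ i u).trans ?_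
    have hi : τ⁻¹ (τ i) = i := τ.symm_apply_apply i
    simp only [hi, ha]
    exact Prod.ext (hfst i u₀ u) rfl

/-- If every point of the first `n` levels of the backward orbit of `y` under `F` has exactly `d`
preimages, the points of level `n` can be labelled by the leaves of the `d`-ary tree. -/
theorem exists_treePath_equiv {X : Type*} (F : X → X) (d : ℕ) : ∀ (n : ℕ) (y : X)
    (_ : ∀ k < n, ∀ z, F^[k] z = y → Nat.card {x // F x = z} = d ∧ Finite {x // F x = z}),
    ∃ l : TreePath d n ≃ {x // F^[n] x = y},
      ∀ k ≤ n, ∀ u v, TreePath.Agree n k u v ↔ F^[k] (l u) = F^[k] (l v)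
  | 0, y, _ => by
    refine ⟨⟨fun _ => ⟨y, rfl⟩, fun _ => (), fun _ => rfl, fun x => Subtype.ext x.2.symm⟩, ?_⟩
    intro k _ u v
    exact ⟨fun _ => rfl, fun _ => trivial⟩
  | n + 1, y, h => by
    obtain ⟨hc, hf⟩ := h 0 (Nat.succ_pos _) y rfl
    obtain ⟨c⟩ : Nonempty (Fin d ≃ {x // F x = y}) := by
      have := Finite.equivFin {x // F x = y}
      rw [hc] at this
      exact ⟨this.symm⟩
    have ih : ∀ i : Fin d, ∃ l : TreePath d n ≃ {x // F^[n] x = (c i : X)},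
        ∀ k ≤ n, ∀ u v, TreePath.Agree n k u v ↔ F^[k] (l u) = F^[k] (l v) := fun i =>
      exists_treePath_equiv F d n (c i) fun k hk z hz => h (k + 1) (by omega) z (by
        rw [Function.iterate_succ_apply', hz]; exact (c i).2)
    choose l hl using ih
    have key : ∀ i u, F^[n + 1] (l i u : X) = y := fun i u => by
      rw [Function.iterate_succ_apply', (l i u).2]; exact (c i).2
    let L : Fin d × TreePath d n → {x // F^[n + 1] x = y} := fun u => ⟨l u.1 u.2, key _ _⟩
    have hL : Function.Bijective L := by
      constructor
      · rintro ⟨i, u⟩ ⟨j, v⟩ huv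
        have h1 : (l i u : X) = l j v := congrArg Subtype.val huv
        have h2 : i = j := c.injective (Subtype.ext (by rw [← (l i u).2, ← (l j v).2, h1]))
        subst h2
        exact Prod.ext rfl ((l i).injective (Subtype.ext h1))
      · rintro ⟨x, hx⟩
        obtain ⟨i, hi⟩ := c.surjective ⟨F^[n] x, by
          rw [← Function.iterate_succ_apply' F, hx]⟩
        obtain ⟨u, hu⟩ := (l i).surjective ⟨x, by rw [hi]⟩
        exact ⟨(i, u), Subtype.ext (by simp [L, hu])⟩
    refine ⟨Equiv.ofBijective L hL, fun k hk => ?_⟩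
    rintro ⟨i, u⟩ ⟨j, v⟩
    change (n + 1 ≤ k ∨ (i = j ∧ TreePath.Agree n k u v)) ↔ F^[k] (l i u : X) = F^[k] (l j v : X)
    constructor
    · rintro (h | ⟨rfl, h⟩)
      · obtain rfl : k = n + 1 := by omega
        rw [key, key]
      · by_cases hk' : k ≤ n
        · exact (hl i k hk' u v).mp h
        · obtain rfl : k = n + 1 := by omega
          rw [key, key]
    · intro h
      by_cases hk' : k ≤ n
      · right
        have h2 : i = j := by
          refine c.injective (Subtype.ext ?_)
          rw [← (l i u).2, ← (l j v).2]
          obtain ⟨m, rfl⟩ := Nat.exists_eq_add_of_le' hk'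
          rw [Function.iterate_add_apply, h, ← Function.iterate_add_apply]
        subst h2
        exact ⟨rfl, (hl i k hk' u v).mpr h⟩
      · left; omega

end

/-! ### Generating the automorphism group of a forest by swaps -/

section

section TreeAction

variable {X G : Type*} [Group G] [MulAction G X] {F : X → X}

open Classical in
/-- The element `σ` acts on `T` as the transposition of two given points. -/
def ActsAsSwap (σ : G) (T : Set X) (x x' : X) : Prop :=
  ∀ z ∈ T, σ • z = Equiv.swap x x' z

theorem ActsAsSwap.conj {σ : G} {T : Set X} {x x' : X} (h : ActsAsSwap σ T x x') (τ : G)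
    (hT : ∀ z ∈ T, τ⁻¹ • z ∈ T) : ActsAsSwap (τ * σ * τ⁻¹) T (τ • x) (τ • x') := by
  classical
  intro z hz
  have h1 := h _ (hT z hz)
  rw [mul_smul, mul_smul, h1]
  rw [Equiv.swap_apply_def, Equiv.swap_apply_def]
  simp only [inv_smul_eq_iff]
  split_ifs <;> simp

/-- Conjugate the given swap three times: carry `x₁` to `x₀`, adjust the sibling by the stabilizer
of `x₀`, then carry `x₀` to `x`. Here `T` is meant to be a whole level and `S` its part over one
root. -/
theorem exists_actsAsSwap {T S : Set X}
    (hF : ∀ (σ : G) x, σ • F x = F (σ • x)) (hT : ∀ (σ : G), ∀ z ∈ T, σ • z ∈ T)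
    (htrans : ∀ x ∈ S, ∀ x' ∈ S, ∃ σ : G, σ • x = x') {x₁ x₂ : X} (hx₁ : x₁ ∈ S) (hx : x₁ ≠ x₂)
    (hx₁₂ : F x₁ = F x₂) {σ : G} (hσ : ActsAsSwap σ T x₁ x₂) {x₀ : X} (hx₀ : x₀ ∈ S)
    (hstab : ∀ a a', a ≠ x₀ → a' ≠ x₀ → F a = F x₀ → F a' = F x₀ →
      ∃ τ : G, τ • x₀ = x₀ ∧ τ • a = a')
    {x x' : X} (hxS : x ∈ S) (hxx' : F x = F x') : ∃ τ : G, ActsAsSwap τ T x x' := by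
  by_cases hne : x = x'
  · subst hne
    exact ⟨1, fun z _ => by simp⟩
  obtain ⟨α, rfl⟩ := htrans x₁ hx₁ x₀ hx₀
  obtain ⟨β, rfl⟩ := htrans _ hx₀ x hxS
  obtain ⟨τ, hτ₀, hτ⟩ := hstab (α • x₂) (β⁻¹ • x') (fun h => hx (smul_left_cancel α h).symm)
    (fun h => hne (by rw [← h, smul_inv_smul])) (by rw [← hF, ← hF, hx₁₂])
    (by rw [← hF, ← hxx', hF, inv_smul_smul])
  have h1 := ((hσ.conj α fun z hz => hT _ z hz).conj τ fun z hz => hT _ z hz).conj β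
    fun z hz => hT _ z hz
  rw [hτ₀, hτ, smul_inv_smul] at h1
  exact ⟨_, h1⟩

/-- A group generated by transpositions contains every finitely supported permutation that keeps
each point in its orbit; here the orbits of the available swaps are the fibres of `F` on `T`. -/
theorem exists_smul_eq_perm {T : Set X} (hT : T.Finite)
    (hswap : ∀ x ∈ T, ∀ x' ∈ T, F x = F x' → ∃ σ : G, ActsAsSwap σ T x x')
    (ρ : Equiv.Perm T) (hρ : ∀ z, F (ρ z) = F z) : ∃ σ : G, ∀ z : T, σ • (z : X) = ρ z := by
  classical
  have := hT.to_subtype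
  let H : Subgroup (Equiv.Perm T) :=
    { carrier := {ρ | ∃ σ : G, ∀ z : T, σ • (z : X) = ρ z}
      one_mem' := ⟨1, fun z => by simp⟩
      mul_mem' := by
        rintro ρ ρ' ⟨σ, hσ⟩ ⟨σ', hσ'⟩
        exact ⟨σ * σ', fun z => by rw [mul_smul, hσ', hσ]; rfl⟩
      inv_mem' := by
        rintro ρ ⟨σ, hσ⟩
        refine ⟨σ⁻¹, fun z => ?_⟩
        rw [inv_smul_eq_iff, hσ]
        exact congrArg Subtype.val (ρ.apply_symm_apply z).symm }
  let S : Set (Equiv.Perm T) := {τ | ∃ x x' : T, x ≠ x' ∧ F x = F x' ∧ τ = Equiv.swap x x'}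
  have hS : ∀ τ ∈ S, τ.IsSwap := by
    rintro _ ⟨x, x', h, -, rfl⟩
    exact ⟨x, x', h, rfl⟩
  have hSH : Subgroup.closure S ≤ H := by
    rw [Subgroup.closure_le]
    rintro _ ⟨x, x', h, hF, rfl⟩
    obtain ⟨σ, hσ⟩ := hswap x x.2 x' x'.2 hF
    refine ⟨σ, fun z => ?_⟩
    rw [hσ z z.2, Equiv.swap_apply_def, Equiv.swap_apply_def]
    simp only [Subtype.ext_iff]
    split_ifs <;> rfl
  refine hSH ((mem_closure_isSwap hS).mpr ⟨Set.toFinite _, fun z => ?_⟩)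
  by_cases hz : ρ z = z
  · rw [hz]; exact MulAction.mem_orbit_self _
  · refine ⟨⟨Equiv.swap z (ρ z), Subgroup.subset_closure ⟨z, ρ z, Ne.symm hz, (hρ z).symm, rfl⟩⟩, ?_⟩
    exact Equiv.swap_apply_left z (ρ z)

/-- The `k`-th level of the backward orbit of the points `b j`. -/
def backwardLevel {ι : Type*} (F : X → X) (b : ι → X) (k : ℕ) : Set X :=
  {x | ∃ j, F^[k] x = b j}

variable {ι : Type*} {b : ι → X}

theorem smul_iterate_of_equivariant (hF : ∀ (σ : G) x, σ • F x = F (σ • x)) (σ : G) (k : ℕ) (x : X) :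
    σ • F^[k] x = F^[k] (σ • x) := by
  induction k generalizing x with
  | zero => rfl
  | succ k ih => rw [Function.iterate_succ_apply, ih, hF, Function.iterate_succ_apply]

theorem smul_mem_backwardLevel (hF : ∀ (σ : G) x, σ • F x = F (σ • x))
    (hb : ∀ (σ : G) j, σ • b j = b j) (σ : G) {k : ℕ} {x : X} (hx : x ∈ backwardLevel F b k) :
    σ • x ∈ backwardLevel F b k := by
  obtain ⟨j, hj⟩ := hx
  exact ⟨j, by rw [← smul_iterate_of_equivariant hF, hj, hb]⟩

theorem iterate_mem_backwardLevel {k m : ℕ} {x : X} (hx : x ∈ backwardLevel F b (k + m)) :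
    F^[m] x ∈ backwardLevel F b k := by
  obtain ⟨j, hj⟩ := hx
  exact ⟨j, by rw [← Function.iterate_add_apply, hj]⟩

theorem exists_mem_backwardLevel {n : ℕ}
    (hsurj : ∀ k < n, ∀ z ∈ backwardLevel F b k, ∃ x, F x = z) {k : ℕ} :
    ∀ {m : ℕ} (_ : k + m ≤ n) {z : X} (_ : z ∈ backwardLevel F b k),
      ∃ x ∈ backwardLevel F b (k + m), F^[m] x = z
  | 0, _, z, hz => ⟨z, hz, rfl⟩
  | m + 1, hm, z, hz => by
    obtain ⟨y, ⟨j, hy⟩, hyz⟩ := exists_mem_backwardLevel hsurj (k := k) (m := m) (by omega) hz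
    obtain ⟨x, hx⟩ := hsurj (k + m) (by omega) y ⟨j, hy⟩
    refine ⟨x, ⟨j, ?_⟩, ?_⟩
    · rw [← Nat.add_assoc, Function.iterate_succ_apply, hx, hy]
    · rw [Function.iterate_succ_apply, hx, hyz]

/-- Climb from the roots: if `σ` agrees with `π` on one level, then `σ⁻¹ π` on the next level
preserves the fibres of `F`, so it is realized by some `τ`, and `σ * τ` agrees with `π` there. The
map `π` stands for a root-preserving automorphism of the forest, described on level `n` only. -/
theorem exists_smul_eq_of_swaps (hF : ∀ (σ : G) x, σ • F x = F (σ • x))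
    (hb : ∀ (σ : G) j, σ • b j = b j) {n : ℕ}
    (hfin : ∀ k ≤ n, (backwardLevel F b k).Finite)
    (hsurj : ∀ k < n, ∀ z ∈ backwardLevel F b k, ∃ x, F x = z)
    (hswap : ∀ k < n, ∀ x ∈ backwardLevel F b (k + 1), ∀ x' ∈ backwardLevel F b (k + 1),
      F x = F x' → ∃ σ : G, ActsAsSwap σ (backwardLevel F b (k + 1)) x x')
    (π : X → X) (hπ₀ : ∀ x ∈ backwardLevel F b n, F^[n] (π x) = F^[n] x)
    (hπs : ∀ x ∈ backwardLevel F b n, ∃ x' ∈ backwardLevel F b n, π x' = x)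
    (hπ : ∀ k ≤ n, ∀ x ∈ backwardLevel F b n, ∀ x' ∈ backwardLevel F b n,
      F^[k] x = F^[k] x' → F^[k] (π x) = F^[k] (π x')) :
    ∃ σ : G, ∀ x ∈ backwardLevel F b n, σ • x = π x := by
  have hπmem : ∀ x ∈ backwardLevel F b n, π x ∈ backwardLevel F b n := by
    rintro x ⟨j, hj⟩
    exact ⟨j, by rw [hπ₀ x ⟨j, hj⟩, hj]⟩
  suffices H : ∀ m k, m + k = n → ∃ σ : G, ∀ x ∈ backwardLevel F b n,
      F^[k] (σ • x) = F^[k] (π x) by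
    obtain ⟨σ, hσ⟩ := H n 0 rfl
    exact ⟨σ, hσ⟩
  intro m
  induction m with
  | zero =>
    rintro k hk
    obtain rfl : k = n := by omega
    exact ⟨1, fun x hx => by rw [one_smul, hπ₀ x hx]⟩
  | succ m ih =>
    rintro k rfl
    obtain ⟨σ, hσ⟩ := ih (k + 1) (by omega)
    set T := backwardLevel F b (m + 1) with hTdef
    have hT : T.Finite := hfin _ (by omega)
    have := hT.to_subtype
    have hs : ∀ z : T, ∃ x ∈ backwardLevel F b (m + 1 + k), F^[k] x = z := fun z =>
      exists_mem_backwardLevel hsurj le_rfl z.2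
    choose s hs hsz using hs
    -- The permutation induced by `σ⁻¹ π` on level `m + 1`, computed at a chosen descendant on level
    -- `n`; `hr` is independence of the choice.
    let r : T → T := fun z => ⟨σ⁻¹ • F^[k] (π (s z)), smul_mem_backwardLevel hF hb _
      (iterate_mem_backwardLevel (hπmem _ (hs z)))⟩
    have hr : ∀ x ∈ backwardLevel F b (m + 1 + k), ∀ z : T, F^[k] x = z →
        (r z : X) = σ⁻¹ • F^[k] (π x) := fun x hx z hz => by
      change σ⁻¹ • F^[k] (π (s z)) = _
      rw [hπ k (by omega) (s z) (hs z) x hx (by rw [hsz, hz])]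
    have hrs : Function.Surjective r := fun z => by
      obtain ⟨x, hx, hxz⟩ := exists_mem_backwardLevel hsurj le_rfl
        (smul_mem_backwardLevel hF hb σ z.2)
      obtain ⟨x', hx', rfl⟩ := hπs x hx
      refine ⟨⟨F^[k] x', iterate_mem_backwardLevel hx'⟩, Subtype.ext ?_⟩
      rw [hr x' hx' _ rfl, hxz, inv_smul_smul]
    let ρ : Equiv.Perm T := Equiv.ofBijective r (Finite.surjective_iff_bijective.mp hrs)
    have hρ : ∀ z, F (ρ z) = F z := fun z => by
      change F (σ⁻¹ • F^[k] (π (s z))) = F z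
      rw [← hF, inv_smul_eq_iff, ← Function.iterate_succ_apply' F, ← hσ _ (hs z),
        ← smul_iterate_of_equivariant hF, Function.iterate_succ_apply' F, hsz]
    obtain ⟨τ, hτ⟩ := exists_smul_eq_perm hT (hswap m (by omega)) ρ hρ
    refine ⟨σ * τ, fun x hx => ?_⟩
    have h1 := hτ ⟨F^[k] x, iterate_mem_backwardLevel hx⟩
    change τ • F^[k] x = (r _ : X) at h1
    rw [hr x hx _ rfl] at h1
    rw [← smul_iterate_of_equivariant hF, mul_smul, h1, smul_inv_smul]

/-- A faithful action on the `n`-th level of a forest of `d`-ary trees which fixes the roots and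
realizes all transpositions within fibres identifies the group with a product of iterated wreath
products. -/
theorem nonempty_mulEquiv_iteratedSymWreath (hF : ∀ (σ : G) x, σ • F x = F (σ • x))
    (hb : ∀ (σ : G) j, σ • b j = b j) (hbinj : Function.Injective b) {d n : ℕ} [NeZero d]
    [Finite ι]
    (hcard : ∀ k < n, ∀ z ∈ backwardLevel F b k,
      Nat.card {x // F x = z} = d ∧ Finite {x // F x = z})
    (hswap : ∀ k < n, ∀ x ∈ backwardLevel F b (k + 1), ∀ x' ∈ backwardLevel F b (k + 1),
      F x = F x' → ∃ σ : G, ActsAsSwap σ (backwardLevel F b (k + 1)) x x')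
    (hfaith : ∀ σ : G, (∀ x ∈ backwardLevel F b n, σ • x = x) → σ = 1) :
    Nonempty (G ≃* (ι → iteratedSymWreath d n)) := by
  have hlab : ∀ m ≤ n, ∀ j, ∃ l : TreePath d m ≃ {x // F^[m] x = b j},
      ∀ k ≤ m, ∀ u v, TreePath.Agree m k u v ↔ F^[k] (l u) = F^[k] (l v) := fun m hm j =>
    exists_treePath_equiv F d m (b j) fun k hk z hz => hcard k (by omega) z ⟨j, hz⟩
  have hfin : ∀ k ≤ n, (backwardLevel F b k).Finite := fun k hk => by
    have : backwardLevel F b k = ⋃ j, {x | F^[k] x = b j} := by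
      ext x; simp [backwardLevel]
    rw [this]
    refine Set.finite_iUnion fun j => ?_
    obtain ⟨l, -⟩ := hlab k hk j
    exact Set.finite_coe_iff.mp (Finite.of_equiv _ l)
  have hsurj : ∀ k < n, ∀ z ∈ backwardLevel F b k, ∃ x, F x = z := fun k hk z hz => by
    obtain ⟨h1, h2⟩ := hcard k hk z hz
    have : Nonempty {x // F x = z} := by
      rw [← Finite.card_pos_iff, h1]
      exact Nat.pos_of_ne_zero (NeZero.ne d)
    obtain ⟨x, hx⟩ := this
    exact ⟨x, hx⟩
  choose l hl using hlab n le_rfl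
  let A : G →* (ι → Equiv.Perm (TreePath d n)) := MonoidHom.mk'
    (fun σ j => (l j).symm.permCongr
      ⟨fun x => ⟨σ • x.1, by rw [← smul_iterate_of_equivariant hF, x.2, hb]⟩,
       fun x => ⟨σ⁻¹ • x.1, by rw [← smul_iterate_of_equivariant hF, x.2, hb]⟩,
       fun x => by simp, fun x => by simp⟩)
    (fun σ τ => by
      funext j
      ext u
      simp [Equiv.permCongr_apply, mul_smul])
  have hA : ∀ σ j u, (l j (A σ j u) : X) = σ • (l j u : X) := fun σ j u => by
    simp [A, Equiv.permCongr_apply]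
  have hAinj : Function.Injective A := by
    rw [injective_iff_map_eq_one]
    intro σ hσ
    refine hfaith σ ?_
    rintro x ⟨j, hj⟩
    obtain ⟨u, hu⟩ := (l j).surjective ⟨x, hj⟩
    have := hA σ j u
    rw [hσ, hu] at this
    simpa [hu] using this.symm
  let B : (ι → iteratedSymWreath d n) →* (ι → Equiv.Perm (TreePath d n)) :=
    MonoidHom.pi fun j => (iteratedSymWreathPerm d n).comp (Pi.evalMonoidHom _ j)
  have hBinj : Function.Injective B := fun w w' h => by
    funext j
    exact iteratedSymWreathPerm_injective d n (congrFun h j)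
  have hrange : A.range = B.range := by
    apply le_antisymm
    · rintro _ ⟨σ, rfl⟩
      have : ∀ j, ∃ w, iteratedSymWreathPerm d n w = A σ j := fun j => by
        refine mem_range_iteratedSymWreathPerm d n _ fun k u v h => ?_
        by_cases hk : k ≤ n
        · rw [hl j k hk] at h ⊢
          rw [hA, hA, ← smul_iterate_of_equivariant hF, h, smul_iterate_of_equivariant hF]
        · exact TreePath.agree_of_le (by omega) _ _
      choose w hw using this
      exact ⟨w, funext hw⟩
    · rintro _ ⟨w, rfl⟩
      have hJ : ∀ x ∈ backwardLevel F b n, ∃ j u, (l j u : X) = x := by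
        rintro x ⟨j, hj⟩
        obtain ⟨u, hu⟩ := (l j).surjective ⟨x, hj⟩
        exact ⟨j, u, by rw [hu]⟩
      have hmem : ∀ j u, (l j u : X) ∈ backwardLevel F b n := fun j u => ⟨j, (l j u).2⟩
      -- Extends the tree permutations to a map on all of `X`, trivial off level `n`. It is well
      -- defined because `b` is injective, so a point of level `n` lies over one root only.
      have hex : ∀ x : X, ∃ y : X, ∀ j u, (l j u : X) = x → y = l j (B w j u) := fun x => by
        by_cases hx : ∃ j u, (l j u : X) = x
        · obtain ⟨j, u, rfl⟩ := hx
          refine ⟨l j (B w j u), fun j' u' h => ?_⟩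
          obtain rfl : j = j' := hbinj (by rw [← (l j u).2, ← (l j' u').2, h])
          rw [(l j).injective (Subtype.ext h)]
        · exact ⟨x, fun j u h => absurd ⟨j, u, h⟩ hx⟩
      choose π hπ' using hex
      have hπ : ∀ j u, π (l j u) = l j (B w j u) := fun j u => hπ' _ j u rfl
      have h₀ : ∀ x ∈ backwardLevel F b n, F^[n] (π x) = F^[n] x := fun x hx => by
        obtain ⟨j, u, rfl⟩ := hJ x hx
        rw [hπ, (l j _).2, (l j _).2]
      have hs : ∀ x ∈ backwardLevel F b n, ∃ x' ∈ backwardLevel F b n, π x' = x := fun x hx => by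
        obtain ⟨j, u, rfl⟩ := hJ x hx
        exact ⟨l j ((B w j)⁻¹ u), hmem _ _, by rw [hπ]; simp⟩
      have ha : ∀ k ≤ n, ∀ x ∈ backwardLevel F b n, ∀ x' ∈ backwardLevel F b n,
          F^[k] x = F^[k] x' → F^[k] (π x) = F^[k] (π x') := fun k hk x hx x' hx' h => by
        obtain ⟨j, u, rfl⟩ := hJ x hx
        obtain ⟨j', u', rfl⟩ := hJ x' hx'
        have hjj : j = j' := hbinj <| by
          rw [← (l j u).2, ← (l j' u').2]
          obtain ⟨m, rfl⟩ := Nat.exists_eq_add_of_le' hk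
          rw [Function.iterate_add_apply, h, ← Function.iterate_add_apply]
        subst hjj
        rw [hπ, hπ, ← hl j k hk]
        exact iteratedSymWreathPerm_agree d n k _ _ _ ((hl j k hk _ _).mpr h)
      obtain ⟨σ, hσ⟩ := exists_smul_eq_of_swaps hF hb hfin hsurj hswap π h₀ hs ha
      refine ⟨σ, funext fun j => Equiv.ext fun u => (l j).injective (Subtype.ext ?_)⟩
      rw [hA, hσ _ (hmem j u), hπ]
  exact ⟨(MonoidHom.ofInjective hAinj).trans
    ((MulEquiv.subgroupCongr hrange).trans (MonoidHom.ofInjective hBinj).symm)⟩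

end TreeAction

end

/-! ### Colliding roots modulo a prime, and transpositions in inertia -/

section

open scoped Pointwise
open Polynomial

section Iterates

theorem iterate_aeval {A : Type*} [CommRing A] (f : ℤ[X]) (k : ℕ) (x : A) :
    (fun z : A => aeval z f)^[k] x = aeval x (f.comp^[k] X) := by
  induction k with
  | zero => simp
  | succ k ih =>
    rw [Function.iterate_succ_apply', ih, Function.iterate_succ_apply', aeval_comp]

theorem iterate_comp_succ (f : ℤ[X]) (k : ℕ) :
    f.comp^[k + 1] X = (f.comp^[k] X).comp f := by
  induction k with
  | zero => simp
  | succ k ih =>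
    rw [Function.iterate_succ_apply', ih, ← comp_assoc, ← ih, Function.iterate_succ_apply' f.comp]

theorem derivative_iterate_comp_succ (f : ℤ[X]) (k : ℕ) :
    derivative (f.comp^[k + 1] X) = derivative f * (derivative (f.comp^[k] X)).comp f := by
  rw [iterate_comp_succ, derivative_comp]

theorem monic_iterate_comp {f : ℤ[X]} (hf : f.Monic) (hd : f.natDegree ≠ 0) (k : ℕ) :
    (f.comp^[k] X).Monic := by
  induction k with
  | zero => exact monic_X
  | succ k ih =>
    rw [iterate_comp_succ]
    exact ih.comp hf hd

theorem natDegree_iterate_comp_X (f : ℤ[X]) (k : ℕ) :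
    (f.comp^[k] X).natDegree = f.natDegree ^ k := by
  rw [natDegree_iterate_comp, natDegree_X, mul_one]

theorem monic_iterate_comp_sub_C {f : ℤ[X]} (hf : f.Monic) (hd : f.natDegree ≠ 0) (k : ℕ) (a : ℤ) :
    (f.comp^[k] X - C a).Monic := by
  refine (monic_iterate_comp hf hd k).sub_of_left ?_
  refine degree_C_le.trans_lt ?_
  rw [← natDegree_pos_iff_degree_pos, natDegree_iterate_comp_X]
  exact pow_pos (Nat.pos_of_ne_zero hd) k

/-- By the chain rule the derivative of `f^k` at `x` is the product of the values of `f'` along the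
orbit of `x` up to time `k - 1`. -/
theorem exists_aeval_derivative_eq_zero {κ : Type*} [CommRing κ] [IsDomain κ] (f : ℤ[X]) (k : ℕ) (x : κ)
    (h : aeval x (derivative (f.comp^[k] X)) = 0) :
    ∃ s < k, aeval ((fun z : κ => aeval z f)^[s] x) (derivative f) = 0 := by
  induction k generalizing x with
  | zero => simp at h
  | succ k ih =>
    rw [derivative_iterate_comp_succ, map_mul, aeval_comp, mul_eq_zero] at h
    rcases h with h | h
    · exact ⟨0, k.succ_pos, h⟩
    · obtain ⟨s, hs, h⟩ := ih _ h
      exact ⟨s + 1, by omega, h⟩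

end Iterates

section QuotientMaps

variable {B κ : Type*} [CommRing B] [CommRing κ] (φ : B →+* κ)

theorem map_ringHom_aeval (f : ℤ[X]) (x : B) :
    φ (aeval x f) = aeval (φ x) f := by
  simp only [aeval_def, hom_eval₂]
  congr 1
  exact RingHom.ext_int _ _

theorem map_ringHom_iterate_aeval (f : ℤ[X]) (k : ℕ) (x : B) :
    φ ((fun z : B => aeval z f)^[k] x) =
      (fun z : κ => aeval z f)^[k] (φ x) := by
  rw [iterate_aeval, iterate_aeval, map_ringHom_aeval]

theorem map_map_ringHom_map_int (P : ℤ[X]) :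
    (P.map (algebraMap ℤ B)).map (φ) = P.map (algebraMap ℤ (κ)) := by
  rw [Polynomial.map_map]
  congr 1
  exact RingHom.ext_int _ _

/-- Distinct roots give a factor of the reduction. -/
theorem prod_X_sub_C_dvd_map_of_roots [IsDomain B] {P : B[X]} (h0 : P ≠ 0) (s : Finset B)
    (hs : ∀ x ∈ s, P.eval x = 0) : ∏ x ∈ s, (X - C (φ x)) ∣ P.map φ := by
  have h1 : (s.val.map fun a => X - C a).prod ∣ P := by
    rw [Multiset.prod_X_sub_C_dvd_iff_le_roots h0, Multiset.le_iff_subset s.nodup]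
    intro x hx
    rw [mem_roots h0]
    exact hs x hx
  have h2 := map_dvd (mapRingHom φ) h1
  rw [coe_mapRingHom] at h2
  convert h2 using 1
  rw [← coe_mapRingHom]
  change _ = mapRingHom φ (∏ x ∈ s, (X - C x))
  rw [map_prod]
  simp

theorem prod_X_sub_C_dvd_map [IsDomain B] {P : ℤ[X]} (hP : P.Monic) (s : Finset B)
    (hs : ∀ x ∈ s, aeval x P = 0) :
    ∏ x ∈ s, (X - C (φ x)) ∣ P.map (algebraMap ℤ κ) := by
  rw [← map_map_ringHom_map_int φ]
  refine prod_X_sub_C_dvd_map_of_roots φ (hP.map _).ne_zero s fun x hx => ?_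
  rw [eval_map_algebraMap, hs x hx]

/-- When `P` splits over `B`, lifting a root of the reduction needs no Hensel argument: some linear
factor must vanish in the domain `κ`. -/
theorem exists_root_of_splits [IsDomain κ] {P : ℤ[X]} {s : Multiset B}
    (hs : P.map (algebraMap ℤ B) = (s.map fun a => X - C a).prod) (r : B)
    (hr : aeval (φ r) P = 0) :
    ∃ x : B, aeval x P = 0 ∧ φ x = φ r := by
  have h1 : aeval r P = (s.map fun a => r - a).prod := by
    rw [← eval_map_algebraMap, hs, eval_multiset_prod, Multiset.map_map]
    simp
  rw [← map_ringHom_aeval, h1, map_multiset_prod, Multiset.prod_eq_zero_iff, Multiset.map_map,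
    Multiset.mem_map] at hr
  obtain ⟨a, ha, har⟩ := hr
  rw [Function.comp_apply, map_sub, sub_eq_zero] at har
  refine ⟨a, ?_, har.symm⟩
  rw [← eval_map_algebraMap, hs, eval_multiset_prod]
  refine Multiset.prod_eq_zero ?_
  rw [Multiset.map_map, Multiset.mem_map]
  exact ⟨a, ha, by simp⟩

end QuotientMaps

section Transposition

variable {B G : Type*} [CommRing B] [IsDedekindDomain B] [Group G] [MulSemiringAction G B]
  {κ : Type*} [CommRing κ] [IsDomain κ] (φ : B →+* κ)

/-- Colliding roots give a double root of the reduction, so the orbit of `φ x` passes through some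
`b i` at a time `s < k`, and `b i` reaches `b j'` after `k - s` steps. The only relation allowed has
length `m + 1`, which forces `s = 0` and the collision at `b j` itself. -/
theorem eq_of_congruent_roots {f : ℤ[X]} (hf : f.Monic) (hd : f.natDegree ≠ 0) {ι : Type*}
    {b : ι → ℤ} {m : ℕ} {j : ι}
    (hder : ∀ z : κ, aeval z (derivative f) = 0 → ∃ i, z = (b i : κ))
    (horb : ∀ i j' k, 1 ≤ k → k ≤ m + 1 →
      (fun z : κ => aeval z f)^[k] (b i) = b j' → i = j ∧ j' = j ∧ k = m + 1)
    {k : ℕ} (hk : k ≤ m + 1) {j' : ι} {x x' : B}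
    (hx : (fun z : B => aeval z f)^[k] x = b j') (hx' : (fun z : B => aeval z f)^[k] x' = b j')
    (hne : x ≠ x') (hxx' : φ x = φ x') :
    k = m + 1 ∧ j' = j ∧ φ x = b j := by
  classical
  have h1 := prod_X_sub_C_dvd_map φ (monic_iterate_comp_sub_C hf hd k (b j')) {x, x'} (by
    intro y hy
    rw [map_sub, ← iterate_aeval, aeval_C]
    rcases Finset.mem_insert.mp hy with rfl | hy
    · rw [hx]; simp
    · rw [Finset.mem_singleton.mp hy, hx']; simp)
  rw [Finset.prod_pair hne, ← hxx'] at h1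
  obtain ⟨r, hr⟩ := h1
  have h2 : aeval (φ x) (derivative (f.comp^[k] X)) = 0 := by
    have := congrArg (fun P => eval (φ x) (derivative P)) hr
    rw [derivative_map, eval_map_algebraMap] at this
    simpa using this
  obtain ⟨s, hs, h3⟩ := exists_aeval_derivative_eq_zero f k _ h2
  obtain ⟨i, hi⟩ := hder _ h3
  have h4 : (fun z : κ => aeval z f)^[k - s] (b i) = b j' := by
    rw [← hi, ← Function.iterate_add_apply, Nat.sub_add_cancel hs.le, ← map_ringHom_iterate_aeval, hx]
    simp
  obtain ⟨rfl, rfl, h5⟩ := horb i j' (k - s) (by omega) (by omega) h4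
  obtain rfl : s = 0 := by omega
  exact ⟨by omega, rfl, hi⟩

/-- Three such roots would make `b j` a triple root of the reduction. As `f'(b j) = 0`, the second
derivative there is `f''(b j)` times the derivative of `f^m` at `f(b j)`; the first factor is
nonzero by assumption, the second because the orbit of `b j` meets no critical point before time `m
+ 1`. -/
theorem not_three_congruent_roots {f : ℤ[X]} (hf : f.Monic) (hd : f.natDegree ≠ 0) {ι : Type*}
    {b : ι → ℤ} {m : ℕ} {j : ι}
    (hder : ∀ z : κ, aeval z (derivative f) = 0 → ∃ i, z = (b i : κ))
    (hbj : aeval (b j : κ) (derivative f) = 0)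
    (hbj' : aeval (b j : κ) (derivative (derivative f)) ≠ 0)
    (horb : ∀ i j' k, 1 ≤ k → k ≤ m + 1 →
      (fun z : κ => aeval z f)^[k] (b i) = b j' → i = j ∧ j' = j ∧ k = m + 1)
    {x y z : B} (hxy : x ≠ y) (hxz : x ≠ z) (hyz : y ≠ z)
    (hx : (fun z : B => aeval z f)^[m + 1] x = b j) (hx' : φ x = b j)
    (hy : (fun z : B => aeval z f)^[m + 1] y = b j) (hy' : φ y = b j)
    (hz : (fun z : B => aeval z f)^[m + 1] z = b j) (hz' : φ z = b j) : False := by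
  classical
  have h1 := prod_X_sub_C_dvd_map φ (monic_iterate_comp_sub_C hf hd (m + 1) (b j)) {x, y, z} (by
    intro w hw
    rw [map_sub, ← iterate_aeval, aeval_C]
    simp only [Finset.mem_insert, Finset.mem_singleton] at hw
    rcases hw with rfl | rfl | rfl
    · rw [hx]; simp
    · rw [hy]; simp
    · rw [hz]; simp)
  rw [Finset.prod_insert (by simp [hxy, hxz]), Finset.prod_pair hyz,
    hx', hy', hz'] at h1
  obtain ⟨r, hr⟩ := h1
  have h2 := congrArg (fun P => eval (b j : κ) (derivative (derivative P))) hr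
  rw [derivative_map, derivative_map, eval_map_algebraMap] at h2
  simp only [map_sub, derivative_C, sub_zero, derivative_iterate_comp_succ, derivative_mul,
    map_add, map_mul, hbj, zero_mul, add_zero, aeval_comp] at h2
  have h3 : aeval (b j : κ) (derivative (derivative f)) *
      aeval (aeval (b j : κ) f) (derivative (f.comp^[m] X)) = 0 := by
    rw [h2]
    simp
  rcases mul_eq_zero.mp h3 with h3 | h3
  · exact hbj' h3
  · obtain ⟨s, hs, h4⟩ := exists_aeval_derivative_eq_zero f m _ h3
    obtain ⟨i, hi⟩ := hder _ h4
    rw [← Function.iterate_succ_apply (fun z : κ => aeval z f)] at hi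
    obtain ⟨-, -, h5⟩ := horb j i (s + 1) (by omega) (by omega) hi
    omega

/-- A simple critical relation `f^{m+1}(b j) ≡ b j`, exact at `p`, produces a transposition in the
inertia group. -/
theorem exists_actsAsSwap_of_inertia {Q : Ideal B} [Q.IsPrime] (hφ : ∀ x, φ x = 0 ↔ x ∈ Q)
    {f : ℤ[X]} (hf : f.Monic) (hd : f.natDegree ≠ 0)
    {ι : Type*} {b : ι → ℤ} {m : ℕ} {j : ι}
    (hder : ∀ z : κ, aeval z (derivative f) = 0 → ∃ i, z = (b i : κ))
    (hbj : (derivative f).eval (b j) = 0)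
    (hbj' : aeval (b j : κ) (derivative (derivative f)) ≠ 0)
    (horb : ∀ i j' k, 1 ≤ k → k ≤ m + 1 →
      (fun z : κ => aeval z f)^[k] (b i) = b j' → i = j ∧ j' = j ∧ k = m + 1)
    {p : ℕ} {u : ℤ} (hpQ : (p : B) ∈ Q) (huQ : (u : B) ∉ Q)
    (hval : (f.comp^[m + 1] X).eval (b j) - b j = p * u)
    {e : ℕ} (hfix : ∀ x : B, (∀ σ ∈ Q.inertia G, σ • x = x) → x ∈ Q → x ∈ Q ^ e)
    (hpe : (p : B) ∉ Q ^ (e + 1))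
    {s : Multiset B}
    (hs : (f.comp^[m + 1] X - C (b j)).map (algebraMap ℤ B) = (s.map fun a => X - C a).prod) :
    ∃ (σ : G) (x₁ x₂ : B), (fun z : B => aeval z f)^[m + 1] x₁ = b j ∧ x₁ ≠ x₂ ∧
      aeval x₁ f = aeval x₂ f ∧
      ActsAsSwap σ (backwardLevel (fun z : B => aeval z f) (fun i => (b i : B)) (m + 1)) x₁ x₂ := by
  classical
  set F : B → B := fun z => aeval z f with hFdef
  have hF : ∀ (σ : G) x, σ • F x = F (σ • x) := fun σ x => (aeval_smul f σ x).symm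
  have hcast : ∀ (σ : G) (a : ℤ), σ • (a : B) = a := fun σ a =>
    map_intCast (MulSemiringAction.toRingHom G B σ) a
  have he : 1 ≤ e := by
    rcases Nat.eq_zero_or_pos e with rfl | h
    · simp [hpQ] at hpe
    · exact h
  have hbjQ : aeval (b j : κ) (derivative f) = 0 := by
    have := congrArg (Int.cast : ℤ → κ) hbj
    simpa [aeval_def, eval₂_at_intCast] using this
  have hevB : aeval (b j : B) (f.comp^[m + 1] X) - b j = (p : B) * u := by
    have := congrArg (Int.cast : ℤ → B) hval
    push_cast at this
    rw [← this, aeval_def, eval₂_at_intCast]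
    simp
  obtain ⟨x₁, hx₁, hx₁Q⟩ := exists_root_of_splits φ hs (b j : B) (by
    rw [← map_ringHom_aeval, hφ, map_sub, aeval_C]
    change _ - ((b j : ℤ) : B) ∈ Q
    rw [hevB]
    exact Q.mul_mem_right _ hpQ)
  rw [map_intCast] at hx₁Q
  have hx₁' : F^[m + 1] x₁ = b j := by
    rw [iterate_aeval]
    rw [map_sub, aeval_C, sub_eq_zero] at hx₁
    exact hx₁
  -- If inertia fixed `x₁`, then `x₁ - b j` would lie in `Q ^ e`. The expansion of `f^{m+1}` at the
  -- critical point `b j` has no linear term, so `p * u` would lie in `Q ^ (2 * e)`, beyond the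
  -- order of `p`.
  have hmove : ∃ σ ∈ Q.inertia G, σ • x₁ ≠ x₁ := by
    by_contra! hfx
    have h1 := hfix (x₁ - b j) (fun σ hσ => by rw [smul_sub, hfx σ hσ, hcast])
      ((hφ _).mp (by rw [map_sub, hx₁Q, map_intCast, sub_self]))
    obtain ⟨k, hk⟩ := binomExpansion ((f.comp^[m + 1] X).map (algebraMap ℤ B)) (b j : B) (x₁ - b j)
    rw [derivative_map, eval_map_algebraMap, eval_map_algebraMap, eval_map_algebraMap,
      derivative_iterate_comp_succ, map_mul] at hk
    have h2 : aeval (b j : B) (derivative f) = 0 := by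
      have := congrArg (Int.cast : ℤ → B) hbj
      simpa [aeval_def, eval₂_at_intCast] using this
    rw [h2, zero_mul, zero_mul, add_zero, add_sub_cancel, ← iterate_aeval] at hk
    have h3 : (u : B) * p = -(k * (x₁ - b j) ^ 2) := by
      rw [mul_comm, ← hevB]
      have : (fun z : B => aeval z f)^[m + 1] x₁ = b j := hx₁'
      rw [this] at hk
      linear_combination -hk
    have h4 : (u : B) * p ∈ Q ^ (e + 1) := by
      rw [h3]
      refine neg_mem (Ideal.mul_mem_left _ _ ?_)
      refine Ideal.pow_le_pow_right (show e + 1 ≤ e * 2 by omega) ?_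
      rw [pow_mul]
      exact Ideal.pow_mem_pow h1 2
    rcases Ideal.IsPrime.mul_mem_pow Q h4 with h | h
    · exact huQ h
    · exact hpe h
  obtain ⟨σ, hσ, hσx⟩ := hmove
  have hres : ∀ z : B, φ (σ • z) = φ z := fun z => by
    rw [← sub_eq_zero, ← map_sub, hφ]
    exact hσ z
  have hlev : ∀ {k : ℕ} {i : ι} {z : B}, F^[k] z = b i → F^[k] (σ • z) = b i := by
    intro k i z hz
    rw [← smul_iterate_of_equivariant hF, hz, hcast]
  have hx₂ := hlev hx₁'
  have hx₂Q : φ (σ • x₁) = b j := (hres x₁).trans hx₁Q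
  have h3 : ∀ z, F^[m + 1] z = b j → φ z = b j → z = x₁ ∨ z = σ • x₁ := by
    intro z hz hzQ
    by_contra! hne
    exact not_three_congruent_roots φ hf hd hder hbjQ hbj' horb hne.1 hne.2 (Ne.symm hσx)
      hz hzQ hx₁' hx₁Q hx₂ hx₂Q
  refine ⟨σ, x₁, σ • x₁, hx₁', Ne.symm hσx, ?_, ?_⟩
  -- Non-siblings would have distinct colliding images on level `m`, and collisions happen only on
  -- level `m + 1`.
  · by_contra hne
    have := eq_of_congruent_roots φ hf hd hder horb (k := m) (by omega) (j' := j)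
      (x := aeval x₁ f) (x' := aeval (σ • x₁) f) hx₁' hx₂ hne
      (by rw [map_ringHom_aeval, map_ringHom_aeval, hres])
    omega
  · rintro z ⟨j', hz⟩
    by_cases hz1 : z = x₁
    · rw [hz1, Equiv.swap_apply_left]
    by_cases hz2 : z = σ • x₁
    · rw [hz2, Equiv.swap_apply_right]
      have h4 : φ (σ • σ • x₁) = b j := (hres _).trans hx₂Q
      rcases h3 _ (hlev hx₂) h4 with h | h
      · exact h
      · exact absurd (smul_left_cancel σ h) hσx
    rw [Equiv.swap_apply_of_ne_of_ne hz1 hz2]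
    -- A moved point collides with its image under inertia, so it is one of the two roots reducing
    -- to `b j`.
    by_contra hne
    obtain ⟨-, rfl, h4⟩ := eq_of_congruent_roots φ hf hd hder horb le_rfl hz (hlev hz)
      (Ne.symm hne) (hres z).symm
    rcases h3 z hz h4 with h | h
    · exact hz1 h
    · exact hz2 h

end Transposition

end

/-! ### Total ramification near the origin -/

section

open scoped Pointwise
open Polynomial

section IdealVal

variable {B : Type*} [CommRing B] [IsDedekindDomain B] (Q : Ideal B)

/-- The order of vanishing of `x` at the ideal `Q`. -/
noncomputable def idealVal (x : B) : ℕ∞ := emultiplicity Q (Ideal.span {x})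

theorem le_idealVal_iff {x : B} {n : ℕ} : (n : ℕ∞) ≤ idealVal Q x ↔ x ∈ Q ^ n := by
  rw [idealVal, ← pow_dvd_iff_le_emultiplicity, Ideal.dvd_iff_le, Ideal.span_singleton_le_iff_mem]

theorem idealVal_eq_iff {x : B} {n : ℕ} :
    idealVal Q x = n ↔ x ∈ Q ^ n ∧ x ∉ Q ^ (n + 1) := by
  rw [idealVal, emultiplicity_eq_coe, Ideal.dvd_iff_le, Ideal.span_singleton_le_iff_mem,
    Ideal.dvd_iff_le, Ideal.span_singleton_le_iff_mem]

theorem idealVal_eq_of_sub_mem {x y : B} {n : ℕ} (hy : idealVal Q y = n)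
    (h : x - y ∈ Q ^ (n + 1)) : idealVal Q x = n := by
  rw [idealVal_eq_iff] at hy ⊢
  have hx : x = (x - y) + y := by ring
  refine ⟨?_, fun hx' => hy.2 ?_⟩
  · rw [hx]
    exact add_mem (Ideal.pow_le_pow_right n.le_succ h) hy.1
  · have := sub_mem hx' h
    rwa [sub_sub_cancel] at this

theorem idealVal_eq_zero {x : B} (hx : x ∉ Q) : idealVal Q x = 0 := by
  have := (idealVal_eq_iff Q (x := x) (n := 0)).mpr ⟨by simp, by simpa using hx⟩
  simpa using this

theorem idealVal_smul_of_mem_inertia {G : Type*} [Group G] [MulSemiringAction G B] {σ : G}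
    (hσ : σ ∈ Q.inertia G) (x : B) : idealVal Q (σ • x) = idealVal Q x := by
  have h1 : ∀ τ ∈ Q.inertia G, ∀ (n : ℕ) (y : B), y ∈ Q ^ n → τ • y ∈ Q ^ n := by
    intro τ hτ n y hy
    have h2 : τ • Q = Q := Ideal.inertia_le_stabilizer Q hτ
    have h3 := Ideal.smul_mem_pointwise_smul τ y (Q ^ n) hy
    rwa [smul_pow', h2] at h3
  refine le_antisymm ?_ ?_
  · refine ENat.forall_natCast_le_iff_le.mp fun n hn => ?_
    rw [le_idealVal_iff] at hn ⊢
    simpa using h1 σ⁻¹ (inv_mem hσ) n _ hn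
  · refine ENat.forall_natCast_le_iff_le.mp fun n hn => ?_
    rw [le_idealVal_iff] at hn ⊢
    exact h1 σ hσ n _ hn

variable [hQ : Q.IsPrime]

theorem idealVal_mul (hQ0 : Q ≠ ⊥) (x y : B) :
    idealVal Q (x * y) = idealVal Q x + idealVal Q y := by
  rw [idealVal, ← Ideal.span_singleton_mul_span_singleton,
    emultiplicity_mul (Ideal.prime_of_isPrime hQ0 hQ)]
  rfl

theorem idealVal_pow (hQ0 : Q ≠ ⊥) (x : B) (n : ℕ) : idealVal Q (x ^ n) = n * idealVal Q x := by
  rw [idealVal, ← Ideal.span_singleton_pow, emultiplicity_pow (Ideal.prime_of_isPrime hQ0 hQ)]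
  rfl

theorem idealVal_prod (hQ0 : Q ≠ ⊥) (s : Finset B) :
    idealVal Q (∏ x ∈ s, x) = ∑ x ∈ s, idealVal Q x := by
  rw [idealVal, ← Ideal.prod_span_singleton,
    Finset.emultiplicity_prod (Ideal.prime_of_isPrime hQ0 hQ)]
  rfl

end IdealVal

section TotallyRamified

variable {B G : Type*} [CommRing B] [IsDedekindDomain B] [Group G] [MulSemiringAction G B]
  {Q : Ideal B} [hQ : Q.IsPrime]

theorem aeval_sub_coeff_zero_mem {B : Type*} [CommRing B] {Q : Ideal B} (f : ℤ[X]) {x : B} (hx : x ∈ Q) :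
    aeval x f - (f.coeff 0 : ℤ) ∈ Q := by
  have h1 := sub_dvd_eval_sub x 0 (f.map (algebraMap ℤ B))
  rw [sub_zero, eval_map_algebraMap, ← coeff_zero_eq_eval_zero, coeff_map] at h1
  exact Ideal.mem_of_dvd _ h1 hx

theorem aeval_mem_of_mem {B : Type*} [CommRing B] {Q : Ideal B} {f : ℤ[X]} (hf : ((f.coeff 0 : ℤ) : B) ∈ Q) {x : B} (hx : x ∈ Q) :
    aeval x f ∈ Q := by
  have := Q.add_mem (aeval_sub_coeff_zero_mem f hx) hf
  rwa [sub_add_cancel] at this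

theorem aeval_notMem_of_mem {B : Type*} [CommRing B] {Q : Ideal B} {f : ℤ[X]} (hf : ((f.coeff 0 : ℤ) : B) ∉ Q) {x : B} (hx : x ∈ Q) :
    aeval x f ∉ Q := by
  intro h3
  have := Q.sub_mem h3 (aeval_sub_coeff_zero_mem f hx)
  rw [sub_sub_cancel] at this
  exact hf this

/-- The data of a polynomial whose reduction at `p` has a zero of order `D` at the origin and
which is Eisenstein there. -/
structure EisensteinShape (f g h : ℤ[X]) (D p : ℕ) (u : ℤ) : Prop where
  two_le : 2 ≤ D
  eq : f = X ^ D * g + C (p : ℤ) * (X * h) + C (p * u)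

variable {f g h : ℤ[X]} {D p e : ℕ} {u b : ℤ}

theorem EisensteinShape.coeff_zero_mem {B : Type*} [CommRing B] {Q : Ideal B}
    (hf : EisensteinShape f g h D p u) (hpQ : (p : B) ∈ Q) :
    ((f.coeff 0 : ℤ) : B) ∈ Q := by
  have hD : D ≠ 0 := by have := hf.two_le; omega
  rw [hf.eq, coeff_zero_eq_eval_zero]
  simp [hD, Q.mul_mem_right _ hpQ]

/-- A Newton polygon computation. When `f(x) = b`, the term `p * u` has order exactly `e` while `p *
x * h(x)` and `b` have larger order, so `x ^ D * g(x)` has order `e`. When `f(x)` is itself an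
earlier preimage, its order is below `e` since `D ≥ 2`; the terms divisible by `p` are then
negligible and `D` times the order of `x` is that of `f(x)`. -/
theorem EisensteinShape.idealVal_eq (hf : EisensteinShape f g h D p u)
    (hQ0 : Q ≠ ⊥) (hg : ((g.coeff 0 : ℤ) : B) ∉ Q) (hu : (u : B) ∉ Q)
    (hpQ : (p : B) ∈ Q) (hpv : idealVal Q (p : B) = e) (hb : (b : B) ∈ Q ^ (e + 1)) :
    ∀ (k : ℕ) (x : B), x ∈ Q → (fun z : B => aeval z f)^[k + 1] x = b →
      (D : ℕ∞) ^ (k + 1) * idealVal Q x = e := by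
  have hF : ∀ x : B, x ∈ Q → aeval x f ∈ Q := fun x hx =>
    aeval_mem_of_mem (hf.coeff_zero_mem hpQ) hx
  have hpe := ((idealVal_eq_iff Q).mp hpv).1
  have hxf : ∀ x : B, aeval x f = x ^ D * aeval x g + p * (x * aeval x h) + p * u := fun x => by
    conv_lhs => rw [hf.eq]
    simp
  have hmem : ∀ x : B, x ∈ Q → (p : B) * (x * aeval x h) ∈ Q ^ (e + 1) := fun x hx => by
    rw [pow_succ, ← mul_assoc]
    exact Ideal.mul_mem_right _ _ (Ideal.mul_mem_mul hpe hx)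
  have hval : ∀ x : B, x ∈ Q → idealVal Q (x ^ D * aeval x g) = D * idealVal Q x := fun x hx => by
    rw [idealVal_mul Q hQ0, idealVal_pow Q hQ0, idealVal_eq_zero Q (aeval_notMem_of_mem hg hx),
      add_zero]
  have hpu : idealVal Q ((p : B) * u) = e := by
    rw [idealVal_mul Q hQ0, hpv, idealVal_eq_zero Q hu, add_zero]
  intro k
  induction k with
  | zero =>
    intro x hx hxb
    rw [zero_add, pow_one, ← hval x hx]
    have h1 : idealVal Q (-((p : B) * u)) = e := by
      rw [idealVal_eq_iff] at hpu ⊢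
      simpa only [neg_mem_iff] using hpu
    refine idealVal_eq_of_sub_mem Q h1 ?_
    have h2 : x ^ D * aeval x g - -((p : B) * u) = b - p * (x * aeval x h) := by
      have : aeval x f = (b : B) := hxb
      rw [← this, hxf]
      ring
    rw [h2]
    exact sub_mem hb (hmem x hx)
  | succ k ih =>
    intro x hx hxb
    have h1 := ih (aeval x f) (hF x hx) hxb
    have he : 0 < e := by
      rcases Nat.eq_zero_or_pos e with rfl | h
      · have := ((idealVal_eq_iff Q).mp hpv).2
        simp [hpQ] at this
      · exact h
    obtain ⟨v, hv⟩ : ∃ v : ℕ, idealVal Q (aeval x f) = v := by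
      cases hc : idealVal Q (aeval x f) with
      | top =>
        rw [hc, ENat.mul_top (pow_ne_zero _ (by exact_mod_cast (by have := hf.two_le; omega)))] at h1
        exact absurd h1.symm (ENat.natCast_ne_top e)
      | coe v => exact ⟨v, rfl⟩
    have hve : v < e := by
      rw [hv] at h1
      have h1' : D ^ (k + 1) * v = e := by exact_mod_cast h1
      have hv0 : 0 < v := by
        rcases Nat.eq_zero_or_pos v with rfl | h
        · simp at h1'; omega
        · exact h
      have h2 : 2 ≤ D ^ (k + 1) := hf.two_le.trans (Nat.le_self_pow k.succ_ne_zero D)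
      nlinarith
    have h2 : idealVal Q (x ^ D * aeval x g) = v := by
      refine idealVal_eq_of_sub_mem Q hv ?_
      have h3 : x ^ D * aeval x g - aeval x f = -(p * (x * aeval x h) + p * u) := by
        rw [hxf]; ring
      rw [h3]
      refine neg_mem (add_mem ?_ ?_)
      · exact Ideal.pow_le_pow_right (by omega) (hmem x hx)
      · refine Ideal.pow_le_pow_right (show v + 1 ≤ e by omega) ?_
        exact ((idealVal_eq_iff Q).mp hpu).1
    rw [pow_succ, mul_assoc, ← hval x hx, h2, ← hv, h1]

/-- The product over the inertia orbit of `x` is invariant and lies in `Q`, so its order is at least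
`e`. All factors have the order of `x`, and `D ^ k` times that order is `e` when `k > 0`; the orbit
therefore has at least `D ^ k` elements. -/
theorem EisensteinShape.le_card_orbit [Finite G] (hf : EisensteinShape f g h D p u)
    (hQ0 : Q ≠ ⊥) (hg : ((g.coeff 0 : ℤ) : B) ∉ Q) (hu : (u : B) ∉ Q)
    (hpQ : (p : B) ∈ Q) (hpv : idealVal Q (p : B) = e) (hb : (b : B) ∈ Q ^ (e + 1))
    (hfix : ∀ x : B, (∀ σ ∈ Q.inertia G, σ • x = x) → x ∈ Q → x ∈ Q ^ e)
    {k : ℕ} {x : B} (hx : x ∈ Q) (hxb : (fun z : B => aeval z f)^[k] x = b) :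
    ∃ O : Finset B, D ^ k ≤ O.card ∧ ∀ a ∈ O, ∃ σ ∈ Q.inertia G, σ • x = a := by
  classical
  rcases Nat.eq_zero_or_pos k with rfl | hk
  · exact ⟨{x}, by simp, fun a ha => ⟨1, one_mem _, by simp [Finset.mem_singleton.mp ha]⟩⟩
  obtain ⟨k, rfl⟩ := Nat.exists_eq_succ_of_ne_zero hk.ne'
  have := Fintype.ofFinite (Q.inertia G)
  let O : Finset B := Finset.univ.image fun σ : Q.inertia G => σ.1 • x
  have hO : ∀ a, a ∈ O ↔ ∃ σ ∈ Q.inertia G, σ • x = a := fun a => by simp [O]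
  refine ⟨O, ?_, fun a ha => (hO a).mp ha⟩
  have hxv := hf.idealVal_eq hQ0 hg hu hpQ hpv hb k x hx hxb
  have hfixed : ∀ σ ∈ Q.inertia G, σ • ∏ a ∈ O, a = ∏ a ∈ O, a := fun σ hσ => by
    have himg : O.image (fun a => σ • a) = O := by
      refine Finset.eq_of_subset_of_card_le ?_ ?_
      · intro a ha
        obtain ⟨c, hc, rfl⟩ := Finset.mem_image.mp ha
        obtain ⟨τ, hτ, rfl⟩ := (hO c).mp hc
        exact (hO _).mpr ⟨σ * τ, mul_mem hσ hτ, mul_smul _ _ _⟩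
      · rw [Finset.card_image_of_injective _ (MulAction.injective σ)]
    have h1 : σ • ∏ a ∈ O, a = ∏ a ∈ O, σ • a :=
      map_prod (MulSemiringAction.toRingHom G B σ) _ _
    rw [h1]
    conv_rhs => rw [← himg]
    rw [Finset.prod_image fun a _ c _ hac => MulAction.injective σ hac]
  have hxO : x ∈ O := (hO x).mpr ⟨1, one_mem _, one_smul _ _⟩
  have hprodQ : ∏ a ∈ O, a ∈ Q := Ideal.mem_of_dvd _ (Finset.dvd_prod_of_mem _ hxO) hx
  have h2 := (le_idealVal_iff Q).mpr (hfix _ hfixed hprodQ)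
  have h3 : idealVal Q (∏ a ∈ O, a) = O.card * idealVal Q x := by
    rw [idealVal_prod Q hQ0, Finset.sum_congr rfl (g := fun _ => idealVal Q x), Finset.sum_const,
      nsmul_eq_mul]
    intro a ha
    obtain ⟨σ, hσ, rfl⟩ := (hO a).mp ha
    exact idealVal_smul_of_mem_inertia Q hσ x
  rw [h3, ← hxv] at h2
  have hx1 : (1 : ℕ∞) ≤ idealVal Q x := by
    have := (le_idealVal_iff Q (x := x) (n := 1)).mpr (by simpa using hx)
    simpa using this
  cases hc : idealVal Q x with
  | top =>
    rw [hc, ENat.mul_top (pow_ne_zero _ (by exact_mod_cast (by have := hf.two_le; omega)))] at hxv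
    exact absurd hxv.symm (ENat.natCast_ne_top e)
  | coe v =>
    rw [hc] at h2 hx1
    have h2' : D ^ (k + 1) * v ≤ O.card * v := by exact_mod_cast h2
    exact Nat.le_of_mul_le_mul_right h2' (by exact_mod_cast hx1)

variable {κ : Type*} [CommRing κ] [IsDomain κ]

theorem exists_map_iterate_comp_eq {f : ℤ[X]} {g : κ[X]} {D : ℕ} (hD : D ≠ 0)
    (hf : f.map (algebraMap ℤ κ) = X ^ D * g) (hg : g.eval 0 ≠ 0) (k : ℕ) :
    ∃ r : κ[X], (f.comp^[k] X).map (algebraMap ℤ κ) = X ^ D ^ k * r ∧ r.eval 0 ≠ 0 := by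
  induction k with
  | zero => exact ⟨1, by simp, by simp⟩
  | succ k ih =>
    obtain ⟨r, hr, hr0⟩ := ih
    refine ⟨r ^ D * g.comp (X ^ D ^ k * r), ?_, ?_⟩
    · rw [Function.iterate_succ_apply', Polynomial.map_comp, hf, hr]
      simp only [mul_comp, X_pow_comp]
      rw [mul_pow, ← pow_mul, ← pow_succ]
      ring
    · have : D ^ k ≠ 0 := pow_ne_zero _ hD
      have h0 : (0 : κ) ^ D ^ k = 0 := zero_pow this
      simp [eval_comp, hr0, hg, h0]

/-- The reduction of `f^k - b` vanishes at the origin to order exactly `D ^ k`. This is the upper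
bound matching `EisensteinShape.le_card_orbit`. -/
theorem card_le_of_roots_mem_ker {φ : B →+* κ} {f : ℤ[X]} (hfm : f.Monic) (hfd : f.natDegree ≠ 0)
    {g : κ[X]} {D : ℕ} (hD : D ≠ 0)
    (hf : f.map (algebraMap ℤ κ) = X ^ D * g) (hg : g.eval 0 ≠ 0) {b : ℤ} (hb : (b : κ) = 0)
    {k : ℕ} {s : Finset B}
    (hs : ∀ x ∈ s, (fun z : B => aeval z f)^[k] x = b ∧ φ x = 0) : s.card ≤ D ^ k := by
  have h1 := prod_X_sub_C_dvd_map φ (monic_iterate_comp_sub_C hfm hfd k b) s (fun x hx => by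
    rw [map_sub, ← iterate_aeval, aeval_C, (hs x hx).1]; simp)
  obtain ⟨r, hr, hr0⟩ := exists_map_iterate_comp_eq hD hf hg k
  rw [Finset.prod_congr rfl (g := fun _ => X) (fun x hx => by simp [(hs x hx).2]),
    Finset.prod_const, Polynomial.map_sub, hr, map_C] at h1
  have hb' : algebraMap ℤ κ b = 0 := hb
  rw [hb', C_0, sub_zero] at h1
  by_contra! hlt
  have h2 : X ^ (D ^ k) * X ∣ X ^ D ^ k * r :=
    (by rw [← pow_succ]; exact pow_dvd_pow _ hlt : X ^ (D ^ k) * X ∣ X ^ s.card).trans h1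
  rw [mul_dvd_mul_iff_left (pow_ne_zero _ X_ne_zero), X_dvd_iff, coeff_zero_eq_eval_zero] at h2
  exact hr0 h2

theorem EisensteinShape.map_eq {κ : Type*} [CommRing κ] (hf : EisensteinShape f g h D p u) (hp : (p : κ) = 0) :
    f.map (algebraMap ℤ κ) = X ^ D * g.map (algebraMap ℤ κ) := by
  have hp' : (p : κ[X]) = 0 := by rw [← C_eq_natCast, hp, C_0]
  rw [hf.eq]
  simp [hp']

/-- The inertia group acts transitively on the roots of `f^k = b` in `Q`. -/
theorem EisensteinShape.exists_inertia_smul_eq [Finite G] (hf : EisensteinShape f g h D p u)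
    (hfm : f.Monic) (hfd : f.natDegree ≠ 0) {φ : B →+* κ} (hφ : ∀ x, φ x = 0 ↔ x ∈ Q)
    (hQ0 : Q ≠ ⊥) (hg : ((g.coeff 0 : ℤ) : B) ∉ Q) (hu : (u : B) ∉ Q)
    (hpQ : (p : B) ∈ Q) (hpv : idealVal Q (p : B) = e) (hb : (b : B) ∈ Q ^ (e + 1))
    (hfix : ∀ x : B, (∀ σ ∈ Q.inertia G, σ • x = x) → x ∈ Q → x ∈ Q ^ e)
    {k : ℕ} {x x' : B} (hx : x ∈ Q) (hxb : (fun z : B => aeval z f)^[k] x = b)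
    (hx' : x' ∈ Q) (hxb' : (fun z : B => aeval z f)^[k] x' = b) :
    ∃ σ ∈ Q.inertia G, σ • x = x' := by
  classical
  obtain ⟨O, hO, hO'⟩ := hf.le_card_orbit (G := G) hQ0 hg hu hpQ hpv hb hfix hx hxb
  by_contra hne
  have hx'O : x' ∉ O := fun h => hne (hO' x' h)
  have hF : ∀ (σ : G) (x : B), σ • aeval x f = aeval (σ • x) f := fun σ x => (aeval_smul f σ x).symm
  have hmap : ∀ n : ℤ, φ (n : B) = n := fun n => map_intCast φ n
  have hb1 : (b : B) ∈ Q := Ideal.pow_le_self e.succ_ne_zero hb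
  have := card_le_of_roots_mem_ker (φ := φ) (b := b) (k := k) (s := insert x' O) hfm hfd
    (by have := hf.two_le; omega : D ≠ 0) (hf.map_eq (by rw [← map_natCast φ, hφ]; exact hpQ))
    (by
      rw [← coeff_zero_eq_eval_zero, coeff_map]
      change ((g.coeff 0 : ℤ) : κ) ≠ 0
      rwa [← hmap, Ne, hφ])
    (by rw [← hmap, hφ]; exact hb1)
    (by
      intro y hy
      rcases Finset.mem_insert.mp hy with rfl | hy
      · exact ⟨hxb', (hφ _).mpr hx'⟩
      · obtain ⟨σ, hσ, rfl⟩ := hO' y hy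
        refine ⟨?_, ?_⟩
        · rw [← smul_iterate_of_equivariant hF, hxb]
          exact map_intCast (MulSemiringAction.toRingHom G B σ) b
        · rw [hφ]
          have := Q.add_mem (hσ x) hx
          rwa [sub_add_cancel] at this)
  rw [Finset.card_insert_of_notMem hx'O] at this
  omega

end TotallyRamified

end

/-! ### Local conditions at primes and their effect on the action -/

section

open scoped Pointwise
open Polynomial

/-- There is a maximal ideal of `B` over `p` such that elements invariant under its inertia group
have order at least that of `p` as soon as they vanish there. -/
def HasInertiaPrime (G B : Type*) [CommRing B] [Group G] [MulSemiringAction G B] (p : ℕ) : Prop :=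
  ∃ (Q : Ideal B) (e : ℕ), Q.IsMaximal ∧ Q ≠ ⊥ ∧ (p : B) ∈ Q ∧
    (∀ x : B, (∀ σ ∈ Q.inertia G, σ • x = x) → x ∈ Q → x ∈ Q ^ e) ∧ (p : B) ∉ Q ^ (e + 1)

theorem intCast_mem_iff {B : Type*} [CommRing B] {Q : Ideal B} [hQ : Q.IsPrime] {p : ℕ}
    (hp : p.Prime) (hpQ : (p : B) ∈ Q) (a : ℤ) : (a : B) ∈ Q ↔ (p : ℤ) ∣ a := by
  constructor
  · intro ha
    by_contra hpa
    obtain ⟨r, s, hrs⟩ := (Nat.prime_iff_prime_int.mp hp).coprime_iff_not_dvd.mpr hpa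
    apply hQ.ne_top
    rw [Ideal.eq_top_iff_one]
    have := congrArg (Int.cast : ℤ → B) hrs
    push_cast at this
    rw [← this]
    exact Q.add_mem (Q.mul_mem_left _ hpQ) (Q.mul_mem_left _ ha)
  · rintro ⟨c, rfl⟩
    push_cast
    exact Q.mul_mem_right _ hpQ

section Critical

variable {ι : Type*} [Fintype ι] {f : ℤ[X]} {d : ℕ} {b : ι → ℤ}

theorem exists_eq_of_aeval_derivative {κ : Type*} [CommRing κ] [IsDomain κ]
    (hder : derivative f = C (d : ℤ) * ∏ i, (X - C (b i))) (hd : (d : κ) ≠ 0) (z : κ)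
    (hz : aeval z (derivative f) = 0) : ∃ i, z = b i := by
  rw [hder, map_mul, map_prod, mul_eq_zero] at hz
  rcases hz with hz | hz
  · simp [hd] at hz
  · obtain ⟨i, -, hi⟩ := Finset.prod_eq_zero_iff.mp hz
    refine ⟨i, sub_eq_zero.mp ?_⟩
    simpa using hi

theorem aeval_derivative_derivative_ne_zero {κ : Type*} [CommRing κ] [IsDomain κ]
    (hder : derivative f = C (d : ℤ) * ∏ i, (X - C (b i))) (hd : (d : κ) ≠ 0) (j : ι)
    (hj : ∀ i, i ≠ j → (b i : κ) ≠ b j) :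
    aeval (b j : κ) (derivative (derivative f)) ≠ 0 := by
  classical
  rw [hder, ← Finset.mul_prod_erase _ _ (Finset.mem_univ j)]
  simp only [derivative_mul, derivative_C, derivative_X, map_add, map_mul, map_sub,
    aeval_X, aeval_C, map_prod]
  simp only [eq_intCast, Int.cast_natCast, sub_self, zero_mul, add_zero, sub_zero, map_zero,
    map_one, one_mul, zero_add]
  refine mul_ne_zero hd (Finset.prod_ne_zero_iff.mpr fun i hi => ?_)
  exact sub_ne_zero.mpr (hj i (Finset.ne_of_mem_erase hi)).symm

theorem eval_derivative_eq_zero (hder : derivative f = C (d : ℤ) * ∏ i, (X - C (b i))) (j : ι) :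
    (derivative f).eval (b j) = 0 := by
  rw [hder, eval_mul, eval_prod, Finset.prod_eq_zero (Finset.mem_univ j) (by simp), mul_zero]

end Critical

section Conditions

/-- The local condition at `p` producing a transposition on level `m + 1` over `b j`. -/
structure TranspositionPrime {ι : Type*} (f : ℤ[X]) (b : ι → ℤ) (d m : ℕ) (j : ι) (p : ℕ) :
    Prop where
  prime : p.Prime
  not_dvd : ¬ p ∣ d
  exists_val : ∃ u : ℤ, ¬ (p : ℤ) ∣ u ∧ (f.comp^[m + 1] X).eval (b j) - b j = p * u
  simple : ∀ i, i ≠ j → ¬ (p : ℤ) ∣ b i - b j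
  orbit : ∀ i j' k, 1 ≤ k → k ≤ m + 1 → (p : ℤ) ∣ (f.comp^[k] X).eval (b i) - b j' →
    i = j ∧ j' = j ∧ k = m + 1

/-- The local condition at `p` making inertia transitive on the roots near the origin. -/
structure EisensteinPrime (f g : ℤ[X]) (D : ℕ) (b : ℤ) (p : ℕ) : Prop where
  prime : p.Prime
  shape : ∃ (h : ℤ[X]) (u : ℤ), ¬ (p : ℤ) ∣ u ∧ EisensteinShape f g h D p u
  not_dvd : ¬ (p : ℤ) ∣ g.coeff 0
  dvd : (p : ℤ) ^ 2 ∣ b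

variable {B G : Type*} [CommRing B] [IsDedekindDomain B] [Group G] [MulSemiringAction G B]

theorem TranspositionPrime.exists_actsAsSwap {ι : Type*} [Fintype ι] {f : ℤ[X]} {b : ι → ℤ}
    {d m : ℕ} {j : ι} {p : ℕ} (H : TranspositionPrime f b d m j p) (hf : f.Monic)
    (hd : f.natDegree ≠ 0) (hder : derivative f = C (d : ℤ) * ∏ i, (X - C (b i)))
    (hp : HasInertiaPrime G B p) {s : Multiset B}
    (hs : (f.comp^[m + 1] X - C (b j)).map (algebraMap ℤ B) = (s.map fun a => X - C a).prod) :
    ∃ (σ : G) (x₁ x₂ : B), (fun z : B => aeval z f)^[m + 1] x₁ = b j ∧ x₁ ≠ x₂ ∧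
      aeval x₁ f = aeval x₂ f ∧
      ActsAsSwap σ (backwardLevel (fun z : B => aeval z f) (fun i => (b i : B)) (m + 1)) x₁ x₂ := by
  obtain ⟨Q, e, hQ, hQ0, hpQ, hfix, hpe⟩ := hp
  suffices key : ∀ {κ : Type _} [CommRing κ] [IsDomain κ] (φ : B →+* κ)
      (_ : ∀ x, φ x = 0 ↔ x ∈ Q), ∃ (σ : G) (x₁ x₂ : B),
      (fun z : B => aeval z f)^[m + 1] x₁ = b j ∧ x₁ ≠ x₂ ∧ aeval x₁ f = aeval x₂ f ∧
      ActsAsSwap σ (backwardLevel (fun z : B => aeval z f) (fun i => (b i : B)) (m + 1)) x₁ x₂ from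
    key (Ideal.Quotient.mk Q) fun x => Ideal.Quotient.eq_zero_iff_mem
  intro κ _ _ φ hφ
  have hκ : ∀ a : ℤ, (a : κ) = 0 ↔ (p : ℤ) ∣ a := fun a => by
    rw [← map_intCast φ, hφ, intCast_mem_iff H.prime hpQ]
  have hdκ : (d : κ) ≠ 0 := fun h => H.not_dvd (by
    have := (hκ d).mp (by simpa using h)
    exact_mod_cast this)
  obtain ⟨u, hu, hval⟩ := H.exists_val
  refine exists_actsAsSwap_of_inertia φ hφ hf hd (exists_eq_of_aeval_derivative hder hdκ)
    (eval_derivative_eq_zero hder j) (aeval_derivative_derivative_ne_zero hder hdκ j ?_) ?_ hpQ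
    (fun h => hu ((intCast_mem_iff H.prime hpQ u).mp h)) hval hfix hpe hs
  · intro i hi h
    refine H.simple i hi ((hκ _).mp ?_)
    rw [Int.cast_sub, h, sub_self]
  · intro i j' k hk hk' h
    refine H.orbit i j' k hk hk' ((hκ _).mp ?_)
    rw [iterate_aeval, aeval_def, eval₂_at_intCast] at h
    rw [Int.cast_sub, ← h]
    simp

theorem idealVal_natCast {Q : Ideal B} {p e : ℕ} (hpQ : (p : B) ∈ Q)
    (hfix : ∀ x : B, (∀ σ ∈ Q.inertia G, σ • x = x) → x ∈ Q → x ∈ Q ^ e)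
    (hpe : (p : B) ∉ Q ^ (e + 1)) : idealVal Q (p : B) = e :=
  (idealVal_eq_iff Q).mpr ⟨hfix _ (fun σ _ =>
    map_natCast (MulSemiringAction.toRingHom G B σ) p) hpQ, hpe⟩

theorem intCast_mem_pow_succ {B : Type*} [CommRing B] [MulSemiringAction G B] {Q : Ideal B} {p e : ℕ} (hpQ : (p : B) ∈ Q)
    (hfix : ∀ x : B, (∀ σ ∈ Q.inertia G, σ • x = x) → x ∈ Q → x ∈ Q ^ e) {b : ℤ}
    (hb : (p : ℤ) ^ 2 ∣ b) : (b : B) ∈ Q ^ (e + 1) := by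
  obtain ⟨c, rfl⟩ := hb
  push_cast
  refine Ideal.mul_mem_right _ _ ?_
  rw [pow_two, pow_succ]
  exact Ideal.mul_mem_mul (hfix _ (fun σ _ =>
    map_natCast (MulSemiringAction.toRingHom G B σ) p) hpQ) hpQ

/-- Total ramification: `f^k = b` has `d ^ k` roots, permuted transitively. -/
theorem EisensteinPrime.card_and_transitive [Finite G] {f : ℤ[X]} {b : ℤ} {p : ℕ}
    (H : EisensteinPrime f 1 f.natDegree b p) (hf : f.Monic) (hp : HasInertiaPrime G B p) {k : ℕ}
    {s : Multiset B}
    (hs : (f.comp^[k] X - C b).map (algebraMap ℤ B) = (s.map fun a => X - C a).prod) :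
    (∃ O : Finset B, O.card = f.natDegree ^ k ∧
      ∀ x, x ∈ O ↔ (fun z : B => aeval z f)^[k] x = b) ∧
    (∀ x x' : B, (fun z : B => aeval z f)^[k] x = b → (fun z : B => aeval z f)^[k] x' = b →
      ∃ σ : G, σ • x = x') := by
  classical
  obtain ⟨Q, e, hQ, hQ0, hpQ, hfix, hpe⟩ := hp
  suffices key : ∀ {κ : Type _} [CommRing κ] [IsDomain κ] (φ : B →+* κ)
      (_ : ∀ x, φ x = 0 ↔ x ∈ Q), (∃ O : Finset B, O.card = f.natDegree ^ k ∧
      ∀ x, x ∈ O ↔ (fun z : B => aeval z f)^[k] x = b) ∧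
      (∀ x x' : B, (fun z : B => aeval z f)^[k] x = b → (fun z : B => aeval z f)^[k] x' = b →
        ∃ σ : G, σ • x = x') from
    key (Ideal.Quotient.mk Q) fun x => Ideal.Quotient.eq_zero_iff_mem
  intro κ _ _ φ hφ
  obtain ⟨h, u, hu, hsh⟩ := H.shape
  have hfd : f.natDegree ≠ 0 := by have := hsh.two_le; omega
  have hg : (((1 : ℤ[X]).coeff 0 : ℤ) : B) ∉ Q := fun hm =>
    H.not_dvd ((intCast_mem_iff H.prime hpQ _).mp hm)
  have huQ : (u : B) ∉ Q := fun hm => hu ((intCast_mem_iff H.prime hpQ _).mp hm)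
  have hpv := idealVal_natCast hpQ hfix hpe
  have hb := intCast_mem_pow_succ hpQ hfix H.dvd
  have hbQ : (b : B) ∈ Q := Ideal.pow_le_self e.succ_ne_zero hb
  have hmap := hsh.map_eq (κ := κ) (by rw [← map_natCast φ, hφ]; exact hpQ)
  rw [Polynomial.map_one, mul_one] at hmap
  have hbκ : (b : κ) = 0 := by rw [← map_intCast φ, hφ]; exact hbQ
  -- The reduction of `f` is a pure power of `X`, so every root of `f^k = b`, not only some of them,
  -- lies near the origin.
  have hroot : ∀ x : B, (fun z : B => aeval z f)^[k] x = b → x ∈ Q := fun x hx => by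
    have hz : ∀ (n : ℕ) (z : κ), (fun z : κ => aeval z f)^[n] z = 0 → z = 0 := by
      intro n
      induction n with
      | zero => exact fun z hz => hz
      | succ n ih =>
        intro z hz
        have h1 : aeval z f = 0 := ih _ hz
        rw [← eval_map_algebraMap, hmap, eval_pow, eval_X] at h1
        exact pow_eq_zero_iff hfd |>.mp h1
    rw [← hφ]
    refine hz k _ ?_
    rw [← map_ringHom_iterate_aeval, hx, map_intCast, hbκ]
  have hmem : ∀ x, x ∈ s.toFinset ↔ (fun z : B => aeval z f)^[k] x = b := fun x => by
    rw [Multiset.mem_toFinset, iterate_aeval, ← sub_eq_zero]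
    have : aeval x (f.comp^[k] X) - b = (s.map fun a => x - a).prod := by
      have h1 := congrArg (eval x) hs
      rw [eval_map_algebraMap, eval_multiset_prod, Multiset.map_map] at h1
      simpa using h1
    rw [this, Multiset.prod_eq_zero_iff, Multiset.mem_map]
    simp [sub_eq_zero]
  have hcards : s.card = f.natDegree ^ k := by
    have h1 := congrArg natDegree hs
    rw [natDegree_multiset_prod_X_sub_C_eq_card,
      (monic_iterate_comp_sub_C hf hfd k b).natDegree_map, natDegree_sub_C,
      natDegree_iterate_comp_X] at h1
    exact h1.symm
  have hpos : 0 < s.card := by rw [hcards]; positivity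
  constructor
  · obtain ⟨x, hx⟩ := Multiset.card_pos_iff_exists_mem.mp hpos
    have hxb := (hmem x).mp (Multiset.mem_toFinset.mpr hx)
    obtain ⟨O, hO, hO'⟩ := hsh.le_card_orbit (G := G) hQ0 hg huQ hpQ hpv hb hfix (hroot x hxb) hxb
    refine ⟨s.toFinset, le_antisymm (hcards ▸ s.toFinset_card_le) (hO.trans ?_), hmem⟩
    refine Finset.card_le_card fun a ha => ?_
    obtain ⟨σ, -, rfl⟩ := hO' a ha
    rw [hmem, ← smul_iterate_of_equivariant (fun (σ : G) x => (aeval_smul f σ x).symm), hxb]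
    exact map_intCast (MulSemiringAction.toRingHom G B σ) b
  · intro x x' hx hx'
    obtain ⟨σ, -, h⟩ := hsh.exists_inertia_smul_eq (G := G) hf hfd hφ hQ0 hg huQ hpQ hpv hb hfix
      (hroot x hx) hx (hroot x' hx') hx'
    exact ⟨σ, h⟩

/-- At a prime where `f ≡ X ^ (d - 1) * (X - a)`, inertia fixes one point of some fibre and permutes
the others transitively. -/
theorem EisensteinPrime.exists_stabilizer_transitive [Finite G] {f : ℤ[X]} {c b : ℤ} {p D : ℕ}
    (H : EisensteinPrime f (X - C c) D b p) (hD : f.natDegree = D + 1) (hf : f.Monic)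
    (hp : HasInertiaPrime G B p) {m : ℕ} {s : Multiset B}
    (hs : (f.comp^[m] X - C b).map (algebraMap ℤ B) = (s.map fun a => X - C a).prod)
    (hfib : ∀ z : B, (fun z : B => aeval z f)^[m] z = b →
      ∃ O : Finset B, O.card = f.natDegree ∧ ∀ x ∈ O, aeval x f = z) :
    ∃ x₀ : B, (fun z : B => aeval z f)^[m + 1] x₀ = b ∧ ∀ a a' : B, a ≠ x₀ → a' ≠ x₀ →
      aeval a f = aeval x₀ f → aeval a' f = aeval x₀ f → ∃ τ : G, τ • x₀ = x₀ ∧ τ • a = a' := by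
  classical
  obtain ⟨Q, e, hQ, hQ0, hpQ, hfix, hpe⟩ := hp
  suffices key : ∀ {κ : Type _} [CommRing κ] [IsDomain κ] (φ : B →+* κ)
      (_ : ∀ x, φ x = 0 ↔ x ∈ Q), ∃ x₀ : B, (fun z : B => aeval z f)^[m + 1] x₀ = b ∧
      ∀ a a' : B, a ≠ x₀ → a' ≠ x₀ → aeval a f = aeval x₀ f → aeval a' f = aeval x₀ f →
        ∃ τ : G, τ • x₀ = x₀ ∧ τ • a = a' from
    key (Ideal.Quotient.mk Q) fun x => Ideal.Quotient.eq_zero_iff_mem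
  intro κ _ _ φ hφ
  obtain ⟨h, u, hu, hsh⟩ := H.shape
  have hD2 := hsh.two_le
  have hfd : f.natDegree ≠ 0 := by omega
  have hg : (((X - C c : ℤ[X]).coeff 0 : ℤ) : B) ∉ Q := fun hm =>
    H.not_dvd ((intCast_mem_iff H.prime hpQ _).mp hm)
  have huQ : (u : B) ∉ Q := fun hm => hu ((intCast_mem_iff H.prime hpQ _).mp hm)
  have hpv := idealVal_natCast hpQ hfix hpe
  have hb := intCast_mem_pow_succ hpQ hfix H.dvd
  have hbQ : (b : B) ∈ Q := Ideal.pow_le_self e.succ_ne_zero hb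
  have hbκ : (b : κ) = 0 := by rw [← map_intCast φ, hφ]; exact hbQ
  have hmap := hsh.map_eq (κ := κ) (by rw [← map_natCast φ, hφ]; exact hpQ)
  rw [Polynomial.map_sub, map_X, map_C] at hmap
  have hcκ : algebraMap ℤ κ c ≠ 0 := fun h0 => hg (by
    rw [← hφ, map_intCast]
    simpa using h0)
  generalize algebraMap ℤ κ c = t at hmap hcκ
  have hroot : ∀ z : κ, aeval z f = 0 → z = 0 ∨ z = t := fun z hz => by
    rw [← eval_map_algebraMap, hmap, eval_mul, eval_pow, eval_X, mul_eq_zero, eval_sub, eval_X,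
      eval_C, sub_eq_zero] at hz
    exact hz.imp_left (pow_eq_zero_iff (by omega)).mp
  have h0 : ∀ n : ℕ, (fun z : κ => aeval z f)^[n] 0 = 0 := fun n => by
    refine Function.iterate_fixed ?_ n
    rw [← eval_map_algebraMap, hmap]
    simp [show D ≠ 0 by omega]
  -- The origin is fixed by the reduction, so some point `y` of level `m` reduces to it. The fibre
  -- over `y` reduces to the zeros of `X ^ D * (X - t)`: one point at `t`, the wanted `x₀`, and the
  -- others in `Q`.
  obtain ⟨y, hy, hyφ⟩ := exists_root_of_splits φ hs 0 (by
    rw [map_zero, map_sub, ← iterate_aeval, h0, aeval_C]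
    simpa using hbκ)
  rw [map_zero] at hyφ
  have hyb : (fun z : B => aeval z f)^[m] y = b := by
    rw [map_sub, aeval_C, sub_eq_zero] at hy
    rw [iterate_aeval, hy]
    simp
  have hdvd : ∀ O : Finset B, (∀ x ∈ O, aeval x f = y) →
      ∏ x ∈ O, (X - C (φ x)) ∣ X ^ D * (X - C t) := fun O hO => by
    have hne : f.map (algebraMap ℤ B) - C y ≠ 0 := by
      refine ((hf.map _).sub_of_left ?_).ne_zero
      refine degree_C_le.trans_lt ?_
      rw [hf.degree_map, ← natDegree_pos_iff_degree_pos]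
      omega
    have h1 := prod_X_sub_C_dvd_map_of_roots φ hne O fun x hx => by
      rw [eval_sub, eval_map_algebraMap, hO x hx, eval_C, sub_self]
    rwa [Polynomial.map_sub, map_map_ringHom_map_int, hmap, map_C, hyφ, C_0, sub_zero] at h1
  have hfibκ : ∀ x : B, aeval x f = y → φ x = 0 ∨ φ x = t := fun x hx =>
    hroot _ (by rw [← map_ringHom_aeval, hx, hyφ])
  have huniq : ∀ x x' : B, aeval x f = y → aeval x' f = y → φ x = t → φ x' = t → x = x' := by
    intro x x' hx hx' hxt hxt'
    by_contra hne
    have h1 := hdvd {x, x'} (by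
      intro z hz
      rcases Finset.mem_insert.mp hz with rfl | hz
      · exact hx
      · rw [Finset.mem_singleton.mp hz]; exact hx')
    rw [Finset.prod_pair hne, hxt, hxt', mul_dvd_mul_iff_right (X_sub_C_ne_zero t),
      dvd_iff_isRoot, IsRoot, eval_pow, eval_X] at h1
    exact hcκ (pow_eq_zero_iff (by omega) |>.mp h1)
  obtain ⟨O, hOcard, hO⟩ := hfib y hyb
  -- Were no fibre point to reduce to `t`, all `D + 1` would reduce to zero and `X ^ (D + 1)` would
  -- divide `X ^ D * (X - t)`.
  have hex : ∃ x₀ ∈ O, φ x₀ = t := by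
    by_contra! hno
    have h1 := hdvd O hO
    rw [Finset.prod_congr rfl (g := fun _ => X) (fun x hx => by
      rw [(hfibκ x (hO x hx)).resolve_right (hno x hx), C_0, sub_zero]), Finset.prod_const,
      hOcard, hD, pow_succ, mul_dvd_mul_iff_left (pow_ne_zero _ X_ne_zero), X_dvd_iff] at h1
    exact hcκ (by simpa using h1)
  obtain ⟨x₀, hx₀O, hx₀t⟩ := hex
  have hx₀ := hO x₀ hx₀O
  have hnear : ∀ a : B, a ≠ x₀ → aeval a f = y → a ∈ Q := fun a ha hay =>
    (hφ a).mp ((hfibκ a hay).resolve_right fun h1 => ha (huniq a x₀ hay hx₀ h1 hx₀t))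
  refine ⟨x₀, ?_, fun a a' ha ha' hax hax' => ?_⟩
  · rw [Function.iterate_succ_apply]
    rw [hx₀, hyb]
  rw [hx₀] at hax hax'
  have hlev : ∀ a : B, aeval a f = y → (fun z : B => aeval z f)^[m + 1] a = b := fun a hay => by
    rw [Function.iterate_succ_apply]
    rw [hay, hyb]
  obtain ⟨τ, hτ, hτa⟩ := hsh.exists_inertia_smul_eq (G := G) hf hfd hφ hQ0 hg huQ hpQ hpv hb hfix
    (hnear a ha hax) (hlev a hax) (hnear a' ha' hax') (hlev a' hax')
  refine ⟨τ, ?_, hτa⟩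
  -- `τ` fixes `y` because `a` and `τ • a` both lie over it, and it preserves residues; so `τ • x₀`
  -- is again the fibre point reducing to `t`.
  refine huniq _ _ ?_ hx₀ ?_ hx₀t
  · rw [aeval_smul, hx₀, ← hax, ← aeval_smul, hτa, hax', hax]
  · rw [← hx₀t, ← sub_eq_zero, ← map_sub, hφ]
    exact hτ x₀

end Conditions

end

/-! ### From the local conditions to the full group -/

section

open scoped Pointwise
open Polynomial

/-- No fibre exceeds the degree, and level `k + 1` has exactly degree times as many points as level
`k`; so every fibre is full. -/
theorem card_fiber_eq {B : Type*} [CommRing B] [IsDomain B] {f : ℤ[X]} (hf : f.Monic)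
    (hd : f.natDegree ≠ 0) {k : ℕ} {b : ℤ} {O O' : Finset B} (hO : O.card = f.natDegree ^ k)
    (hO' : O'.card = f.natDegree ^ (k + 1))
    (hmem : ∀ x, x ∈ O ↔ (fun z : B => aeval z f)^[k] x = b)
    (hmem' : ∀ x, x ∈ O' ↔ (fun z : B => aeval z f)^[k + 1] x = b) {z : B} (hz : z ∈ O) :
    ∃ S : Finset B, S.card = f.natDegree ∧ ∀ x, x ∈ S ↔ aeval x f = z := by
  classical
  have hne : ∀ y : B, f.map (algebraMap ℤ B) - C y ≠ 0 := fun y => by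
    refine ((hf.map _).sub_of_left ?_).ne_zero
    refine degree_C_le.trans_lt ?_
    rw [hf.degree_map, ← natDegree_pos_iff_degree_pos]
    omega
  have hle : ∀ y ∈ O, (O'.filter fun x => aeval x f = y).card ≤ f.natDegree := fun y _ => by
    have h1 : O'.filter (fun x => aeval x f = y) ⊆ (f.map (algebraMap ℤ B) - C y).roots.toFinset := by
      intro x hx
      rw [Multiset.mem_toFinset, mem_roots (hne y), IsRoot, eval_sub, eval_map_algebraMap,
        (Finset.mem_filter.mp hx).2, eval_C, sub_self]
    refine (Finset.card_le_card h1).trans ((Multiset.toFinset_card_le _).trans ?_)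
    refine (card_roots' _).trans ?_
    rw [natDegree_sub_C, hf.natDegree_map]
  have hsum : O'.card = ∑ y ∈ O, (O'.filter fun x => aeval x f = y).card :=
    Finset.card_eq_sum_card_fiberwise fun x hx => (hmem _).mpr ((hmem' x).mp hx)
  refine ⟨O'.filter fun x => aeval x f = z, ?_, fun x => ?_⟩
  · by_contra hlt
    have h2 : ∑ y ∈ O, (O'.filter fun x => aeval x f = y).card < ∑ y ∈ O, f.natDegree :=
      Finset.sum_lt_sum hle ⟨z, hz, lt_of_le_of_ne (hle z hz) hlt⟩
    rw [← hsum, hO', Finset.sum_const, hO, smul_eq_mul, pow_succ] at h2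
    exact lt_irrefl _ h2
  · rw [Finset.mem_filter, hmem', Function.iterate_succ_apply, and_iff_right_iff_imp]
    rintro rfl
    exact (hmem _).mp hz

/-- Finitely many local conditions force the Galois action on the backward orbits of the critical
points to be the full product of iterated wreath products. -/
theorem nonempty_mulEquiv_of_local_conditions {B G : Type*} [CommRing B] [IsDedekindDomain B]
    [Group G] [Finite G] [MulSemiringAction G B] {f : ℤ[X]} {d n : ℕ} (hd : 2 ≤ d)
    (hf : f.Monic) (hfd : f.natDegree = d) {ι : Type*} [Fintype ι] {b : ι → ℤ}
    (hbinj : Function.Injective fun i => (b i : B))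
    (hder : derivative f = C (d : ℤ) * ∏ i, (X - C (b i)))
    (hspl : ∀ k ≤ n, ∀ j, ∃ s : Multiset B,
      (f.comp^[k] X - C (b j)).map (algebraMap ℤ B) = (s.map fun a => X - C a).prod)
    (hfaith : ∀ σ : G, (∀ x ∈ backwardLevel (fun z : B => aeval z f) (fun i => (b i : B)) n,
      σ • x = x) → σ = 1)
    (hE : ∃ p, HasInertiaPrime G B p ∧ ∀ j, EisensteinPrime f 1 d (b j) p)
    (hC : 3 ≤ d → ∀ j, ∃ (p : ℕ) (c : ℤ), HasInertiaPrime G B p ∧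
      EisensteinPrime f (X - C c) (d - 1) (b j) p)
    (hT : ∀ m < n, ∀ j, ∃ p, HasInertiaPrime G B p ∧ TranspositionPrime f b d m j p) :
    Nonempty (G ≃* (ι → iteratedSymWreath d n)) := by
  classical
  subst hfd
  have hfd0 : f.natDegree ≠ 0 := by omega
  have : NeZero f.natDegree := ⟨hfd0⟩
  obtain ⟨p₀, hp₀, hE⟩ := hE
  have hF : ∀ (σ : G) (x : B), σ • aeval x f = aeval (σ • x) f := fun σ x => (aeval_smul f σ x).symm
  have hb : ∀ (σ : G) (j : ι), σ • (b j : B) = b j := fun σ j =>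
    map_intCast (MulSemiringAction.toRingHom G B σ) (b j)
  have hlev : ∀ k ≤ n, ∀ j, (∃ O : Finset B, O.card = f.natDegree ^ k ∧
      ∀ x, x ∈ O ↔ (fun z : B => aeval z f)^[k] x = b j) ∧
      (∀ x x' : B, (fun z : B => aeval z f)^[k] x = b j →
        (fun z : B => aeval z f)^[k] x' = b j → ∃ σ : G, σ • x = x') := fun k hk j => by
    obtain ⟨s, hs⟩ := hspl k hk j
    exact (hE j).card_and_transitive hf hp₀ hs
  have hfib : ∀ k < n, ∀ j, ∀ z : B, (fun z : B => aeval z f)^[k] z = b j →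
      ∃ S : Finset B, S.card = f.natDegree ∧ ∀ x, x ∈ S ↔ aeval x f = z := fun k hk j z hz => by
    obtain ⟨O, hO, hmem⟩ := (hlev k hk.le j).1
    obtain ⟨O', hO', hmem'⟩ := (hlev (k + 1) hk j).1
    exact card_fiber_eq hf hfd0 hO hO' hmem hmem' ((hmem z).mpr hz)
  refine nonempty_mulEquiv_iteratedSymWreath (F := fun z : B => aeval z f)
    (b := fun i => (b i : B)) hF hb hbinj ?_ ?_ hfaith
  · rintro k hk z ⟨j, hz⟩
    obtain ⟨S, hS, hmem⟩ := hfib k hk j z hz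
    have e : {x // aeval x f = z} ≃ S := Equiv.subtypeEquivRight fun x => (hmem x).symm
    exact ⟨by rw [Nat.card_congr e]; simpa using hS, Finite.of_equiv _ e.symm⟩
  · rintro k hk x ⟨j, hx⟩ x' - hxx'
    obtain ⟨p, hp, hTp⟩ := hT k hk j
    obtain ⟨s, hs⟩ := hspl (k + 1) hk j
    obtain ⟨σ, x₁, x₂, hx₁, hne, hx₁₂, hswap⟩ := hTp.exists_actsAsSwap hf hfd0 hder hp hs
    have hstab : ∃ x₀ : B, (fun z : B => aeval z f)^[k + 1] x₀ = b j ∧ ∀ a a' : B, a ≠ x₀ →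
        a' ≠ x₀ → aeval a f = aeval x₀ f → aeval a' f = aeval x₀ f →
          ∃ τ : G, τ • x₀ = x₀ ∧ τ • a = a' := by
      -- For `d = 2` a point has a single sibling and the identity suffices. The second kind of
      -- prime is needed only for `d ≥ 3`.
      rcases hd.eq_or_lt with h2 | h3
      · refine ⟨x₁, hx₁, fun a a' ha ha' hax hax' => ⟨1, one_smul _ _, ?_⟩⟩
        rw [one_smul]
        by_contra haa'
        obtain ⟨S, hS, hmem⟩ := hfib k hk j (aeval x₁ f) (by
          rw [← hx₁, Function.iterate_succ_apply])
        have h3 : ({x₁, a, a'} : Finset B) ⊆ S := by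
          intro y hy
          rw [hmem]
          simp only [Finset.mem_insert, Finset.mem_singleton] at hy
          rcases hy with rfl | rfl | rfl
          exacts [rfl, hax, hax']
        have h4 := Finset.card_le_card h3
        rw [Finset.card_eq_three.mpr ⟨x₁, a, a', ha.symm, ha'.symm, haa', rfl⟩, hS, ← h2] at h4
        omega
      · obtain ⟨q, c, hq, hCq⟩ := hC h3 j
        obtain ⟨s, hs⟩ := hspl k hk.le j
        refine hCq.exists_stabilizer_transitive (by omega) hf hq hs fun z hz => ?_
        obtain ⟨S, hS, hmem⟩ := hfib k hk j z hz
        exact ⟨S, hS, fun x hx => (hmem x).mp hx⟩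
    obtain ⟨x₀, hx₀, hstab⟩ := hstab
    exact exists_actsAsSwap (F := fun z : B => aeval z f)
      (S := {x | (fun z : B => aeval z f)^[k + 1] x = b j}) hF
      (fun σ z hz => smul_mem_backwardLevel hF hb σ hz)
      (fun x hx x' hx' => (hlev (k + 1) hk j).2 x x' hx hx') hx₁ hne hx₁₂ hswap hx₀ hstab hx hxx'

end

/-! ### The splitting field of the composite and its ring of integers -/

section

open scoped Pointwise NumberField
open Polynomial

/-- Any maximal ideal over `p` serves, with `e` the order of its inertia group. -/
theorem hasInertiaPrime_of_not_dvd_discr {K L : Type*} [Field K] [Field L] [NumberField K]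
    [NumberField L] [Algebra K L] [IsGalois K L] {p : ℕ} (hp : p.Prime)
    (hpK : ¬ (p : ℤ) ∣ NumberField.discr K) : HasInertiaPrime Gal(L/K) (𝓞 L) p := by
  have hpZ : Prime (p : ℤ) := Nat.prime_iff_prime_int.mp hp
  have hmax : (Ideal.span {(p : ℤ)}).IsMaximal :=
    PrincipalIdealRing.isMaximal_of_irreducible hpZ.irreducible
  obtain ⟨Q, hQ, hover⟩ := Ideal.exists_maximal_ideal_liesOver_of_isIntegral (S := 𝓞 L)
    (Ideal.span {(p : ℤ)})
  have hpQ : (p : 𝓞 L) ∈ Q := by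
    have := (Ideal.liesOver_span_iff (Ideal.IsPrime.ne_top inferInstance) hpZ).mp hover
    simpa using this
  have hQ0 : Q ≠ ⊥ := by
    rintro rfl
    exact hp.ne_zero (by simpa using hpQ)
  exact ⟨Q, _, hQ, hQ0, hpQ, fun x hx hxQ => mem_pow_card_inertia_of_fixed (K := K) Q hQ0 x hx hxQ,
    natCast_notMem_pow_card_inertia_succ Q hp hpK hpQ⟩

theorem exists_multiset_of_splits {L : Type*} [Field L] [NumberField L] {P : ℤ[X]} (hP : P.Monic)
    (h : (P.map (algebraMap ℤ L)).Splits) : ∃ s : Multiset (𝓞 L),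
      P.map (algebraMap ℤ (𝓞 L)) = (s.map fun a => X - C a).prod := by
  have h1 := h.eq_prod_roots_of_monic (hP.map _)
  have hint : ∀ x ∈ (P.map (algebraMap ℤ L)).roots, ∃ y : 𝓞 L, algebraMap (𝓞 L) L y = x := by
    intro x hx
    have hx' : IsIntegral ℤ x := ⟨P, hP, by
      rw [mem_roots (hP.map _).ne_zero, IsRoot, eval_map] at hx
      exact hx⟩
    exact ⟨⟨x, hx'⟩, rfl⟩
  choose g hg using hint
  refine ⟨(P.map (algebraMap ℤ L)).roots.attach.map fun x => g x.1 x.2, ?_⟩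
  apply map_injective (algebraMap (𝓞 L) L) NumberField.RingOfIntegers.coe_injective
  rw [Polynomial.map_map]
  have h2 : (algebraMap (𝓞 L) L).comp (algebraMap ℤ (𝓞 L)) = algebraMap ℤ L := RingHom.ext_int _ _
  rw [h2]
  conv_lhs => rw [h1]
  rw [Polynomial.map_multiset_prod, Multiset.map_map, Multiset.map_map]
  conv_lhs => rw [← Multiset.attach_map_val (P.map (algebraMap ℤ L)).roots, Multiset.map_map]
  congr 1
  refine Multiset.map_congr rfl fun x _ => ?_
  simp [hg]

theorem map_iterate_comp {R S : Type*} [CommRing R] [CommRing S] (φ : R →+* S) (f : R[X]) (k : ℕ) :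
    (f.comp^[k] X).map φ = (f.map φ).comp^[k] X := by
  induction k with
  | zero => simp
  | succ k ih => rw [Function.iterate_succ_apply', Polynomial.map_comp, ih,
      Function.iterate_succ_apply']

theorem iterate_comp_add {R : Type*} [CommRing R] (f : R[X]) (k m : ℕ) :
    f.comp^[k + m] X = (f.comp^[k] X).comp (f.comp^[m] X) := by
  induction k with
  | zero => simp
  | succ k ih =>
    rw [Nat.add_right_comm, Function.iterate_succ_apply', ih, Function.iterate_succ_apply',
      comp_assoc]

theorem exists_ringOfIntegers_iterate_eq {L : Type*} [Field L] [NumberField L] {f : ℤ[X]} {n : ℕ}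
    {b : ℤ} {x : L} (hint : IsIntegral ℤ x) (hx : aeval x (f.comp^[n] X - C b) = 0) :
    ∃ y : 𝓞 L, algebraMap (𝓞 L) L y = x ∧ (fun z : 𝓞 L => aeval z f)^[n] y = b := by
  obtain ⟨y, hyx⟩ : ∃ y : 𝓞 L, algebraMap (𝓞 L) L y = x := ⟨⟨x, hint⟩, rfl⟩
  refine ⟨y, hyx, ?_⟩
  apply NumberField.RingOfIntegers.coe_injective
  rw [map_ringHom_iterate_aeval, hyx, iterate_aeval]
  rw [map_sub, aeval_C, sub_eq_zero] at hx
  exact hx.trans (by simp)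

theorem nonempty_gal_mulEquiv (K : Type*) [Field K] [NumberField K] {f : ℤ[X]} {d n : ℕ}
    (hd : 2 ≤ d) (hf : f.Monic) (hfd : f.natDegree = d) {ι : Type*} [Fintype ι] {b : ι → ℤ}
    (hbinj : Function.Injective b)
    (hder : derivative f = C (d : ℤ) * ∏ i, (X - C (b i)))
    (hE : ∃ p : ℕ, p.Prime ∧ ¬ (p : ℤ) ∣ NumberField.discr K ∧ ∀ j, EisensteinPrime f 1 d (b j) p)
    (hC : 3 ≤ d → ∀ j, ∃ (p : ℕ) (c : ℤ), ¬ (p : ℤ) ∣ NumberField.discr K ∧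
      EisensteinPrime f (X - C c) (d - 1) (b j) p)
    (hT : ∀ m < n, ∀ j, ∃ p : ℕ, ¬ (p : ℤ) ∣ NumberField.discr K ∧
      TranspositionPrime f b d m j p) :
    Nonempty (((derivative (f.map (algebraMap ℤ K))).comp
      (polyIterate (f.map (algebraMap ℤ K)) n)).Gal ≃* (ι → iteratedSymWreath d n)) := by
  have hfd0 : f.natDegree ≠ 0 := by omega
  set fK := f.map (algebraMap ℤ K) with hfK
  set P := (derivative fK).comp (polyIterate fK n) with hP
  let L := P.SplittingField
  have : NumberField L := NumberField.of_module_finite K L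
  have : Normal K L := Normal.of_isSplittingField P
  have : IsGalois K L := { }
  have hdK : (d : K) ≠ 0 := by exact_mod_cast (by omega : d ≠ 0)
  have hderK : derivative fK = C (d : K) * ∏ i, (X - C (b i : K)) := by
    rw [hfK, derivative_map, hder]
    simp [Polynomial.map_prod]
  have hderne : derivative fK ≠ 0 := by
    rw [hderK]
    refine mul_ne_zero (by simpa using hdK) (Finset.prod_ne_zero_iff.mpr fun i _ => X_sub_C_ne_zero _)
  have hiter : ∀ k, (fK.comp^[k] X).natDegree = f.natDegree ^ k := fun k => by
    rw [natDegree_iterate_comp, natDegree_X, mul_one, hfK, hf.natDegree_map]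
  have hcompne : ∀ k, (derivative fK).comp (fK.comp^[k] X) ≠ 0 := fun k => by
    intro h0
    rcases comp_eq_zero_iff.mp h0 with h1 | ⟨-, h1⟩
    · exact hderne h1
    · have h2 := congrArg natDegree h1
      rw [natDegree_C, hiter] at h2
      exact pow_ne_zero k hfd0 h2
  have hfac : ∀ k j, (f.comp^[k] X - C (b j)).map (algebraMap ℤ K) ∣
      (derivative fK).comp (fK.comp^[k] X) := fun k j => by
    rw [hderK, mul_comp, prod_comp]
    refine Dvd.dvd.mul_left ?_ _
    refine dvd_trans (dvd_of_eq ?_) (Finset.dvd_prod_of_mem _ (Finset.mem_univ j))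
    rw [Polynomial.map_sub, map_iterate_comp, map_C, sub_comp, X_comp, C_comp]
    simp [hfK]
  -- All levels below `n` lie in `L` too: the polynomial is `(f' ∘ f^k) ∘ f^m` with `n = k + m`, and
  -- splitting a composite splits its outer factor.
  have hsplits : ∀ k ≤ n, ∀ j, ((f.comp^[k] X - C (b j)).map (algebraMap ℤ L)).Splits := by
    intro k hk j
    obtain ⟨m, rfl⟩ := Nat.exists_eq_add_of_le hk
    have hPeq : P = ((derivative fK).comp (fK.comp^[k] X)).comp (fK.comp^[m] X) := by
      rw [hP, comp_assoc, ← iterate_comp_add]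
      rfl
    have h1 : (((derivative fK).comp (fK.comp^[k] X)).map (algebraMap K L)).Splits := by
      -- The splitting field depends on the polynomial, so the factorization is substituted into a
      -- general `R` rather than rewritten in place.
      have h0 : ∀ R : K[X], R = ((derivative fK).comp (fK.comp^[k] X)).comp (fK.comp^[m] X) →
          (((derivative fK).comp (fK.comp^[k] X)).map (algebraMap K R.SplittingField)).Splits := by
        rintro _ rfl
        exact Gal.splits_in_splittingField_of_comp _ _ (by rw [hiter]; exact pow_ne_zero m hfd0)
      exact h0 P hPeq
    have h2 := h1.of_dvd ((Polynomial.map_ne_zero_iff (algebraMap K L).injective).mpr (hcompne k))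
      (Polynomial.map_dvd (algebraMap K L) (hfac k j))
    rw [Polynomial.map_map] at h2
    have h3 : (algebraMap K L).comp (algebraMap ℤ K) = algebraMap ℤ L := RingHom.ext_int _ _
    rwa [h3] at h2
  have key : Nonempty (Gal(L/K) ≃* (ι → iteratedSymWreath d n)) := by
    refine nonempty_mulEquiv_of_local_conditions (B := 𝓞 L) hd hf hfd ?_ hder
      (fun k hk j => exists_multiset_of_splits (monic_iterate_comp_sub_C hf hfd0 k (b j))
        (hsplits k hk j)) ?_ ?_ ?_ ?_
    · intro i j h
      exact hbinj (by simpa using h)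
    · intro σ hσ
      refine Gal.ext (p := P) (σ := σ) (τ := 1) fun x hx => ?_
      have hx0 : aeval x ((derivative fK).comp (fK.comp^[n] X)) = 0 := (mem_rootSet.mp hx).2
      have hxK : aeval x (fK.comp^[n] X) = aeval x (f.comp^[n] X) := by
        rw [hfK, ← map_iterate_comp, aeval_map_algebraMap]
      rw [aeval_comp, hderK, map_mul, map_prod, mul_eq_zero] at hx0
      change _ ∨ ∏ i, aeval (aeval x (fK.comp^[n] X)) (X - C (b i : K)) = 0 at hx0
      obtain ⟨j, hj⟩ : ∃ j, aeval x (f.comp^[n] X - C (b j)) = 0 := by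
        rcases hx0 with hx0 | hx0
        · rw [aeval_C] at hx0
          exact absurd ((map_eq_zero _).mp hx0) hdK
        · obtain ⟨j, -, hj⟩ := Finset.prod_eq_zero_iff.mp hx0
          refine ⟨j, ?_⟩
          rw [hxK] at hj
          simpa using hj
      have hint : IsIntegral ℤ x := ⟨_, monic_iterate_comp_sub_C hf hfd0 n (b j), hj⟩
      obtain ⟨y, hy, hyj⟩ := exists_ringOfIntegers_iterate_eq (L := L) hint hj
      have h1 := congrArg (algebraMap (𝓞 L) L) (hσ y ⟨j, hyj⟩)
      rw [← hy]
      exact h1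
    · obtain ⟨p, hpp, hp, h⟩ := hE
      exact ⟨p, hasInertiaPrime_of_not_dvd_discr hpp hp, h⟩
    · intro h3 j
      obtain ⟨p, c, hp, h⟩ := hC h3 j
      exact ⟨p, c, hasInertiaPrime_of_not_dvd_discr h.prime hp, h⟩
    · intro m hm j
      obtain ⟨p, hp, h⟩ := hT m hm j
      exact ⟨p, hasInertiaPrime_of_not_dvd_discr h.prime hp, h⟩
  exact key

end

/-! ### Periodic parameters of a bicritical family and their reductions -/

section

open Polynomial

/-- The map `y ↦ y ^ d - d B y ^ (d - 1) + c`, whose critical points are `(d - 1) B` and `0`. -/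
def bicritical {R : Type*} [CommRing R] (d B : ℕ) (c y : R) : R :=
  y ^ d - (d * B : ℕ) * y ^ (d - 1) + c

theorem map_bicritical_iterate {R S : Type*} [CommRing R] [CommRing S] (φ : R →+* S) (d B : ℕ)
    (c y : R) (k : ℕ) :
    φ ((bicritical d B c)^[k] y) = (bicritical d B (φ c))^[k] (φ y) := by
  induction k generalizing y with
  | zero => rfl
  | succ k ih =>
    rw [Function.iterate_succ_apply, Function.iterate_succ_apply, ih]
    simp [bicritical]

theorem eval_bicritical_iterate {R : Type*} [CommRing R] (d B a : ℕ) (c : R) (k : ℕ) :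
    aeval c ((bicritical d B (X : ℤ[X]))^[k] (a : ℤ[X])) = (bicritical d B c)^[k] (a : R) := by
  have := map_bicritical_iterate (aeval (R := ℤ) c).toRingHom d B (X : ℤ[X]) (a : ℤ[X]) k
  simpa using this

theorem monic_bicritical {d B : ℕ} (hd : 2 ≤ d) {q : ℤ[X]} (hq : q.Monic)
    (hq0 : 1 ≤ q.natDegree) :
    (bicritical d B X q).Monic ∧ (bicritical d B X q).natDegree = d * q.natDegree := by
  have hqd : (q ^ d).natDegree = d * q.natDegree := hq.natDegree_pow d
  have h1 : (q ^ d).Monic := hq.pow d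
  have hlt : (-(((d * B : ℕ) : ℤ[X]) * q ^ (d - 1)) + X).natDegree < (q ^ d).natDegree := by
    rw [hqd]
    refine lt_of_le_of_lt (natDegree_add_le _ _) (max_lt ?_ ?_)
    · rw [natDegree_neg]
      refine lt_of_le_of_lt natDegree_mul_le ?_
      rw [natDegree_natCast, zero_add, hq.natDegree_pow]
      exact Nat.mul_lt_mul_of_pos_right (by omega) hq0
    · rw [natDegree_X]
      nlinarith
  have heq : bicritical d B X q = q ^ d + (-(((d * B : ℕ) : ℤ[X]) * q ^ (d - 1)) + X) := by
    rw [bicritical]; ring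
  rw [heq]
  have hdeg := degree_lt_degree hlt
  exact ⟨h1.add_of_left hdeg, by rw [natDegree_add_eq_left_of_natDegree_lt hlt, hqd]⟩

/-- The variable of `ℤ[X]` is the parameter `c`. The first iterate of a constant is linear in `c`,
and each further step multiplies the degree by `d`. -/
theorem monic_bicritical_iterate {d B : ℕ} (hd : 2 ≤ d) (a k : ℕ) :
    ((bicritical d B (X : ℤ[X]))^[k + 1] (a : ℤ[X])).Monic ∧
      ((bicritical d B (X : ℤ[X]))^[k + 1] (a : ℤ[X])).natDegree = d ^ k := by
  induction k with
  | zero =>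
    have : (bicritical d B (X : ℤ[X]))^[0 + 1] (a : ℤ[X]) =
        X + C ((a : ℤ) ^ d - (d * B : ℕ) * (a : ℤ) ^ (d - 1)) := by
      simp [bicritical]; ring
    rw [this]
    exact ⟨monic_X_add_C _, by rw [natDegree_X_add_C, pow_zero]⟩
  | succ k ih =>
    rw [Function.iterate_succ_apply']
    have h := monic_bicritical (B := B) hd ih.1 (by rw [ih.2]; exact Nat.one_le_pow _ _ (by omega))
    exact ⟨h.1, by rw [h.2, ih.2, pow_succ']⟩

theorem monic_bicritical_iterate_sub {d B : ℕ} (hd : 2 ≤ d) (a k : ℕ) :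
    ((bicritical d B (X : ℤ[X]))^[k + 1] (a : ℤ[X]) - (a : ℤ[X])).Monic ∧
      ((bicritical d B (X : ℤ[X]))^[k + 1] (a : ℤ[X]) - (a : ℤ[X])).natDegree = d ^ k := by
  obtain ⟨h1, h2⟩ := monic_bicritical_iterate (B := B) hd a k
  have hpos : 0 < d ^ k := Nat.pow_pos (by omega)
  have hlt : ((a : ℤ[X])).natDegree < ((bicritical d B (X : ℤ[X]))^[k + 1] (a : ℤ[X])).natDegree := by
    rw [natDegree_natCast, h2]; exact hpos
  exact ⟨h1.sub_of_left (degree_lt_degree hlt), by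
    rw [natDegree_sub_eq_left_of_natDegree_lt hlt, h2]⟩

/-- Differentiating in the parameter, the previous iterate contributes only multiples of `d`; the
added constant `c` contributes the `1`. Hence periodic parameters, being algebraic integers, are
simple roots: `-1/d` is not integral. -/
theorem derivative_bicritical_iterate (d B a k : ℕ) :
    ∃ S : ℤ[X], derivative ((bicritical d B (X : ℤ[X]))^[k + 1] (a : ℤ[X]) - (a : ℤ[X])) =
      1 + (d : ℤ[X]) * S := by
  rw [Function.iterate_succ_apply']
  set q := (bicritical d B (X : ℤ[X]))^[k] (a : ℤ[X])
  refine ⟨q ^ (d - 1) * derivative q - B * derivative (q ^ (d - 1)), ?_⟩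
  rw [bicritical]
  simp only [derivative_sub, derivative_add, derivative_natCast, derivative_X, derivative_mul,
    derivative_pow, map_natCast]
  push_cast
  ring

theorem natCast_mul_ne_neg_one_of_isIntegral {d : ℕ} (hd : 2 ≤ d) {s : ℂ} (hs : IsIntegral ℤ s) :
    1 + (d : ℂ) * s ≠ 0 := by
  intro h
  have hd0 : (d : ℂ) ≠ 0 := by exact_mod_cast (by omega : d ≠ 0)
  have hsq : s = algebraMap ℚ ℂ (-1 / d) := by
    rw [map_div₀]
    simp only [map_neg, map_one, map_natCast]
    field_simp
    linear_combination h
  rw [hsq, isIntegral_algebraMap_iff (algebraMap ℚ ℂ).injective,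
    IsIntegrallyClosed.isIntegral_iff] at hs
  obtain ⟨y, hy⟩ := hs
  have hdq : (d : ℚ) ≠ 0 := by exact_mod_cast (by omega : d ≠ 0)
  have h2 : (d : ℤ) * y = -1 := by
    have : (d : ℚ) * (algebraMap ℤ ℚ y) = -1 := by rw [hy]; field_simp
    simp only [algebraMap_int_eq, eq_intCast] at this
    exact_mod_cast this
  have h3 : (d : ℤ) ∣ 1 := ⟨-y, by linear_combination h2⟩
  have := Int.le_of_dvd one_pos h3
  omega

theorem isIntegral_aeval_int {R : Type*} [CommRing R] {x : R} (hx : IsIntegral ℤ x) (S : ℤ[X]) :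
    IsIntegral ℤ (aeval x S) := by
  induction S using Polynomial.induction_on' with
  | add p q hp hq => rw [map_add]; exact hp.add hq
  | monomial k a =>
    rw [aeval_monomial]
    exact isIntegral_algebraMap.mul (hx.pow k)

section Escape

variable {d B : ℕ} {c x : ℂ}

/-- Half of the leading term absorbs the middle one; the other half is at least `4‖x‖`, leaving
`3‖x‖` after removing `c`. -/
theorem norm_bicritical_ge (hd : 2 ≤ d) (hx1 : 2 * (d * B : ℕ) ≤ ‖x‖) (hx2 : 8 ≤ ‖x‖)
    (hc : ‖c‖ ≤ ‖x‖) : 2 * ‖x‖ ≤ ‖bicritical d B c x‖ := by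
  obtain ⟨e, rfl⟩ : ∃ e, d = e + 2 := ⟨d - 2, by omega⟩
  have he : e + 2 - 1 = e + 1 := rfl
  rw [bicritical, he]
  have h1 : ‖x‖ ^ (e + 2) - ((e + 2) * B : ℕ) * ‖x‖ ^ (e + 1) - ‖c‖ ≤
      ‖x ^ (e + 2) - (((e + 2) * B : ℕ) : ℂ) * x ^ (e + 1) + c‖ := by
    have t1 := norm_sub_norm_le (x ^ (e + 2)) ((((e + 2) * B : ℕ) : ℂ) * x ^ (e + 1))
    have t2 := norm_sub_le (x ^ (e + 2) - (((e + 2) * B : ℕ) : ℂ) * x ^ (e + 1) + c) c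
    rw [add_sub_cancel_right] at t2
    rw [norm_mul, norm_pow, norm_pow, Complex.norm_natCast] at t1
    linarith
  refine le_trans ?_ h1
  have hp : ‖x‖ ≤ ‖x‖ ^ (e + 1) := le_self_pow₀ (by linarith) (by omega)
  have hp0 : 0 ≤ ‖x‖ ^ (e + 1) := by positivity
  have h3 : 2 * (((e + 2) * B : ℕ) * ‖x‖ ^ (e + 1)) ≤ ‖x‖ ^ (e + 2) := by
    rw [pow_succ ‖x‖ (e + 1)]
    nlinarith
  have h4 : 8 * ‖x‖ ^ (e + 1) ≤ ‖x‖ ^ (e + 2) := by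
    rw [pow_succ ‖x‖ (e + 1)]
    nlinarith
  linarith

theorem norm_bicritical_iterate_ge (hd : 2 ≤ d) (hx1 : 2 * (d * B : ℕ) ≤ ‖x‖) (hx2 : 8 ≤ ‖x‖)
    (hc : ‖c‖ ≤ ‖x‖) (k : ℕ) : ‖x‖ ≤ ‖(bicritical d B c)^[k] x‖ := by
  induction k generalizing x with
  | zero => exact le_rfl
  | succ k ih =>
    have h := norm_bicritical_ge hd hx1 hx2 hc
    rw [Function.iterate_succ_apply]
    exact le_trans (by linarith) (ih (x := bicritical d B c x) (by linarith) (by linarith)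
      (by linarith))

theorem bicritical_critical (hd : 2 ≤ d) :
    bicritical d B c (((d - 1) * B : ℕ) : ℂ) = c - ((d - 1) ^ (d - 1) * B ^ d : ℕ) := by
  obtain ⟨e, rfl⟩ : ∃ e, d = e + 2 := ⟨d - 2, by omega⟩
  have he : e + 2 - 1 = e + 1 := rfl
  rw [bicritical, he]
  push_cast
  rw [mul_pow, mul_pow]
  ring

theorem eight_mul_le (hd : 2 ≤ d) (hB : 8 * d ≤ B) :
    8 * (d * B) ≤ (d - 1) ^ (d - 1) * B ^ d := by
  calc 8 * (d * B) = 8 * d * B := by ring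
    _ ≤ B * B := Nat.mul_le_mul_right _ hB
    _ = B ^ 2 := by ring
    _ ≤ B ^ d := Nat.pow_le_pow_right (by omega) hd
    _ ≤ _ := Nat.le_mul_of_pos_left _ (Nat.pow_pos (by omega))

/-- If the critical point `(d - 1) B` is periodic, then the critical point `0` escapes. -/
theorem bicritical_iterate_zero_of_periodic (hd : 2 ≤ d) (hB : 8 * d ≤ B) {m : ℕ}
    (hper : (bicritical d B c)^[m + 1] (((d - 1) * B : ℕ) : ℂ) = ((d - 1) * B : ℕ)) {k : ℕ}
    (hk : 1 ≤ k) :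
    (((d - 1) * B : ℕ) : ℝ) < ‖(bicritical d B c)^[k] 0‖ := by
  set V : ℕ := (d - 1) ^ (d - 1) * B ^ d with hV
  have hVle : (8 * (d * B : ℕ) : ℝ) ≤ V := by exact_mod_cast eight_mul_le hd hB
  have hdB : 16 ≤ d * B := by nlinarith
  have hdB' : (16 : ℝ) ≤ (d * B : ℕ) := by exact_mod_cast hdB
  have hlt : (((d - 1) * B : ℕ) : ℝ) < (d * B : ℕ) := by
    exact_mod_cast Nat.mul_lt_mul_of_pos_right (by omega : d - 1 < d) (by omega)
  -- The critical value is `c - V`. If `‖c‖ ≤ V / 2`, it would have norm at least `V / 2` and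
  -- escape, contradicting periodicity; `B ≥ 8 * d` makes `V` large enough. So `c`, the image of
  -- `0`, is itself in the escape region.
  have hcV : (V : ℝ) / 2 < ‖c‖ := by
    by_contra hcon
    push Not at hcon
    have h1 : (V : ℝ) / 2 ≤ ‖bicritical d B c (((d - 1) * B : ℕ) : ℂ)‖ := by
      rw [bicritical_critical hd, ← hV]
      have := norm_sub_norm_le (V : ℂ) c
      rw [Complex.norm_natCast, norm_sub_rev] at this
      linarith
    rw [Function.iterate_succ_apply] at hper
    have h2 := norm_bicritical_iterate_ge (c := c) (B := B) hd
      (x := bicritical d B c (((d - 1) * B : ℕ) : ℂ)) (by linarith) (by linarith) (by linarith) m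
    rw [hper, Complex.norm_natCast] at h2
    linarith
  obtain ⟨k, rfl⟩ : ∃ l, k = l + 1 := ⟨k - 1, by omega⟩
  rw [Function.iterate_succ_apply]
  have h0 : bicritical d B c 0 = c := by
    simp [bicritical, show d ≠ 0 by omega, show d - 1 ≠ 0 by omega]
  rw [h0]
  have h2 := norm_bicritical_iterate_ge (c := c) (B := B) hd (x := c) (by linarith) (by linarith)
    le_rfl k
  linarith

end Escape

/-- A parameter for which `(d - 1) B` is periodic of exact period `m + 1`. -/
theorem exists_bicritical_periodic {d B : ℕ} (hd : 2 ≤ d) (a m : ℕ) :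
    ∃ c : ℂ, IsIntegral ℤ c ∧ (bicritical d B c)^[m + 1] (a : ℂ) = a ∧
      (∀ k, 1 ≤ k → k ≤ m → (bicritical d B c)^[k] (a : ℂ) ≠ a) ∧
      aeval c (derivative ((bicritical d B (X : ℤ[X]))^[m + 1] (a : ℤ[X]) - (a : ℤ[X]))) ≠ 0 := by
  set R : ℕ → ℤ[X] := fun k => (bicritical d B (X : ℤ[X]))^[k + 1] (a : ℤ[X]) - (a : ℤ[X]) with hR
  have hmon : ∀ k, (R k).Monic := fun k => (monic_bicritical_iterate_sub hd a k).1
  have hdeg : ∀ k, (R k).natDegree = d ^ k := fun k => (monic_bicritical_iterate_sub hd a k).2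
  have hev : ∀ (c : ℂ) k, aeval c (R k) = (bicritical d B c)^[k + 1] (a : ℂ) - a := by
    intro c k
    simp only [hR, map_sub, eval_bicritical_iterate, map_natCast]
  have hint : ∀ c : ℂ, aeval c (R m) = 0 → IsIntegral ℤ c := fun c hc =>
    ⟨R m, hmon m, by rwa [aeval_def] at hc⟩
  have hsimple : ∀ c : ℂ, aeval c (R m) = 0 → aeval c (derivative (R m)) ≠ 0 := by
    intro c hc
    obtain ⟨S, hS⟩ := derivative_bicritical_iterate d B a m
    rw [hS]
    simpa using natCast_mul_ne_neg_one_of_isIntegral hd (isIntegral_aeval_int (hint c hc) S)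
  -- `R k` describes return after `k + 1` steps. Its `d ^ m` roots for `k = m` are distinct, and the
  -- lower `R k` have `1 + d + ⋯ + d ^ (m - 1) < d ^ m` roots in total, so some root has exact
  -- period `m + 1`.
  obtain ⟨c, hc, hck⟩ : ∃ c : ℂ, aeval c (R m) = 0 ∧ ∀ k < m, aeval c (R k) ≠ 0 := by
    by_contra hcon
    push Not at hcon
    set φ := algebraMap ℤ ℂ
    have hnd : ((R m).map φ).roots.Nodup := by
      rw [Multiset.nodup_iff_count_le_one]
      intro c
      by_contra hlt
      rw [count_roots, not_le, one_lt_rootMultiplicity_iff_isRoot ((hmon m).map φ).ne_zero,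
        IsRoot.def, IsRoot.def, derivative_map, eval_map_algebraMap, eval_map_algebraMap] at hlt
      exact hsimple c hlt.1 hlt.2
    have hcard : ((R m).map φ).roots.toFinset.card = d ^ m := by
      rw [Multiset.toFinset_card_of_nodup hnd, IsAlgClosed.card_roots_eq_natDegree,
        (hmon m).natDegree_map, hdeg]
    set Q : ℤ[X] := ∏ k ∈ Finset.range m, R k
    have hQ : Q.Monic := monic_prod_of_monic _ _ fun k _ => hmon k
    have hQd : Q.natDegree < d ^ m := by
      rw [natDegree_prod_of_monic _ _ fun k _ => hmon k]
      simp only [hdeg]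
      exact Nat.geomSum_lt hd (by simp)
    have hsub : ((R m).map φ).roots.toFinset ⊆ (Q.map φ).roots.toFinset := by
      intro c hc
      rw [Multiset.mem_toFinset, mem_roots ((hmon m).map φ).ne_zero, IsRoot.def,
        eval_map_algebraMap] at hc
      rw [Multiset.mem_toFinset, mem_roots (hQ.map φ).ne_zero, IsRoot.def, eval_map_algebraMap,
        map_prod]
      obtain ⟨k, hk, h0⟩ := hcon c hc
      exact Finset.prod_eq_zero (Finset.mem_range.mpr hk) h0
    have := Finset.card_le_card hsub
    rw [hcard] at this
    have h2 := (Multiset.toFinset_card_le (Q.map φ).roots).trans (card_roots' _)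
    rw [hQ.natDegree_map] at h2
    omega
  refine ⟨c, hint c hc, ?_, ?_, hsimple c hc⟩
  · rw [hev] at hc
    exact sub_eq_zero.mp hc
  · intro k hk1 hkm h
    obtain ⟨l, rfl⟩ : ∃ l, k = l + 1 := ⟨k - 1, by omega⟩
    exact hck l (by omega) (by rw [hev, h, sub_self])

/-- Euclid's argument: with `a = r(x₀) ≠ 0`, the value at `x₀ + a * N! * t` is `a` times a number
congruent to `1` modulo `N!`, and `t` is chosen so that this number is not a unit. -/
theorem exists_prime_dvd_eval {r : ℤ[X]} (hr : 0 < r.natDegree) (N : ℕ) :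
    ∃ (p : ℕ) (x : ℤ), p.Prime ∧ N < p ∧ (p : ℤ) ∣ r.eval x := by
  have hne : ∀ e : ℤ, r - C e ≠ 0 := by
    intro e h
    rw [sub_eq_zero] at h
    rw [h, natDegree_C] at hr
    exact lt_irrefl _ hr
  obtain ⟨x₀, hx₀⟩ : ∃ x₀ : ℤ, r.eval x₀ ≠ 0 := by
    by_contra hcon
    push Not at hcon
    exact hne 0 (by rw [C_0, sub_zero]; exact funext (by simpa using hcon))
  set a := r.eval x₀
  have hN : (N.factorial : ℤ) ≠ 0 := by exact_mod_cast N.factorial_ne_zero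
  obtain ⟨t, ht⟩ : ∃ t : ℤ, ((r - C a) * (r - C (-a))).eval (x₀ + a * N.factorial * t) ≠ 0 := by
    by_contra hcon
    push Not at hcon
    refine mul_ne_zero (hne a) (hne (-a)) (eq_zero_of_infinite_isRoot _ ?_)
    refine Set.Infinite.mono ?_ (Set.infinite_range_of_injective
      (f := fun t : ℤ => x₀ + a * N.factorial * t) ?_)
    · rintro _ ⟨t, rfl⟩
      exact hcon t
    · intro t t' h
      exact mul_left_cancel₀ (mul_ne_zero hx₀ hN) (add_left_cancel h)
  set x := x₀ + a * N.factorial * t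
  obtain ⟨s, hs⟩ : a * N.factorial * t ∣ r.eval x - a := by
    have := sub_dvd_eval_sub x x₀ r
    rwa [show x - x₀ = a * N.factorial * t by simp [x]] at this
  have hfac : r.eval x = a * (1 + N.factorial * (t * s)) := by linear_combination hs
  have hunit : (1 + N.factorial * (t * s) : ℤ).natAbs ≠ 1 := by
    intro h
    apply ht
    rw [eval_mul, eval_sub, eval_sub, eval_C, eval_C, hfac]
    rcases Int.natAbs_eq_iff.mp h with h | h <;> rw [h] <;> push_cast <;> ring
  obtain ⟨p, hp, hpd⟩ := Nat.exists_prime_and_dvd hunit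
  have hpd' : (p : ℤ) ∣ 1 + N.factorial * (t * s) := Int.natCast_dvd.mpr hpd
  refine ⟨p, x, hp, ?_, hfac ▸ hpd'.mul_left a⟩
  by_contra hle
  have h1 : (p : ℤ) ∣ N.factorial := by
    exact_mod_cast (Nat.Prime.dvd_factorial hp).mpr (not_lt.mp hle)
  have h2 : (p : ℤ) ∣ 1 := (Int.dvd_add_left (h1.mul_right _)).mp hpd'
  exact hp.one_lt.ne' (by exact_mod_cast Int.eq_one_of_dvd_one (by positivity) h2)

/-- Algebraic integers have reductions modulo infinitely many primes with residue field `𝔽_p`. -/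
theorem exists_prime_dvd_eval_not_dvd_eval {z : ℂ} (hz : IsIntegral ℤ z) {R S : ℤ[X]}
    (hR : aeval z R = 0) (hS : aeval z S ≠ 0) (N : ℕ) :
    ∃ (p : ℕ) (x : ℤ), p.Prime ∧ N < p ∧ (p : ℤ) ∣ R.eval x ∧ ¬ (p : ℤ) ∣ S.eval x := by
  have hw : IsIntegral ℤ (aeval z S) := isIntegral_aeval_int hz S
  -- The constant term of `q` is nonzero, and the minimal polynomial of `z` divides `q ∘ S`. At a
  -- root of it modulo `p`, vanishing of `S` would make `p` divide that constant term, impossible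
  -- for `p` large.
  set q := minpoly ℤ (aeval z S)
  have hq0 : q.coeff 0 ≠ 0 := by
    intro h
    refine hS ((minpoly.coeff_zero_eq_zero (A := ℚ) hw.tower_top).mp ?_)
    rw [minpoly.isIntegrallyClosed_eq_field_fractions' ℚ hw, coeff_map, h, map_zero]
  obtain ⟨p, x, hp, hN, hpx⟩ := exists_prime_dvd_eval (minpoly.natDegree_pos hz)
    (max N (q.coeff 0).natAbs)
  have hRd : minpoly ℤ z ∣ R := minpoly.isIntegrallyClosed_dvd hz hR
  have hqd : minpoly ℤ z ∣ q.comp S := minpoly.isIntegrallyClosed_dvd hz (by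
    rw [aeval_comp]; exact minpoly.aeval ℤ _)
  refine ⟨p, x, hp, (le_max_left _ _).trans_lt hN, hpx.trans (eval_dvd hRd), fun h => ?_⟩
  have h1 : (p : ℤ) ∣ q.eval (S.eval x) := by
    have := hpx.trans (eval_dvd (x := x) hqd)
    rwa [eval_comp] at this
  have h2 : (p : ℤ) ∣ q.eval (S.eval x) - q.eval 0 := by
    refine h.trans ?_
    simpa using sub_dvd_eval_sub (S.eval x) 0 q
  have h3 : (p : ℤ) ∣ q.coeff 0 := by
    rw [coeff_zero_eq_eval_zero]
    exact (Int.dvd_iff_dvd_of_dvd_sub h2).mp h1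
  have h4 := Nat.le_of_dvd (Int.natAbs_pos.mpr hq0) (Int.natCast_dvd.mp h3)
  exact absurd ((le_max_right _ _).trans_lt hN) (by omega)

/-- If `p ^ 2` divides `R(x)`, passing to `x + p` changes the value by `p * R'(x)` modulo `p ^ 2`,
which makes the divisibility exact. -/
theorem exists_not_dvd_eval_eq_mul {R S : ℤ[X]} {p : ℕ} {x : ℤ}
    (hR : (p : ℤ) ∣ R.eval x) (hR' : ¬ (p : ℤ) ∣ (derivative R).eval x)
    (hS : ¬ (p : ℤ) ∣ S.eval x) :
    ∃ y u : ℤ, ¬ (p : ℤ) ∣ u ∧ R.eval y = p * u ∧ ¬ (p : ℤ) ∣ S.eval y := by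
  obtain ⟨v, hv⟩ := hR
  by_cases h : (p : ℤ) ∣ v
  · obtain ⟨k, hk⟩ := R.binomExpansion x p
    refine ⟨x + p, v + (derivative R).eval x + k * p, ?_, by rw [hk, hv]; ring, ?_⟩
    · rw [add_assoc, Int.dvd_add_right h, Int.dvd_add_left (dvd_mul_left _ _)]
      exact hR'
    · intro h2
      apply hS
      have := sub_dvd_eval_sub (x + p) x S
      rw [add_sub_cancel_left] at this
      exact (Int.dvd_iff_dvd_of_dvd_sub this).mp h2
  · exact ⟨x, v, h, hv, hS⟩

/-- Primes modulo which the critical point `(d - 1) B` has exact period `m + 1`, to first order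
only, while the critical point `0` avoids the critical points. -/
theorem exists_prime_bicritical {d B : ℕ} (hd : 2 ≤ d) (hB : 8 * d ≤ B) (m N : ℕ) :
    ∃ (p : ℕ) (c : ℤ), p.Prime ∧ N < p ∧
      (∃ u : ℤ, ¬ (p : ℤ) ∣ u ∧
        (bicritical d B c)^[m + 1] (((d - 1) * B : ℕ) : ℤ) - ((d - 1) * B : ℕ) = p * u) ∧
      (∀ k, 1 ≤ k → k ≤ m →
        ¬ (p : ℤ) ∣ (bicritical d B c)^[k] (((d - 1) * B : ℕ) : ℤ) - ((d - 1) * B : ℕ)) ∧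
      ∀ k, 1 ≤ k → k ≤ m + 1 →
        ¬ (p : ℤ) ∣ (bicritical d B c)^[k] (((d - 1) * B : ℕ) : ℤ) ∧
        ¬ (p : ℤ) ∣ (bicritical d B c)^[k] 0 ∧
        ¬ (p : ℤ) ∣ (bicritical d B c)^[k] 0 - ((d - 1) * B : ℕ) := by
  set a : ℕ := (d - 1) * B with ha
  have ha0 : a ≠ 0 := Nat.mul_ne_zero (by omega) (by omega)
  obtain ⟨z, hz, hper, hmin, hder⟩ := exists_bicritical_periodic (B := B) hd a m
  have hesc : ∀ k, 1 ≤ k → (a : ℝ) < ‖(bicritical d B z)^[k] 0‖ := fun k hk =>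
    bicritical_iterate_zero_of_periodic hd hB hper hk
  set O : ℕ → ℕ → ℤ[X] := fun k b => (bicritical d B (X : ℤ[X]))^[k] (b : ℤ[X]) with hO
  have hOev : ∀ {R : Type} [CommRing R] (x : R) k b,
      aeval x (O k b) = (bicritical d B x)^[k] (b : R) := fun x k b =>
    eval_bicritical_iterate d B b x k
  set R : ℤ[X] := O (m + 1) a - (a : ℤ[X])
  -- The product of everything that must stay nonzero modulo `p`: the parameter derivative, the
  -- shorter periods, and the encounters of the two critical orbits with the critical points.
  set S : ℤ[X] := derivative R * ((∏ k ∈ Finset.Icc 1 m, (O k a - (a : ℤ[X]))) *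
    ∏ k ∈ Finset.Icc 1 (m + 1), (O k a * (O k 0 * (O k 0 - (a : ℤ[X]))))) with hSdef
  have hzero : ∀ k, 1 ≤ k → (bicritical d B z)^[k] 0 ≠ a := by
    intro k hk h
    have := hesc k hk
    rw [h, Complex.norm_natCast] at this
    exact lt_irrefl _ this
  have hRz : aeval z R = 0 := by
    simp only [R, map_sub, hOev, map_natCast, hper, sub_self]
  have hSz : aeval z S ≠ 0 := by
    rw [hSdef, map_mul, map_mul, map_prod, map_prod]
    refine mul_ne_zero hder (mul_ne_zero (Finset.prod_ne_zero_iff.mpr fun k hk => ?_)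
      (Finset.prod_ne_zero_iff.mpr fun k hk => ?_))
    · rw [Finset.mem_Icc] at hk
      rw [map_sub, hOev, map_natCast]
      exact sub_ne_zero.mpr (hmin k hk.1 hk.2)
    · rw [Finset.mem_Icc] at hk
      simp only [map_mul, map_sub, hOev, map_natCast, Nat.cast_zero]
      refine mul_ne_zero ?_ (mul_ne_zero ?_ (sub_ne_zero.mpr (hzero k hk.1)))
      -- If `a` reached `0` at a time `k ≤ m`, then `0` would reach `a` at time `m + 1 - k`, against
      -- its escape.
      · intro h0
        rcases Nat.lt_or_ge m k with hmk | hmk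
        · obtain rfl : k = m + 1 := by omega
          rw [hper] at h0
          exact ha0 (by exact_mod_cast h0)
        · refine hzero (m + 1 - k) (by omega) ?_
          rw [← h0, ← Function.iterate_add_apply, Nat.sub_add_cancel hk.2, hper]
      · intro h0
        have := hesc k hk.1
        rw [h0, norm_zero] at this
        exact absurd this (by simp)
  obtain ⟨p, x, hp, hN, hpR, hpS⟩ := exists_prime_dvd_eval_not_dvd_eval hz hRz hSz N
  obtain ⟨c, u, hu, hc, hcS⟩ := exists_not_dvd_eval_eq_mul hpR
    (fun h => hpS (by rw [hSdef, eval_mul]; exact h.mul_right _)) hpS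
  have hOc : ∀ k b, (O k b).eval c = (bicritical d B c)^[k] (b : ℤ) := by
    intro k b
    rw [← hOev, coe_aeval_eq_eval]
  have hS1 : ∀ k, 1 ≤ k → k ≤ m → (O k a - (a : ℤ[X])).eval c ∣ S.eval c := fun k h1 h2 =>
    eval_dvd (((Finset.dvd_prod_of_mem _ (Finset.mem_Icc.mpr ⟨h1, h2⟩)).mul_right _).mul_left _)
  have hS2 : ∀ k, 1 ≤ k → k ≤ m + 1 →
      (O k a * (O k 0 * (O k 0 - (a : ℤ[X])))).eval c ∣ S.eval c := fun k h1 h2 =>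
    eval_dvd (((Finset.dvd_prod_of_mem (fun k => O k a * (O k 0 * (O k 0 - (a : ℤ[X]))))
      (Finset.mem_Icc.mpr ⟨h1, h2⟩)).mul_left _).mul_left _)
  refine ⟨p, c, hp, hN, ⟨u, hu, ?_⟩, fun k h1 h2 h => ?_, fun k h1 h2 => ?_⟩
  · rw [← hc]
    simp only [R, eval_sub, hOc, eval_natCast]
  · refine hcS (dvd_trans ?_ (hS1 k h1 h2))
    simpa only [eval_sub, hOc, eval_natCast] using h
  · have h3 := hS2 k h1 h2
    simp only [eval_mul, eval_sub, hOc, eval_natCast, Nat.cast_zero] at h3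
    exact ⟨fun h => hcS ((h.mul_right _).trans h3),
      fun h => hcS (((h.mul_right _).mul_left _).trans h3),
      fun h => hcS (((h.mul_left _).mul_left _).trans h3)⟩

end

/-! ### Residue classes of critical points and constant terms -/

section

open Polynomial

theorem dvd_prod_sub_prod {R ι : Type*} [CommRing R] {r : R} {F G : ι → R} (s : Finset ι)
    (h : ∀ i ∈ s, r ∣ F i - G i) : r ∣ ∏ i ∈ s, F i - ∏ i ∈ s, G i := by
  classical
  induction s using Finset.induction_on with
  | empty => simp
  | insert a s ha ih =>
    rw [Finset.prod_insert ha, Finset.prod_insert ha]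
    have h1 := h a (Finset.mem_insert_self a s)
    have h2 := ih fun i hi => h i (Finset.mem_insert_of_mem hi)
    have : F a * ∏ i ∈ s, F i - G a * ∏ i ∈ s, G i =
        (F a - G a) * ∏ i ∈ s, F i + G a * (∏ i ∈ s, F i - ∏ i ∈ s, G i) := by ring
    rw [this]
    exact dvd_add (h1.mul_right _) (h2.mul_left _)

/-- If all roots of a monic polynomial are divisible by `d!`, then `d` times it has a monic
antiderivative with integer coefficients. -/
theorem exists_monic_derivative_eq {ι : Type*} [Fintype ι] {d : ℕ} (hd : 2 ≤ d)
    (hι : Fintype.card ι = d - 1) {b : ι → ℤ} (hb : ∀ i, (d.factorial : ℤ) ∣ b i) (c : ℤ) :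
    ∃ f : ℤ[X], f.Monic ∧ f.natDegree = d ∧ f.coeff 0 = c ∧
      derivative f = C (d : ℤ) * ∏ i, (X - C (b i)) := by
  obtain ⟨q, hq⟩ : C (d.factorial : ℤ) ∣ ∏ i, (X - C (b i)) - ∏ _i : ι, (X : ℤ[X]) := by
    refine dvd_prod_sub_prod _ fun i _ => ?_
    rw [sub_sub_cancel_left, dvd_neg]
    exact map_dvd C (hb i)
  rw [Finset.prod_const, Finset.card_univ, hι] at hq
  have hN : (d.factorial : ℤ) ≠ 0 := by exact_mod_cast d.factorial_ne_zero
  have hmon : (∏ i, (X - C (b i))).Monic := monic_prod_of_monic _ _ fun i _ => monic_X_sub_C _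
  have hdeg : (∏ i, (X - C (b i))).natDegree = d - 1 := by
    rw [natDegree_prod_of_monic _ _ fun i _ => monic_X_sub_C _]
    simp only [natDegree_X_sub_C, Finset.sum_const, Finset.card_univ, hι, smul_eq_mul, mul_one]
  have hqdeg : q.natDegree < d - 1 := by
    have h1 : (∏ i, (X - C (b i)) - X ^ (d - 1)).degree < (X ^ (d - 1) : ℤ[X]).degree := by
      have := degree_sub_lt_left (p := ∏ i, (X - C (b i))) (q := (X ^ (d - 1) : ℤ[X]))
        (by rw [degree_X_pow, degree_eq_natDegree hmon.ne_zero, hdeg]) hmon.ne_zero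
        (by rw [hmon.leadingCoeff, (monic_X_pow _).leadingCoeff])
      rwa [degree_X_pow, ← hdeg, ← degree_eq_natDegree hmon.ne_zero, hdeg]
    rw [hq, degree_C_mul hN, degree_X_pow] at h1
    by_cases h0 : q = 0
    · rw [h0, natDegree_zero]; omega
    · exact (natDegree_lt_iff_degree_lt h0).mpr h1
  -- The antiderivative of `d * d! * q` with constant term `c`; it is integral because `k + 1 ≤ d`
  -- divides `d!`.
  set w : ℤ[X] := ∑ k ∈ Finset.range (d - 1),
    C ((d : ℤ) * (d.factorial / (k + 1) : ℕ) * q.coeff k) * X ^ (k + 1) + C c with hw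
  have hwdeg : w.natDegree < d := by
    refine lt_of_le_of_lt (natDegree_add_le _ _) (max_lt ?_ (by rw [natDegree_C]; omega))
    refine lt_of_le_of_lt (natDegree_sum_le_of_forall_le (n := d - 1) _ _ fun k hk => ?_) (by omega)
    rw [Finset.mem_range] at hk
    exact (natDegree_C_mul_X_pow_le _ _).trans (by omega)
  have hwdeg' : w.natDegree < (X ^ d : ℤ[X]).natDegree := by rwa [natDegree_X_pow]
  refine ⟨X ^ d + w, (monic_X_pow d).add_of_left (degree_lt_degree hwdeg'), ?_, ?_, ?_⟩
  · rw [natDegree_add_eq_left_of_natDegree_lt hwdeg', natDegree_X_pow]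
  · rw [coeff_zero_eq_eval_zero, hw]
    simp [eval_finsetSum, show d ≠ 0 by omega]
  · rw [sub_eq_iff_eq_add] at hq
    rw [hq, as_sum_range' q (d - 1) hqdeg, derivative_add, hw, derivative_add, derivative_C,
      derivative_sum, derivative_X_pow, mul_add, Finset.mul_sum, Finset.mul_sum, add_zero, add_comm]
    congr 1
    refine Finset.sum_congr rfl fun k hk => ?_
    rw [Finset.mem_range] at hk
    rw [derivative_C_mul_X_pow, Nat.add_sub_cancel, ← C_mul_X_pow_eq_monomial, ← mul_assoc,
      ← mul_assoc, ← C_mul, ← C_mul]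
    congr 2
    have h1 : d.factorial / (k + 1) * (k + 1) = d.factorial :=
      Nat.div_mul_cancel (Nat.dvd_factorial (by omega) (by omega))
    have h2 : ((d.factorial / (k + 1) : ℕ) : ℤ) * ((k + 1 : ℕ) : ℤ) = d.factorial := by
      exact_mod_cast h1
    linear_combination (d : ℤ) * q.coeff k * h2

theorem C_dvd_of_C_dvd_derivative {f : ℤ[X]} {d : ℕ} {N : ℤ} (hfd : f.natDegree ≤ d)
    (hN : ∀ k : ℕ, 1 ≤ k → k ≤ d → IsCoprime N (k : ℤ)) (h : C N ∣ derivative f)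
    (h0 : N ∣ f.coeff 0) : C N ∣ f := by
  rw [C_dvd_iff_dvd_coeff] at h ⊢
  rintro (_ | k)
  · exact h0
  · by_cases hk : k + 1 ≤ d
    · have h1 := h k
      rw [coeff_derivative] at h1
      exact (hN (k + 1) (by omega) hk).dvd_of_dvd_mul_right (by exact_mod_cast h1)
    · rw [coeff_eq_zero_of_natDegree_lt (by omega)]
      exact dvd_zero _

/-- The polynomial with critical points `(d - 1) B` and `0`. -/
noncomputable def bicriticalPoly (d B : ℕ) (c : ℤ) : ℤ[X] :=
  X ^ d - C ((d * B : ℕ) : ℤ) * X ^ (d - 1) + C c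

theorem eval_bicriticalPoly (d B : ℕ) (c x : ℤ) :
    (bicriticalPoly d B c).eval x = bicritical d B c x := by
  simp [bicriticalPoly, bicritical]

theorem derivative_bicriticalPoly {ι : Type*} [Fintype ι] [DecidableEq ι] {d : ℕ} (hd : 2 ≤ d)
    (hι : Fintype.card ι = d - 1) (i₀ : ι) (B : ℕ) (c : ℤ) :
    derivative (bicriticalPoly d B c) =
      C (d : ℤ) * ∏ i, (X - C ((Pi.single i₀ (((d - 1) * B : ℕ) : ℤ) : ι → ℤ) i)) := by
  rw [← Finset.mul_prod_erase _ _ (Finset.mem_univ i₀), Pi.single_eq_same,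
    Finset.prod_congr rfl (g := fun _ => X) (fun i hi => by
      rw [Pi.single_eq_of_ne (Finset.ne_of_mem_erase hi), C_0, sub_zero]),
    Finset.prod_const, Finset.card_erase_of_mem (Finset.mem_univ _), Finset.card_univ, hι]
  obtain ⟨e, rfl⟩ : ∃ e, d = e + 2 := ⟨d - 2, by omega⟩
  rw [bicriticalPoly, show e + 2 - 1 = e + 1 from rfl, show e + 1 - 1 = e from rfl]
  simp only [derivative_add, derivative_sub, derivative_C, derivative_X_pow, derivative_C_mul,
    Nat.add_sub_cancel, show e + 2 - 1 = e + 1 from rfl]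
  simp only [map_natCast]
  push_cast
  ring

theorem natDegree_bicriticalPoly_le (d B : ℕ) (c : ℤ) : (bicriticalPoly d B c).natDegree ≤ d := by
  rw [bicriticalPoly]
  compute_degree

section Model

variable {ι : Type*} [Fintype ι] [DecidableEq ι] {d B p : ℕ} {c : ℤ} {i₀ : ι} {f : ℤ[X]} {b : ι → ℤ}

/-- For `p > d`, integration is possible modulo `p ^ 2` in degree `d`, so critical points and
constant term modulo `p ^ 2` determine `f` there. -/
theorem C_sq_dvd_sub_bicriticalPoly (hd : 2 ≤ d) (hι : Fintype.card ι = d - 1) (hp : p.Prime)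
    (hpd : d < p) (hfd : f.natDegree = d) (hder : derivative f = C (d : ℤ) * ∏ i, (X - C (b i)))
    (hb : ∀ i, (p : ℤ) ^ 2 ∣ b i - (Pi.single i₀ (((d - 1) * B : ℕ) : ℤ) : ι → ℤ) i)
    (hc : (p : ℤ) ^ 2 ∣ f.coeff 0 - c) :
    C ((p : ℤ) ^ 2) ∣ f - bicriticalPoly d B c := by
  refine C_dvd_of_C_dvd_derivative (d := d) ?_ ?_ ?_ ?_
  · exact (natDegree_sub_le _ _).trans (max_le hfd.le (natDegree_bicriticalPoly_le d B c))
  · intro k h1 h2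
    refine IsCoprime.pow_left (Nat.isCoprime_iff_coprime.mpr ?_)
    exact Nat.coprime_of_lt_prime (by omega) (by omega) hp
  · rw [derivative_sub, hder, derivative_bicriticalPoly hd hι i₀, ← mul_sub]
    refine (dvd_prod_sub_prod _ fun i _ => ?_).mul_left _
    rw [sub_sub_sub_cancel_left, ← C_sub, ← neg_sub, C_neg, dvd_neg]
    exact map_dvd C (hb i)
  · have : (bicriticalPoly d B c).coeff 0 = c := by
      rw [coeff_zero_eq_eval_zero, eval_bicriticalPoly, bicritical]
      simp [show d ≠ 0 by omega, show d - 1 ≠ 0 by omega]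
    rwa [coeff_sub, this]

theorem EisensteinPrime.of_C_sq_dvd {g : ℤ[X]} {D : ℕ} {b : ℤ} (hp : p.Prime) (hD : 2 ≤ D)
    (hf : C ((p : ℤ) ^ 2) ∣ f - (X ^ D * g + C (p : ℤ))) (hg : ¬ (p : ℤ) ∣ g.coeff 0)
    (hb : (p : ℤ) ^ 2 ∣ b) : EisensteinPrime f g D b p := by
  obtain ⟨w, hw⟩ := hf
  refine ⟨hp, ⟨C (p : ℤ) * w.divX, 1 + p * w.coeff 0, ?_, hD, ?_⟩, hg, hb⟩
  · rw [Int.dvd_add_left (dvd_mul_right _ _)]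
    intro h
    exact hp.one_lt.ne' (by exact_mod_cast Int.eq_one_of_dvd_one (by positivity) h)
  · have h1 := X_mul_divX_add w
    have h2 : (C ((p : ℤ) ^ 2) : ℤ[X]) = C (p : ℤ) * C (p : ℤ) := by rw [sq, C_mul]
    rw [sub_eq_iff_eq_add] at hw
    rw [hw, h2, C_mul, C_add, C_mul, C_1]
    linear_combination (-(C (p : ℤ) * C (p : ℤ))) * h1

theorem bicritical_iterate_modEq {N : ℤ} (hf : C N ∣ f - bicriticalPoly d B c) {x y : ℤ}
    (hxy : N ∣ x - y) (k : ℕ) : N ∣ (f.comp^[k] X).eval x - (bicritical d B c)^[k] y := by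
  rw [← coe_aeval_eq_eval, ← iterate_aeval]
  induction k with
  | zero => exact hxy
  | succ k ih =>
    rw [Function.iterate_succ_apply', Function.iterate_succ_apply']
    set x' := (fun z : ℤ => aeval z f)^[k] x
    set y' := (bicritical d B c)^[k] y
    have h1 := ih.trans (sub_dvd_eval_sub x' y' f)
    have h2 := eval_dvd (x := y') hf
    rw [eval_C, eval_sub, eval_bicriticalPoly] at h2
    have h3 := dvd_add h1 h2
    rwa [sub_add_sub_cancel] at h3

/-- Agreement modulo `p ^ 2`, not only modulo `p`, preserves the exactness of the relation at `b j`.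
Every other `b i` is congruent to `0`, so the orbit of `0` controls them all. -/
theorem TranspositionPrime.of_C_sq_dvd {ι : Type*} [DecidableEq ι] {b : ι → ℤ} {m : ℕ}
    {j : ι} (hd : 2 ≤ d) (hB : B ≠ 0) (hp : p.Prime)
    (hpd : d < p) (hpB : (d - 1) * B < p) (hf : C ((p : ℤ) ^ 2) ∣ f - bicriticalPoly d B c)
    (hb : ∀ i, (p : ℤ) ^ 2 ∣ b i - (Pi.single j (((d - 1) * B : ℕ) : ℤ) : ι → ℤ) i)
    (hval : ∃ u : ℤ, ¬ (p : ℤ) ∣ u ∧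
        (bicritical d B c)^[m + 1] (((d - 1) * B : ℕ) : ℤ) - ((d - 1) * B : ℕ) = p * u)
    (hmin : ∀ k, 1 ≤ k → k ≤ m →
        ¬ (p : ℤ) ∣ (bicritical d B c)^[k] (((d - 1) * B : ℕ) : ℤ) - ((d - 1) * B : ℕ))
    (havoid : ∀ k, 1 ≤ k → k ≤ m + 1 →
        ¬ (p : ℤ) ∣ (bicritical d B c)^[k] (((d - 1) * B : ℕ) : ℤ) ∧
        ¬ (p : ℤ) ∣ (bicritical d B c)^[k] 0 ∧
        ¬ (p : ℤ) ∣ (bicritical d B c)^[k] 0 - ((d - 1) * B : ℕ)) :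
    TranspositionPrime f b d m j p := by
  set a : ℕ := (d - 1) * B with ha
  have ha0 : 0 < a := Nat.mul_pos (by omega) (by omega)
  have hpa : ¬ (p : ℤ) ∣ a := fun h =>
    absurd (Nat.le_of_dvd ha0 (by exact_mod_cast h)) (by omega)
  have hbj : (p : ℤ) ^ 2 ∣ b j - a := by simpa using hb j
  have hbi : ∀ i, i ≠ j → (p : ℤ) ^ 2 ∣ b i - 0 := by
    intro i hi
    simpa [Pi.single_eq_of_ne hi] using hb i
  have hsq : (p : ℤ) ∣ (p : ℤ) ^ 2 := dvd_pow_self _ two_ne_zero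
  have key : ∀ {x y s t : ℤ} (k : ℕ), (p : ℤ) ^ 2 ∣ x - y → (p : ℤ) ^ 2 ∣ s - t →
      (p : ℤ) ^ 2 ∣ ((f.comp^[k] X).eval x - s) - ((bicritical d B c)^[k] y - t) := by
    intro x y s t k hxy hst
    have := dvd_sub (bicritical_iterate_modEq hf hxy k) hst
    rwa [sub_sub_sub_comm] at this
  refine ⟨hp, fun h => absurd (Nat.le_of_dvd (by omega) h) (by omega), ?_, ?_, ?_⟩
  · obtain ⟨u, hu, hval⟩ := hval
    obtain ⟨w, hw⟩ := key (m + 1) hbj hbj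
    refine ⟨u + p * w, ?_, ?_⟩
    · rwa [Int.dvd_add_left (dvd_mul_right _ _)]
    · linear_combination hw + hval
  · intro i hi h
    have h1 := dvd_sub (hsq.trans (hbi i hi)) (hsq.trans hbj)
    have h2 := dvd_sub h1 h
    rw [show b i - 0 - (b j - a) - (b i - b j) = (a : ℤ) by ring] at h2
    exact hpa h2
  · intro i j' k h1 h2 h
    obtain ⟨hA, hZ, hZA⟩ := havoid k h1 h2
    by_cases hi : i = j
    · subst hi
      by_cases hj : j' = i
      · subst hj
        refine ⟨rfl, rfl, ?_⟩
        by_contra hk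
        exact hmin k h1 (by omega) ((Int.dvd_iff_dvd_of_dvd_sub (hsq.trans (key k hbj hbj))).mp h)
      · refine absurd ((Int.dvd_iff_dvd_of_dvd_sub (hsq.trans (key k hbj (hbi j' hj)))).mp h) ?_
        rwa [sub_zero]
    · by_cases hj : j' = j
      · subst hj
        exact absurd ((Int.dvd_iff_dvd_of_dvd_sub (hsq.trans (key k (hbi i hi) hbj))).mp h) hZA
      · refine absurd ((Int.dvd_iff_dvd_of_dvd_sub (hsq.trans (key k (hbi i hi)
          (hbi j' hj)))).mp h) ?_
        rwa [sub_zero]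

end Model

/-- A property of a polynomial and its critical points holds on a residue class modulo `p ^ 2`. -/
def HoldsOnClass {ι : Type*} [Fintype ι] (d : ℕ) (Φ : ℤ[X] → (ι → ℤ) → ℕ → Prop) (p : ℕ) : Prop :=
  ∃ (b₀ : ι → ℤ) (c₀ : ℤ), ∀ (f : ℤ[X]) (b : ι → ℤ), f.natDegree = d →
    derivative f = C (d : ℤ) * ∏ i, (X - C (b i)) → (∀ i, (p : ℤ) ^ 2 ∣ b i - b₀ i) →
    (p : ℤ) ^ 2 ∣ f.coeff 0 - c₀ → Φ f b p

section Classes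

variable {ι : Type*} [Fintype ι] {d : ℕ}

theorem holdsOnClass_eisenstein [Nonempty ι] (hd : 2 ≤ d) (hι : Fintype.card ι = d - 1) {p : ℕ}
    (hp : p.Prime) (hpd : d < p) :
    HoldsOnClass d (fun f (b : ι → ℤ) p => ∀ j, EisensteinPrime f 1 d (b j) p) p := by
  classical
  -- With `B = 0` the model is `X ^ d + p`.
  refine ⟨0, p, fun f b hfd hder hb hc j => ?_⟩
  refine EisensteinPrime.of_C_sq_dvd hp hd ?_ ?_ (by simpa using hb j)
  · have := C_sq_dvd_sub_bicriticalPoly (B := 0) (i₀ := j) hd hι hp hpd hfd hder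
      (by simpa using hb) hc
    simpa [bicriticalPoly] using this
  · rw [coeff_one_zero]
    intro h
    exact hp.one_lt.ne' (by exact_mod_cast Int.eq_one_of_dvd_one (by positivity) h)

theorem holdsOnClass_eisenstein_sub_C (hd : 3 ≤ d) (hι : Fintype.card ι = d - 1) (j : ι) {p : ℕ}
    (hp : p.Prime) (hpd : d < p) :
    HoldsOnClass d (fun f (b : ι → ℤ) p => EisensteinPrime f (X - C (d : ℤ)) (d - 1) (b j) p) p := by
  classical
  have : Nontrivial ι := Fintype.one_lt_card_iff_nontrivial.mp (by omega)
  obtain ⟨i₀, hi₀⟩ := exists_ne j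
  -- With `B = 1` the model is `X ^ (d - 1) * (X - d) + p`. Its nonzero critical point is placed at
  -- an index other than `j`, available since `d ≥ 3`, so that `b j` is near the origin.
  refine ⟨Pi.single i₀ (((d - 1) * 1 : ℕ) : ℤ), p, fun f b hfd hder hb hc => ?_⟩
  refine EisensteinPrime.of_C_sq_dvd hp (by omega) ?_ ?_ ?_
  · have := C_sq_dvd_sub_bicriticalPoly (B := 1) (i₀ := i₀) (by omega) hι hp hpd hfd hder hb hc
    rw [bicriticalPoly, mul_one] at this
    have h2 : (X ^ d : ℤ[X]) = X ^ (d - 1) * X := by rw [← pow_succ, Nat.sub_add_cancel (by omega)]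
    rw [mul_sub, ← h2, mul_comm (X ^ (d - 1)) (C _)]
    exact this
  · rw [coeff_sub, coeff_X_zero, coeff_C_zero, zero_sub, dvd_neg]
    intro h
    exact absurd (Nat.le_of_dvd (by omega) (by exact_mod_cast h : p ∣ d)) (by omega)
  · have := hb j
    rwa [Pi.single_eq_of_ne hi₀.symm, sub_zero] at this

theorem exists_holdsOnClass_transposition (hd : 2 ≤ d) (hι : Fintype.card ι = d - 1) (m : ℕ)
    (j : ι) (N : ℕ) :
    ∃ p : ℕ, p.Prime ∧ N < p ∧
      HoldsOnClass d (fun f (b : ι → ℤ) p => TranspositionPrime f b d m j p) p := by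
  classical
  -- Here `B = 8 * d`, the least value allowed by the escape estimate; `p` exceeds `(d - 1) * B` so
  -- that the two critical points stay distinct modulo `p`.
  obtain ⟨p, c, hp, hN, h1, h2, h3⟩ := exists_prime_bicritical hd le_rfl m
    (max N (max d ((d - 1) * (8 * d))))
  simp only [max_lt_iff] at hN
  refine ⟨p, hp, hN.1, Pi.single j (((d - 1) * (8 * d) : ℕ) : ℤ), c, fun f b hfd hder hb hc => ?_⟩
  exact TranspositionPrime.of_C_sq_dvd hd (by omega) hp hN.2.1 hN.2.2
    (C_sq_dvd_sub_bicriticalPoly hd hι hp hN.2.1 hfd hder hb hc) hb h1 h2 h3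

end Classes

theorem exists_injective_of_unbounded {J : Type*} [Finite J] {P : J → ℕ → Prop}
    (h : ∀ j N, ∃ p, N < p ∧ P j p) : ∃ φ : J → ℕ, Function.Injective φ ∧ ∀ j, P j (φ j) := by
  classical
  have := Fintype.ofFinite J
  suffices ∀ s : Finset J, ∃ φ : J → ℕ, Set.InjOn φ s ∧ ∀ j ∈ s, P j (φ j) by
    obtain ⟨φ, h1, h2⟩ := this Finset.univ
    exact ⟨φ, by simpa [Set.injOn_univ] using h1, fun j => h2 j (Finset.mem_univ j)⟩
  intro s
  induction s using Finset.induction_on with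
  | empty => exact ⟨0, by simp, by simp⟩
  | insert a s ha ih =>
    obtain ⟨φ, h1, h2⟩ := ih
    obtain ⟨p, hp, hPp⟩ := h a (s.sup φ)
    have hne : ∀ j ∈ s, φ j ≠ p := fun j hj => ((Finset.le_sup hj).trans_lt hp).ne
    have hja : ∀ j ∈ s, j ≠ a := fun j hj hja => ha (hja ▸ hj)
    refine ⟨Function.update φ a p, ?_, ?_⟩
    · rw [Finset.coe_insert, Set.injOn_insert (by exact_mod_cast ha)]
      refine ⟨h1.congr fun j hj => ?_, ?_⟩
      · rw [Function.update_of_ne (hja j hj)]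
      · rintro ⟨j, hj, hj'⟩
        rw [Function.update_self, Function.update_of_ne (hja j hj)] at hj'
        exact hne j hj hj'
    · intro j hj
      rcases Finset.mem_insert.mp hj with rfl | hj
      · rwa [Function.update_self]
      · rw [Function.update_of_ne (hja j hj)]
        exact h2 j hj

/-- Finitely many properties, each holding on residue classes modulo squares of arbitrarily large
primes, hold simultaneously on a residue class of points with integral antiderivative. -/
theorem exists_class_forall {ι J : Type*} [Fintype ι] [Finite J] {d : ℕ}
    {Φ : J → ℤ[X] → (ι → ℤ) → ℕ → Prop}
    (h : ∀ ρ N, ∃ p : ℕ, p.Prime ∧ N < p ∧ HoldsOnClass d (Φ ρ) p) (N : ℕ) :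
    ∃ (M : ℤ) (b₀ : ι → ℤ) (c₀ : ℤ), M ≠ 0 ∧ ∀ (b : ι → ℤ) (c : ℤ), (∀ i, M ∣ b i - b₀ i) →
      M ∣ c - c₀ → (∀ i, (d.factorial : ℤ) ∣ b i) ∧
      ∀ f : ℤ[X], f.natDegree = d → f.coeff 0 = c →
        derivative f = C (d : ℤ) * ∏ i, (X - C (b i)) → ∀ ρ, ∃ p, N < p ∧ Φ ρ f b p := by
  classical
  have := Fintype.ofFinite J
  obtain ⟨φ, hφ, hP⟩ := exists_injective_of_unbounded
    (P := fun ρ p => p.Prime ∧ max N d < p ∧ HoldsOnClass d (Φ ρ) p) (fun ρ N' => by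
      obtain ⟨p, h1, h2, h3⟩ := h ρ (max N' (max N d))
      rw [max_lt_iff] at h2
      exact ⟨p, h2.1, h1, h2.2, h3⟩)
  choose hprime hgt hclass using hP
  choose b' c' hΦ using hclass
  -- The moduli of the Chinese remainder theorem; the extra slot `none` imposes divisibility by
  -- `d!`.
  let μ : Option J → ℤ := fun o => o.elim (d.factorial : ℤ) fun ρ => (φ ρ : ℤ) ^ 2
  have hμ : Pairwise (Function.onFun IsCoprime fun o => Ideal.span {μ o}) := by
    have hfac : ∀ ρ, IsCoprime (d.factorial : ℤ) ((φ ρ : ℤ) ^ 2) := fun ρ => by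
      refine IsCoprime.pow_right (Nat.isCoprime_iff_coprime.mpr ?_)
      exact ((hprime ρ).coprime_factorial_of_lt ((le_max_right _ _).trans_lt (hgt ρ))).symm
    rintro (_ | ρ) (_ | ρ') hne
    · exact absurd rfl hne
    · exact Ideal.isCoprime_span_singleton_iff _ _ |>.mpr (hfac ρ')
    · exact Ideal.isCoprime_span_singleton_iff _ _ |>.mpr (hfac ρ).symm
    · refine Ideal.isCoprime_span_singleton_iff _ _ |>.mpr (IsCoprime.pow
        (Nat.isCoprime_iff_coprime.mpr ((Nat.coprime_primes (hprime ρ) (hprime ρ')).mpr ?_)))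
      exact fun h => hne (congrArg some (hφ h))
  have hcrt : ∀ x : Option J → ℤ, ∃ y : ℤ, ∀ o, μ o ∣ y - x o := by
    intro x
    obtain ⟨y, hy⟩ := Ideal.exists_forall_sub_mem_ideal hμ x
    exact ⟨y, fun o => Ideal.mem_span_singleton.mp (hy o)⟩
  choose b₀ hb₀ using fun i => hcrt fun o => o.elim 0 fun ρ => b' ρ i
  obtain ⟨c₀, hc₀⟩ := hcrt fun o => o.elim 0 c'
  have hM : ∀ o, μ o ∣ ∏ o, μ o := fun o => Finset.dvd_prod_of_mem _ (Finset.mem_univ o)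
  refine ⟨∏ o, μ o, b₀, c₀, Finset.prod_ne_zero_iff.mpr ?_, fun b c hb hc => ⟨fun i => ?_,
    fun f hfd hfc hder ρ => ⟨φ ρ, (le_max_left _ _).trans_lt (hgt ρ), ?_⟩⟩⟩
  · rintro (_ | ρ) -
    · exact Int.natCast_ne_zero.mpr d.factorial_ne_zero
    · exact pow_ne_zero _ (by exact_mod_cast (hprime ρ).ne_zero)
  · have := dvd_add ((hM none).trans (hb i)) (hb₀ i none)
    simpa [μ] using this
  · refine hΦ ρ f b hfd hder (fun i => ?_) ?_
    · have := dvd_add ((hM (some ρ)).trans (hb i)) (hb₀ i (some ρ))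
      simpa [μ] using this
    · have := dvd_add ((hM (some ρ)).trans hc) (hc₀ (some ρ))
      rw [hfc]
      simpa [μ] using this

/-- On a residue class of integral critical points and constant terms, the Galois group of the
preimages of the critical points is as large as possible. -/
theorem exists_class_nonempty_gal_mulEquiv (K : Type*) [Field K] [NumberField K] {d : ℕ}
    (hd : 2 ≤ d) (n : ℕ) {ι : Type*} [Fintype ι] (hι : Fintype.card ι = d - 1) :
    ∃ (M : ℤ) (b₀ : ι → ℤ) (c₀ : ℤ), M ≠ 0 ∧ ∀ (b : ι → ℤ) (c : ℤ), Function.Injective b →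
      (∀ i, M ∣ b i - b₀ i) → M ∣ c - c₀ →
      ∃ f : ℤ[X], f.Monic ∧ f.natDegree = d ∧ f.coeff 0 = c ∧
        derivative f = C (d : ℤ) * ∏ i, (X - C (b i)) ∧
        Nonempty (((derivative (f.map (algebraMap ℤ K))).comp
          (polyIterate (f.map (algebraMap ℤ K)) n)).Gal ≃* (ι → iteratedSymWreath d n)) := by
  have : Nonempty ι := Fintype.card_pos_iff.mp (by omega)
  -- One condition for transitivity over all roots, one per root for the stabilizers (vacuous when
  -- `d = 2`), and one per root and level for the swaps.
  let Φ : Option (ι × Option (Fin n)) → ℤ[X] → (ι → ℤ) → ℕ → Prop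
    | none => fun f b p => ∀ j, EisensteinPrime f 1 d (b j) p
    | some (j, none) => fun f b p => 3 ≤ d → EisensteinPrime f (X - C (d : ℤ)) (d - 1) (b j) p
    | some (j, some m) => fun f b p => TranspositionPrime f b d m j p
  have hbig : ∀ N, ∃ p : ℕ, p.Prime ∧ N < p ∧ d < p := fun N => by
    obtain ⟨p, hp, hpp⟩ := Nat.exists_infinite_primes (max N d + 1)
    rw [Nat.succ_le_iff, max_lt_iff] at hp
    exact ⟨p, hpp, hp⟩
  obtain ⟨M, b₀, c₀, hM, h⟩ := exists_class_forall (d := d) (Φ := Φ) (by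
    rintro (_ | ⟨j, _ | m⟩) N
    · obtain ⟨p, hp, hN, hpd⟩ := hbig N
      exact ⟨p, hp, hN, holdsOnClass_eisenstein hd hι hp hpd⟩
    · obtain ⟨p, hp, hN, hpd⟩ := hbig N
      refine ⟨p, hp, hN, ?_⟩
      by_cases h3 : 3 ≤ d
      · obtain ⟨b₀, c₀, h⟩ := holdsOnClass_eisenstein_sub_C h3 hι j hp hpd
        exact ⟨b₀, c₀, fun f b h1 h2 h4 h5 _ => h f b h1 h2 h4 h5⟩
      · exact ⟨0, 0, fun f b _ _ _ _ h => absurd h h3⟩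
    · exact exists_holdsOnClass_transposition hd hι m j N) (NumberField.discr K).natAbs
  have hdiscr : ∀ p : ℕ, (NumberField.discr K).natAbs < p → ¬ (p : ℤ) ∣ NumberField.discr K :=
    fun p hp hdvd => absurd (Nat.le_of_dvd (Int.natAbs_pos.mpr (NumberField.discr_ne_zero K))
      (Int.natCast_dvd.mp hdvd)) (by omega)
  refine ⟨M, b₀, c₀, hM, fun b c hinj hb hc => ?_⟩
  obtain ⟨hfac, hΦ⟩ := h b c hb hc
  obtain ⟨f, hf, hfd, hfc, hder⟩ := exists_monic_derivative_eq hd hι hfac c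
  have hΦ := hΦ f hfd hfc hder
  refine ⟨f, hf, hfd, hfc, hder, nonempty_gal_mulEquiv K hd hf hfd hinj hder ?_ ?_ ?_⟩
  · obtain ⟨p, hp, hE⟩ := hΦ none
    exact ⟨p, (hE (Classical.arbitrary ι)).prime, hdiscr p hp, hE⟩
  · intro h3 j
    obtain ⟨p, hp, hC⟩ := hΦ (some (j, none))
    exact ⟨p, d, hdiscr p hp, hC h3⟩
  · intro m hm j
    obtain ⟨p, hp, hT⟩ := hΦ (some (j, some ⟨m, hm⟩))
    exact ⟨p, hdiscr p hp, hT⟩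

end

/-! ### Zariski density and conclusion -/

section

open Polynomial

theorem isZariskiDense_of_forall {K σ : Type*} [Field K] {S : Set (σ → K)}
    (h : ∀ P : MvPolynomial σ K, (∀ v ∈ S, MvPolynomial.aeval v P = 0) → P = 0) :
    IsZariskiDense S := by
  rw [IsZariskiDense, Set.eq_univ_iff_forall]
  intro x P hP
  rw [h P hP, map_zero]

theorem paramPoint_injective {K : Type*} {d : ℕ} (hd : 1 < d) {b b' : Fin (d - 1) → K} {c c' : K}
    (h : paramPoint b c = paramPoint b' c') : b = b' ∧ c = c' := by
  constructor
  · funext i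
    have := congrFun h ⟨i, by omega⟩
    simpa [paramPoint] using this
  · have := congrFun h ⟨d - 1, by omega⟩
    simpa [paramPoint] using this

theorem eq_paramPoint {K : Type*} {d : ℕ} (hd : 1 < d) (v : Fin d → K) :
    v = paramPoint (fun i : Fin (d - 1) => v ⟨i, by omega⟩) (v ⟨d - 1, by omega⟩) := by
  funext i
  by_cases h : (i : ℕ) < d - 1
  · simp [paramPoint, h]
  · have : i = ⟨d - 1, by omega⟩ := Fin.ext (by have := i.2; simp only; omega)
    rw [this]
    simp [paramPoint]

theorem comp_paramPoint {K L : Type*} {d : ℕ} (φ : K → L) (b : Fin (d - 1) → K) (c : K) :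
    (fun i => φ (paramPoint b c i)) = paramPoint (fun i => φ (b i)) (φ c) := by
  funext i
  simp only [paramPoint]
  split_ifs <;> rfl

/-- Integer points in a residue class with distinct coordinates are Zariski dense. -/
theorem isZariskiDense_class {K σ : Type*} [Field K] [CharZero K] [Finite σ] {M : ℤ} (hM : M ≠ 0)
    (v₀ : σ → ℤ) :
    IsZariskiDense {v : σ → K | ∃ z : σ → ℤ, Function.Injective z ∧ (∀ i, M ∣ z i - v₀ i) ∧
      v = fun i => (z i : K)} := by
  classical
  have := Fintype.ofFinite σ
  refine isZariskiDense_of_forall fun P hP => ?_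
  -- Multiplying by all differences of coordinates disposes of the distinctness condition: `P * D`
  -- vanishes on a full product of infinite sets, hence is zero.
  set D : MvPolynomial σ K := ∏ x ∈ (Finset.univ : Finset σ).offDiag,
    (MvPolynomial.X x.1 - MvPolynomial.X x.2) with hD
  have hD0 : D ≠ 0 := Finset.prod_ne_zero_iff.mpr fun x hx =>
    sub_ne_zero.mpr fun h => (Finset.mem_offDiag.mp hx).2.2 (MvPolynomial.X_injective h)
  refine (mul_eq_zero.mp ?_).resolve_right hD0
  refine MvPolynomial.funext_set (fun i => {x : K | ∃ z : ℤ, M ∣ z - v₀ i ∧ x = z}) (fun i => ?_)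
    fun v hv => ?_
  · refine Set.Infinite.mono ?_ (Set.infinite_range_of_injective
      (f := fun t : ℤ => ((v₀ i + M * t : ℤ) : K)) ?_)
    · rintro _ ⟨t, rfl⟩
      exact ⟨_, by simp, rfl⟩
    · intro t t' h
      exact mul_left_cancel₀ hM (add_left_cancel (Int.cast_injective h))
  · choose z hz hvz using fun i => hv i (Set.mem_univ i)
    rw [map_mul, map_zero]
    by_cases hinj : Function.Injective z
    · have := hP v ⟨z, hinj, hz, funext hvz⟩
      rw [MvPolynomial.aeval_eq_eval] at this
      rw [this, zero_mul]
    · rw [Function.Injective] at hinj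
      push Not at hinj
      obtain ⟨i, j, hij, hne⟩ := hinj
      have : MvPolynomial.eval v D = 0 := by
        rw [hD, map_prod]
        refine Finset.prod_eq_zero (i := (i, j)) (by simpa using hne) ?_
        rw [map_sub, MvPolynomial.eval_X, MvPolynomial.eval_X, hvz, hvz j, hij, sub_self]
      rw [this, mul_zero]

theorem eq_of_derivative_eq {K : Type*} [Field K] [CharZero K] {f g : K[X]}
    (h : derivative f = derivative g) (h0 : f.coeff 0 = g.coeff 0) : f = g := by
  rw [← sub_eq_zero] at h
  rw [← derivative_sub] at h
  have h1 := eq_C_of_natDegree_eq_zero (derivative_eq_zero.mp h)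
  rw [coeff_sub, h0, sub_self, C_0] at h1
  exact sub_eq_zero.mp h1

theorem derivative_eq_C_mul_prod {K ι : Type*} [Field K] [CharZero K] [Fintype ι] {f : K[X]}
    {b : ι → K} (hf : f.Monic) (hι : Fintype.card ι = f.natDegree - 1)
    (hroots : (derivative f).roots = Finset.univ.val.map b) :
    derivative f = C (f.natDegree : K) * ∏ i, (X - C (b i)) := by
  have hcard : (derivative f).roots.card = (derivative f).natDegree := by
    rw [hroots, natDegree_derivative, Multiset.card_map, Finset.card_val, Finset.card_univ, hι]
  have := C_leadingCoeff_mul_prod_multiset_X_sub_C hcard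
  rw [← this, leadingCoeff_derivative, hf.leadingCoeff, one_mul, hroots, Multiset.map_map]
  rfl

end

theorem corollary3p7 (K : Type*) [Field K] [NumberField K] (d n : ℕ) (hd : 1 < d) :
    ∃ H : Set (Fin d → K), IsZariskiDense H ∧
      ∀ (f : Polynomial K) (b : Fin (d - 1) → K),
        f.Monic → f.natDegree = d →
        f.derivative.roots = Finset.univ.val.map b →
        paramPoint b (f.coeff 0) ∈ H →
        Nonempty ((f.derivative.comp (polyIterate f n)).Gal ≃*
          (Fin (d - 1) → iteratedSymWreath d n)) := by
  obtain ⟨M, b₀, c₀, hM, h⟩ := exists_class_nonempty_gal_mulEquiv K hd n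
    (ι := Fin (d - 1)) (Fintype.card_fin _)
  refine ⟨_, isZariskiDense_class hM (paramPoint b₀ c₀), ?_⟩
  rintro f b hf hfd hroots ⟨z, hinj, hz, hv⟩
  rw [eq_paramPoint hd z, comp_paramPoint (fun x : ℤ => (x : K))] at hv
  obtain ⟨hb, hc⟩ := paramPoint_injective hd hv
  obtain ⟨g, hg, hgd, hgc, hgder, hG⟩ := h (fun i => z ⟨i, by omega⟩) (z ⟨d - 1, by omega⟩)
    (fun i j hij => Fin.ext (by simpa using hinj hij))
    (fun i => by simpa [paramPoint] using hz ⟨i, by omega⟩)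
    (by simpa [paramPoint] using hz ⟨d - 1, by omega⟩)
  -- In characteristic zero the critical points and the constant term determine a monic polynomial
  -- of degree `d`, so `f` is the integral polynomial built from them.
  have hfg : f = g.map (algebraMap ℤ K) := by
    refine eq_of_derivative_eq ?_ ?_
    · rw [derivative_eq_C_mul_prod hf (by rw [hfd, Fintype.card_fin]) hroots, Polynomial.derivative_map, hgder,
        hfd, hb]
      simp [Polynomial.map_prod]
    · rw [Polynomial.coeff_map, hgc, hc]
      simp
  rw [hfg]
  exact hG
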